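/- **Setting.** Let $T\ge 1$, let $\omega$ be a primitive $T$-th root of unity, and let $\mathfrak g$ be a finite-dimensional complex Lie algebra with an automorphism $\sigma$ such that $\sigma^T=\mathrm{id}$, an antilinear involutive automorphism $\tau$ preserving each eigenspace of $\sigma$, and a nondegenerate invariant symmetric bilinear form $\langle\cdot,\cdot\rangle$ with $\langle\sigma x,\sigma y\rangle=\langle x,y\rangle$ and $\langle\tau x,\tau y\rangle=\overline{\langle x,y\rangle}$. Let $\widetilde{\mathfrak g}=\mathfrak g[t,t^{-1}]\oplus\mathbb CK\oplus\mathbb CD$ be the affine Kac–Moody algebra, with $x_n=x\otimes t^n$ and $$[x_m+\alpha K+aD,\;y_n+\beta K+bD]=[x,y]_{m+n}+na\,y_n-mb\,x_m+m\,\delta_{m+n,0}\langle x,y\rangle K .$$ Extend $\sigma,\tau$ to $\widetilde{\mathfrak g}$ by $\sigma x_n=(\sigma x)_n$, $\sigma K=K$, $\sigma D=D$, $\tau x_n=(\tau x)_{-n}$, $\tau K=-K$, $\tau D=-D$. The dihedral group $\Pi=\langle \mathsf s,\mathsf t\rangle$ of order $2T$ acts on $\mathbb C\cup\{\infty\}$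 by $\mathsf s z=\omega z$, $\mathsf t z=\bar z$, and on $\widetilde{\mathfrak g}$ by $\mathsf s\mapsto\sigma$, $\mathsf t\mapsto\tau$. Put $\mathsf F_n=\mathfrak g\otimes t^n\mathbb C[t]$ and $\overline{\mathsf F}_n=\mathfrak g\otimes t^{-n}\mathbb C[t^{-1}]$ for $n\ge 0$. Let $Z\subset\mathbb C$ be a finite set of points in pairwise different $\Pi$-orbits, with positive integers $n_x$ ($x\in Z$) and $n_\infty$. **The Lie algebra $\widetilde{\mathfrak g}^{\mathcal D}$.** It is the real Lie algebra consisting of the elements of $$\bigoplus_{x\in Z}\widetilde{\mathfrak g}\otimes\mathbb C[\varepsilon_x]/\varepsilon_x^{n_x}\;\oplus\;\widetilde{\mathfrak g}\otimes\varepsilon_\infty\mathbb C[\varepsilon_\infty]/\varepsilon_\infty^{n_\infty}$$ whose component at each point is invariant under the stabiliser of that point in $\Pi$. Here $\mathsf s^k\mathsf t^b$ acts by $X\otimes\varepsilon_x^p\mapsto\omega^{-kp}\sigma^k\tau^bX\otimes\varepsilon_x^p$ at $x\in Z$ and by $X\otimes\varepsilon_\infty^p\mapsto\omega^{kp}\sigma^k\tau^bX\otimes\varepsilon_\infty^p$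 at $\infty$. Set $\widetilde{\mathfrak g}^{\mathcal D}_{\mathbb C}=\widetilde{\mathfrak g}^{\mathcal D}\otimes_{\mathbb R}\mathbb C$, let $c$ be complex conjugation on the second factor and let $\varphi(u\otimes a)=au$. Let $\mathsf F_n(\widetilde{\mathfrak g}^{\mathcal D}_{\mathbb C})$ be the space of those $v$ for which all coefficients of $\varphi(v)$ lie in $\mathsf F_n$ and all coefficients of $\varphi(cv)$ lie in $\overline{\mathsf F}_n$. **Completions.** Let $\widetilde{\mathfrak g}\,\hat\otimes\,\widetilde{\mathfrak g}$ and $\mathfrak F$ be the completions of $\widetilde{\mathfrak g}\otimes\widetilde{\mathfrak g}$ and $\widetilde{\mathfrak g}\otimes\widetilde{\mathfrak g}^{\mathcal D}_{\mathbb C}$ with respect to $$\mathsf F_n\otimes\overline{\mathsf F}_n+\overline{\mathsf F}_n\otimes\mathsf F_n\qquad\text{and}\qquad \mathsf F_n\otimes c(\mathsf F_n(\widetilde{\mathfrak g}^{\mathcal D}_{\mathbb C}))+\overline{\mathsf F}_n\otimes\mathsf F_n(\widetilde{\mathfrak g}^{\mathcal D}_{\mathbb C}).$$ Writing $\overline{\mathsf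 F}_n(\widetilde{\mathfrak g}^{\mathcal D}_{\mathbb C})=c(\mathsf F_n(\widetilde{\mathfrak g}^{\mathcal D}_{\mathbb C}))$, let $\widetilde{\mathfrak g}\,\hat\otimes\,\widetilde{\mathfrak g}\,\hat\otimes\,\widetilde{\mathfrak g}^{\mathcal D}_{\mathbb C}$ be the completion with respect to the sum of the six subspaces of the triple tensor product that have $\mathsf F_n$ in one factor, $\overline{\mathsf F}_n$ in another and the whole Lie algebra in the third. Let $R_{\Pi z}$ be the algebra of rational functions of $z$ whose poles lie in $\Pi Z\cup\{\infty\}$, and $\mathfrak A$ the algebra of rational functions of $(z,z')\in\mathbb C^2$. **Dual bases.** For $k,p\in\mathbb Z$ let $\mathfrak g_{k,p}=\{x\in\mathfrak g:\sigma^k\tau x=\omega^{kp}x\}$ and $\mathfrak g_{(p)}=\{x\in\mathfrak g:\sigma x=\omega^px,\ \tau x=x\}$, and define $\widetilde{\mathfrak g}_{k,p}$, $\widetilde{\mathfrak g}_{(p)}$ by the same formulas in $\widetilde{\mathfrak g}$. Choose arbitrary real bases $I^a_{k,p}$ of $\mathfrak g_{k,p}$ and $I^{(p,\alpha)}$ of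 $\mathfrak g_{(p)}$, with dual bases $I_{a;k,-p}$ of $\mathfrak g_{k,-p}$ and $I_{(-p,\alpha)}$ of $\mathfrak g_{(-p)}$; write $I^a=I^a_{0,0}$ and $I_a=I_{a;0,0}$. The bases $I^{\tilde a}$ below are indexed by the modes of the finite bases together with $K$ and $D$: * $\widetilde{\mathfrak g}$ has the complex basis $I^{\tilde a}$: $I^a_n$ ($n\in\mathbb Z$), $K$, $D$, with dual basis $I_{\tilde a}$: $I_{a,-n}$, $D$, $K$. * $\widetilde{\mathfrak g}_{k,p}$ has the real basis $I^{\tilde a}_{k,p}$: $x_0$, $\tfrac1{\sqrt2}(x_n+x_{-n})$, $\tfrac{i}{\sqrt2}(x_n-x_{-n})$ ($n>0$) with $x=I^a_{k,p}$, and $i\eta^{-1}K$, $i\eta^{-1}D$ where $\eta^2=\omega^{kp}$. Its dual basis $I_{\tilde a;k,-p}$ is given by the same mode formulas with $x=I_{a;k,-p}$, and $-i\eta D$, $-i\eta K$. * $\widetilde{\mathfrak g}_{(p)}$ has the real basis $I^{(p,\tilde\alpha)}$ given by the same mode formulas with $x=I^{(p,\alpha)}$, together with $iK$, $iD$ if $T\mid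 p$. Its dual basis $I_{(-p,\tilde\alpha)}$ is given by the mode formulas with $x=I_{(-p,\alpha)}$, together with $-iD$, $-iK$ if $T\mid p$. **Formal Lax matrix.** The canonical element is $\Phi=\sum_A I_A\otimes I^A$ (tensor product over $\mathbb R$), with $I_A$ a $\widetilde{\mathfrak g}$-valued rational differential and $I^A\in\widetilde{\mathfrak g}^{\mathcal D}$. Here $\alpha\in\Pi$ acts on differentials by $\hat\alpha(X\otimes f\,dz)=\alpha X\otimes\alpha.(f\,dz)$ with $\mathsf s.(f\,dz)=\omega^{-1}f(\omega^{-1}z)\,dz$ and $\mathsf t.(f\,dz)=\overline{f(\bar z)}\,dz$. The pairs $(I^A,I_A)$ are, with $0\le p<n_x$: * at a nonzero $x\in Z$ fixed by no $\mathsf s^k\mathsf t$: $I^{\tilde a}\otimes\varepsilon_x^p$ with $\frac1{2T}\sum_{\alpha\in\Pi}\hat\alpha\big(I_{\tilde a}\otimes\frac{dz}{(z-x)^{p+1}}\big)$, and $iI^{\tilde a}\otimes\varepsilon_x^p$ with $\frac1{2T}\sum_{\alpha\in\Pi}\hat\alpha\big(-iI_{\tilde a}\otimes\frac{dz}{(z-x)^{p+1}}\big)$;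 * at a nonzero $x\in Z$ fixed by $\mathsf s^k\mathsf t$: $I^{\tilde a}_{k,p}\otimes\varepsilon_x^p$ with $\frac1T\sum_{l=0}^{T-1}\hat{\mathsf s}^l\big(I_{\tilde a;k,-p}\otimes\frac{dz}{(z-x)^{p+1}}\big)$; * at $x=0$, if $0\in Z$: $I^{(p,\tilde\alpha)}\otimes\varepsilon_0^p$ with $I_{(-p,\tilde\alpha)}\otimes z^{-p-1}dz$; * at $\infty$: $I^{(-q-1,\tilde\alpha)}\otimes\varepsilon_\infty^{q+1}$ with $-I_{(q+1,\tilde\alpha)}\otimes z^q\,dz$, for $0\le q\le n_\infty-2$. The formal Lax matrix $\mathcal L(z)$ is defined by $\zeta(\Phi)=\mathcal L(z)\,dz$, where $\zeta\big((X\otimes f\,dz)\otimes Y\big)=\big(X\otimes(Y\otimes1)\big)\otimes f\,dz$; infinite sums over modes are limits of the partial sums over $|n|<N$. The formal $r$-matrix is the element of $(\widetilde{\mathfrak g}\,\hat\otimes\,\widetilde{\mathfrak g})\otimes\mathfrak A$ $$\mathfrak r_{12}(z,z')=\frac1T\sum_{k=0}^{T-1}\frac{\sigma^kI^{\tilde a}\otimes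 I_{\tilde a}}{z'-\omega^{-k}z}$$ (summed over $\tilde a$). **Proposition.** The formal Lax matrix is a well defined element of $\mathfrak F\otimes R_{\Pi z}$: there is exactly one $\mathcal L\in\mathfrak F\otimes R_{\Pi z}$ with $\zeta(\Phi)=\mathcal L(z)\,dz$. In $(\widetilde{\mathfrak g}\,\hat\otimes\,\widetilde{\mathfrak g}\,\hat\otimes\,\widetilde{\mathfrak g}^{\mathcal D}_{\mathbb C})\otimes\mathfrak A$ it satisfies $$\{\mathcal L_1(z),\mathcal L_2(z')\}=[\mathfrak r_{12}(z,z'),\mathcal L_1(z)]-[\mathfrak r_{21}(z',z),\mathcal L_2(z')].$$ Here, for $u,v,w$ pure tensors, $\{u_1,v_2\}=u^1\otimes v^1\otimes[u^2,v^2]$ with the Lie bracket of $\widetilde{\mathfrak g}^{\mathcal D}_{\mathbb C}$ in the last factor, $[w_{12},v_1]=[w^1,v^1]\otimes w^2\otimes v^2$ and $[w_{21},v_2]=w^2\otimes[w^1,v^1]\otimes v^2$. These brackets are extended by continuity to the completions and bilinearly over rational functions. -/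

import Mathlib

open scoped TensorProduct
open ComplexConjugate

noncomputable section

namespace DihedralGaudin

/-! ## The finite-dimensional data -/

/-- The data attached to a complex Lie algebra `𝔤`: a positive integer `T`, a primitive `T`-th root
of unity `ω`, an automorphism `σ` of `𝔤` with `σ ^ T = id`, an antilinear involutive automorphism
`τ` of `𝔤` preserving every eigenspace of `σ`, and a nondegenerate invariant symmetric bilinear form
compatible with `σ` and `τ`. -/
structure Datum (𝔤 : Type*) [LieRing 𝔤] [LieAlgebra ℂ 𝔤] where
  T : ℕ
  T_pos : 0 < T
  ω : ℂ
  primitive : IsPrimitiveRoot ω T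
  σ : 𝔤 →ₗ⁅ℂ⁆ 𝔤
  σ_iterate : ∀ x, σ^[T] x = x
  τ : 𝔤 →ₛₗ[starRingEnd ℂ] 𝔤
  τ_lie : ∀ x y, τ ⁅x, y⁆ = ⁅τ x, τ y⁆
  τ_τ : ∀ x, τ (τ x) = x
  τ_eigenspace : ∀ (j : ℕ) (x : 𝔤), σ x = ω ^ j • x → σ (τ x) = ω ^ j • τ x
  form : LinearMap.BilinForm ℂ 𝔤
  form_symm : ∀ x y, form x y = form y x
  form_lie : ∀ x y z, form ⁅x, y⁆ z = form x ⁅y, z⁆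
  form_nondegenerate : ∀ x, (∀ y, form x y = 0) → x = 0
  form_σ : ∀ x y, form (σ x) (σ y) = form x y
  form_τ : ∀ x y, form (τ x) (τ y) = conj (form x y)

/-! ## The affine Kac-Moody algebra -/

variable {𝔤 : Type*} [LieRing 𝔤] [LieAlgebra ℂ 𝔤]

/-- The affine Kac-Moody algebra `𝔤[t, t⁻¹] ⊕ ℂ K ⊕ ℂ D`. An element is a triple consisting of
a Laurent polynomial `∑ₙ xₙ tⁿ` (stored as `n ↦ xₙ`), the coefficient of `K` and
the coefficient of `D`. -/
def KM (_D : Datum 𝔤) : Type _ := (ℤ →₀ 𝔤) × ℂ × ℂ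

namespace KM

variable {D : Datum 𝔤}

instance : AddCommGroup (KM D) := inferInstanceAs (AddCommGroup ((ℤ →₀ 𝔤) × ℂ × ℂ))
instance : Module ℂ (KM D) := inferInstanceAs (Module ℂ ((ℤ →₀ 𝔤) × ℂ × ℂ))

/-- The loop part of an element. -/
def loop : KM D →ₗ[ℂ] (ℤ →₀ 𝔤) := LinearMap.fst ℂ (ℤ →₀ 𝔤) (ℂ × ℂ)
/-- The coefficient of `K`. -/
def cK : KM D →ₗ[ℂ] ℂ := LinearMap.fst ℂ ℂ ℂ ∘ₗ LinearMap.snd ℂ (ℤ →₀ 𝔤) (ℂ × ℂ)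
/-- The coefficient of `D`. -/
def cD : KM D →ₗ[ℂ] ℂ := LinearMap.snd ℂ ℂ ℂ ∘ₗ LinearMap.snd ℂ (ℤ →₀ 𝔤) (ℂ × ℂ)

/-- The element with prescribed components. -/
def mk (f : ℤ →₀ 𝔤) (α a : ℂ) : KM D := (f, α, a)

@[simp] theorem loop_mk (f : ℤ →₀ 𝔤) (α a : ℂ) : loop (mk f α a : KM D) = f := rfl
@[simp] theorem cK_mk (f : ℤ →₀ 𝔤) (α a : ℂ) : cK (mk f α a : KM D) = α := rfl
@[simp] theorem cD_mk (f : ℤ →₀ 𝔤) (α a : ℂ) : cD (mk f α a : KM D) = a := rfl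

theorem ext' {X Y : KM D} (h : ∀ n, loop X n = loop Y n) (hK : cK X = cK Y) (hD : cD X = cD Y) :
    X = Y :=
  Prod.ext (Finsupp.ext h) (Prod.ext hK hD)

/-- `xₙ = x ⊗ tⁿ`. -/
def mode (n : ℤ) (x : 𝔤) : KM D := mk (Finsupp.single n x) 0 0
/-- The central element `K`. -/
def K : KM D := mk 0 1 0
/-- The derivation element `D`. -/
def der : KM D := mk 0 0 1

/-- The bracket of the loop algebra, `[x tᵐ, y tⁿ] = [x, y] tᵐ⁺ⁿ`. -/
def loopBracket (f g : ℤ →₀ 𝔤) : ℤ →₀ 𝔤 :=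
  f.sum fun m x => g.sum fun n y => Finsupp.single (m + n) ⁅x, y⁆

/-- The derivation `t d/dt`. -/
def degree (f : ℤ →₀ 𝔤) : ℤ →₀ 𝔤 := f.sum fun n x => Finsupp.single n ((n : ℂ) • x)

/-- The cocycle `(x tᵐ, y tⁿ) ↦ m δ_{m+n,0} ⟨x, y⟩`. -/
def cocycle (D : Datum 𝔤) (f g : ℤ →₀ 𝔤) : ℂ :=
  f.sum fun m x => g.sum fun n y => if m + n = 0 then (m : ℂ) * D.form x y else 0

/-- `[xₘ + αK + aD, yₙ + βK + bD] = [x,y]ₘ₊ₙ + n a yₙ - m b xₘ + m δ_{m+n,0} ⟨x,y⟩ K`. -/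
instance : Bracket (KM D) (KM D) where
  bracket X Y := mk
    (loopBracket (loop X) (loop Y) + cD X • degree (loop Y) - cD Y • degree (loop X))
    (cocycle D (loop X) (loop Y)) 0

theorem lie_def (X Y : KM D) : ⁅X, Y⁆ = mk
    (loopBracket (loop X) (loop Y) + cD X • degree (loop Y) - cD Y • degree (loop X))
    (cocycle D (loop X) (loop Y)) 0 := rfl

theorem loopBracket_add_left (f f' g : ℤ →₀ 𝔤) :
    loopBracket (f + f') g = loopBracket f g + loopBracket f' g := by
  unfold loopBracket
  rw [Finsupp.sum_add_index'] <;> intros <;> simp [Finsupp.single_add]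

theorem loopBracket_add_right (f g g' : ℤ →₀ 𝔤) :
    loopBracket f (g + g') = loopBracket f g + loopBracket f g' := by
  unfold loopBracket
  rw [← Finsupp.sum_add]
  refine Finsupp.sum_congr fun m _ => ?_
  rw [Finsupp.sum_add_index'] <;> intros <;> simp [Finsupp.single_add]

theorem loopBracket_smul_right (c : ℂ) (f g : ℤ →₀ 𝔤) :
    loopBracket f (c • g) = c • loopBracket f g := by
  unfold loopBracket
  rw [Finsupp.smul_sum]
  refine Finsupp.sum_congr fun m _ => ?_
  rw [Finsupp.sum_smul_index' (by simp), Finsupp.smul_sum]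
  simp [Finsupp.smul_single]

theorem cocycle_add_left (f f' g : ℤ →₀ 𝔤) :
    cocycle D (f + f') g = cocycle D f g + cocycle D f' g := by
  unfold cocycle
  rw [Finsupp.sum_add_index']
  · simp
  · intro m x y
    rw [← Finsupp.sum_add]
    refine Finsupp.sum_congr fun n _ => ?_
    split_ifs <;> simp [mul_add]

theorem cocycle_add_right (f g g' : ℤ →₀ 𝔤) :
    cocycle D f (g + g') = cocycle D f g + cocycle D f g' := by
  unfold cocycle
  rw [← Finsupp.sum_add]
  refine Finsupp.sum_congr fun m _ => ?_
  rw [Finsupp.sum_add_index']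
  · simp
  · intro n x y
    split_ifs <;> simp [mul_add]

theorem cocycle_smul_right (c : ℂ) (f g : ℤ →₀ 𝔤) :
    cocycle D f (c • g) = c * cocycle D f g := by
  unfold cocycle
  rw [← smul_eq_mul, Finsupp.smul_sum]
  refine Finsupp.sum_congr fun m _ => ?_
  rw [Finsupp.sum_smul_index' (by simp), Finsupp.smul_sum]
  refine Finsupp.sum_congr fun n _ => ?_
  split_ifs
  · simp only [map_smul, smul_eq_mul]; ring
  · simp

theorem degree_add (f g : ℤ →₀ 𝔤) : degree (f + g) = degree f + degree g := by
  unfold degree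
  rw [Finsupp.sum_add_index'] <;> intros <;> simp [Finsupp.single_add]

theorem degree_smul (c : ℂ) (f : ℤ →₀ 𝔤) : degree (c • f) = c • degree f := by
  unfold degree
  rw [Finsupp.sum_smul_index' (by simp), Finsupp.smul_sum]
  refine Finsupp.sum_congr fun n _ => ?_
  rw [Finsupp.smul_single, smul_comm]

@[simp] theorem degree_zero : degree (0 : ℤ →₀ 𝔤) = 0 := by simp [degree]
@[simp] theorem degree_single (n : ℤ) (x : 𝔤) :
    degree (Finsupp.single n x) = Finsupp.single n ((n : ℂ) • x) := by
  unfold degree; rw [Finsupp.sum_single_index]; simp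
@[simp] theorem loopBracket_single (m n : ℤ) (x y : 𝔤) :
    loopBracket (Finsupp.single m x) (Finsupp.single n y) = Finsupp.single (m + n) ⁅x, y⁆ := by
  unfold loopBracket
  rw [Finsupp.sum_single_index (by simp), Finsupp.sum_single_index (by simp)]
@[simp] theorem cocycle_single (m n : ℤ) (x y : 𝔤) :
    cocycle D (Finsupp.single m x) (Finsupp.single n y)
      = if m + n = 0 then (m : ℂ) * D.form x y else 0 := by
  unfold cocycle
  rw [Finsupp.sum_single_index (by simp), Finsupp.sum_single_index (by simp)]

/-- `xₙ + αK + aD`. -/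
def elem (n : ℤ) (x : 𝔤) (α a : ℂ) : KM D := mk (Finsupp.single n x) α a

@[simp] theorem loop_elem (n : ℤ) (x : 𝔤) (α a : ℂ) :
    loop (elem n x α a : KM D) = Finsupp.single n x := rfl
@[simp] theorem cK_elem (n : ℤ) (x : 𝔤) (α a : ℂ) : cK (elem n x α a : KM D) = α := rfl
@[simp] theorem cD_elem (n : ℤ) (x : 𝔤) (α a : ℂ) : cD (elem n x α a : KM D) = a := rfl

theorem induction {p : KM D → Prop} (h0 : ∀ n x α a, p (elem n x α a))
    (hadd : ∀ X Y, p X → p Y → p (X + Y)) (X : KM D) : p X := by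
  obtain ⟨f, α, a⟩ := X
  suffices h : ∀ f : ℤ →₀ 𝔤, p (mk f 0 0) by
    have := hadd _ _ (h f) (h0 0 0 α a)
    have e : (mk f 0 0 + elem 0 0 α a : KM D) = (f, α, a) := by
      refine ext' (fun n => ?_) ?_ ?_
      · simp; rfl
      · simp; rfl
      · simp; rfl
    rwa [e] at this
  intro f
  induction f using Finsupp.induction_linear with
  | zero => simpa [elem] using h0 0 0 0 0
  | add f g hf hg =>
    have := hadd _ _ hf hg
    have e : (mk f 0 0 + mk g 0 0 : KM D) = mk (f + g) 0 0 := ext' (by simp) (by simp) (by simp)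
    rwa [e] at this
  | single n x => exact h0 n x 0 0

theorem lie_elem (m n : ℤ) (x y : 𝔤) (α a β b : ℂ) :
    ⁅(elem m x α a : KM D), (elem n y β b : KM D)⁆
      = mk (Finsupp.single (m + n) ⁅x, y⁆ + Finsupp.single n ((a * n) • y)
          - Finsupp.single m ((b * m) • x))
        (if m + n = 0 then (m : ℂ) * D.form x y else 0) 0 := by
  simp [lie_def, mul_smul]

theorem add_lie' (X Y Z : KM D) : ⁅X + Y, Z⁆ = ⁅X, Z⁆ + ⁅Y, Z⁆ := by
  refine ext' (fun n => ?_) ?_ ?_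
  · simp only [lie_def, map_add, loop_mk, loopBracket_add_left, degree_add, add_smul, smul_add,
      Finsupp.add_apply, Finsupp.sub_apply]
    abel
  · simp [lie_def, cocycle_add_left]
  · simp [lie_def]

theorem lie_add' (X Y Z : KM D) : ⁅X, Y + Z⁆ = ⁅X, Y⁆ + ⁅X, Z⁆ := by
  refine ext' (fun n => ?_) ?_ ?_
  · simp only [lie_def, map_add, loop_mk, loopBracket_add_right, degree_add, add_smul, smul_add,
      Finsupp.add_apply, Finsupp.sub_apply]
    abel
  · simp [lie_def, cocycle_add_right]
  · simp [lie_def]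

theorem lie_swap (X : KM D) : ∀ Y : KM D, ⁅X, Y⁆ = -⁅Y, X⁆ := by
  induction X using KM.induction with
  | hadd X Y hX hY => intro Z; rw [add_lie', lie_add', hX, hY, neg_add]
  | h0 m x α a =>
    intro Y
    induction Y using KM.induction with
    | hadd X Y hX hY => rw [add_lie', lie_add', hX, hY, neg_add]
    | h0 n y β b =>
      rw [lie_elem, lie_elem]
      refine ext' (fun r => ?_) ?_ ?_
      · simp only [loop_mk, map_neg, Finsupp.neg_apply, Finsupp.sub_apply, Finsupp.add_apply]
        rw [← lie_skew x y, add_comm m n, Finsupp.single_neg, Finsupp.neg_apply]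
        abel
      · simp only [cK_mk, map_neg]
        by_cases h : m + n = 0
        · rw [if_pos h, if_pos (by omega), D.form_symm y x]
          obtain rfl : n = -m := by omega
          push_cast; ring
        · rw [if_neg h, if_neg (by omega), neg_zero]
      · simp

theorem lie_elem' (m n : ℤ) (x y : 𝔤) (α a β b : ℂ) :
    ⁅(elem m x α a : KM D), (elem n y β b : KM D)⁆
      = elem (m + n) ⁅x, y⁆ (if m + n = 0 then (m : ℂ) * D.form x y else 0) 0
        + elem n ((a * n) • y) 0 0 + elem m (-((b * m) • x)) 0 0 := by
  rw [lie_elem]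
  refine ext' (fun r => ?_) ?_ ?_ <;> simp [sub_eq_add_neg]

theorem leibniz' (X : KM D) : ∀ Y Z : KM D, ⁅X, ⁅Y, Z⁆⁆ = ⁅⁅X, Y⁆, Z⁆ + ⁅Y, ⁅X, Z⁆⁆ := by
  induction X using KM.induction with
  | hadd X X' hX hX' =>
    intro Y Z
    simp only [add_lie', lie_add', hX, hX']
    abel
  | h0 m x α a =>
    intro Y
    induction Y using KM.induction with
    | hadd Y Y' hY hY' =>
      intro Z
      simp only [add_lie', lie_add', hY, hY']
      abel
    | h0 n y β b =>
      intro Z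
      induction Z using KM.induction with
      | hadd Z Z' hZ hZ' =>
        simp only [lie_add', hZ, hZ']
        abel
      | h0 p z γ c =>
        simp only [lie_elem', add_lie', lie_add']
        refine ext' (DFunLike.congr_fun (?_ : loop _ = loop _)) ?_ ?_
        · simp only [map_add, loop_elem, add_left_comm n m p, add_assoc]
          rw [add_comm n m, leibniz_lie x y z]
          simp only [zero_mul, zero_smul, neg_zero, lie_neg, neg_lie, smul_lie, lie_smul, smul_neg,
            Finsupp.single_add, Finsupp.single_neg, Finsupp.single_zero, ← Finsupp.smul_single]
          rw [← lie_skew y x, Finsupp.single_neg]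
          push_cast
          module
        · simp only [map_add, cK_elem, map_smul, map_neg, LinearMap.neg_apply,
            LinearMap.smul_apply, smul_eq_mul, zero_mul, zero_smul, neg_zero, add_zero]
          have e1 : D.form ⁅x, y⁆ z = D.form x ⁅y, z⁆ := D.form_lie x y z
          have e2 : D.form y ⁅x, z⁆ = - D.form x ⁅y, z⁆ := by
            rw [← D.form_lie, ← lie_skew, map_neg, LinearMap.neg_apply, e1]
          have e3 : D.form y x = D.form x y := D.form_symm y x
          rw [e1, e2, e3]
          split_ifs <;> first | omega | skip
          all_goals try (have hh : n = -m := (by omega); subst hh)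
          all_goals try (have hh : p = -m - n := (by omega); subst hh)
          all_goals try (have hh : p = -m := (by omega); subst hh)
          all_goals try (have hh : p = -n := (by omega); subst hh)
          all_goals try (have hh : p = 0 := (by omega); subst hh)
          all_goals try (have hh : n = m := (by omega); subst hh)
          all_goals try (have hh : p = m := (by omega); subst hh)
          all_goals try (have hh : m = 0 := (by omega); subst hh)
          all_goals try (have hh : n = 0 := (by omega); subst hh)
          all_goals push_cast
          all_goals ring
        · simp

instance : LieRing (KM D) where
  add_lie := add_lie'
  lie_add := lie_add'
  lie_self X := by
    have h := lie_swap X X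
    have h2 : (2 : ℂ) • ⁅X, X⁆ = 0 := by
      rw [two_smul]; nth_rewrite 1 [h]; exact neg_add_cancel _
    exact (smul_eq_zero.1 h2).resolve_left two_ne_zero
  leibniz_lie := leibniz'

instance : LieAlgebra ℂ (KM D) where
  lie_smul c X Y := by
    refine ext' (fun n => ?_) ?_ ?_
    · simp only [lie_def, map_smul, loop_mk, loopBracket_smul_right, degree_smul,
        Finsupp.add_apply, Finsupp.sub_apply, Finsupp.smul_apply, smul_eq_mul]
      module
    · simp [lie_def, cocycle_smul_right]
    · simp [lie_def]

/-- The automorphism `σ`, acting on modes by `xₙ ↦ (σ x)ₙ` and fixing `K` and `D`. -/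
def sigma : KM D →ₗ[ℂ] KM D where
  toFun X := mk ((loop X).mapRange D.σ (map_zero D.σ)) (cK X) (cD X)
  map_add' X Y := ext' (by simp) (by simp) (by simp)
  map_smul' c X := ext' (by simp) (by simp) (by simp)

/-- The antilinear automorphism `τ`, acting on modes by `xₙ ↦ (τ x)₋ₙ` and sending `K`, `D`
to `-K`, `-D`. -/
def tau : KM D →ₛₗ[starRingEnd ℂ] KM D where
  toFun X := mk (((loop X).mapRange D.τ (map_zero D.τ)).equivMapDomain (Equiv.neg ℤ))
    (-conj (cK X)) (-conj (cD X))
  map_add' X Y := ext' (by simp) (by simp; ring) (by simp; ring)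
  map_smul' c X := ext' (by simp) (by simp) (by simp)

@[simp] theorem loop_sigma (X : KM D) (n : ℤ) : loop (sigma X) n = D.σ (loop X n) := rfl
@[simp] theorem cK_sigma (X : KM D) : cK (sigma X) = cK X := rfl
@[simp] theorem cD_sigma (X : KM D) : cD (sigma X) = cD X := rfl
@[simp] theorem loop_tau (X : KM D) (n : ℤ) : loop (tau X) n = D.τ (loop X (-n)) := rfl
@[simp] theorem cK_tau (X : KM D) : cK (tau X) = -conj (cK X) := rfl
@[simp] theorem cD_tau (X : KM D) : cD (tau X) = -conj (cD X) := rfl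

theorem sigma_elem (n : ℤ) (x : 𝔤) (α a : ℂ) :
    sigma (elem n x α a : KM D) = elem n (D.σ x) α a :=
  ext' (fun r => by simp [Finsupp.single_apply]; split_ifs <;> simp) (by simp) (by simp)

theorem tau_elem (n : ℤ) (x : 𝔤) (α a : ℂ) :
    tau (elem n x α a : KM D) = elem (-n) (D.τ x) (-conj α) (-conj a) :=
  ext' (fun r => by
    by_cases h : n = -r
    · subst h; simp
    · simp [h, show ¬ (-n = r) by omega]) (by simp) (by simp)

theorem sigma_lie (X Y : KM D) : sigma ⁅X, Y⁆ = ⁅sigma X, sigma Y⁆ := by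
  induction X using KM.induction with
  | hadd X X' h h' => simp only [add_lie, map_add, h, h']
  | h0 m x α a =>
    induction Y using KM.induction with
    | hadd Y Y' h h' => simp only [lie_add, map_add, h, h']
    | h0 n y β b =>
      simp only [lie_elem', sigma_elem, map_add, D.form_σ, map_smul, map_neg, LieHom.map_lie]

theorem tau_lie (X Y : KM D) : tau ⁅X, Y⁆ = ⁅tau X, tau Y⁆ := by
  induction X using KM.induction with
  | hadd X X' h h' => simp only [add_lie, map_add, h, h']
  | h0 m x α a =>
    induction Y using KM.induction with
    | hadd Y Y' h h' => simp only [lie_add, map_add, h, h']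
    | h0 n y β b =>
      simp only [lie_elem', tau_elem, map_add, D.form_τ, map_smulₛₗ, map_neg, D.τ_lie, map_mul,
        map_zero, neg_zero]
      have e : (-m + -n = 0) ↔ (m + n = 0) := by omega
      simp only [e, map_intCast, Int.cast_neg, neg_mul_neg, neg_add]
      congr 3
      split_ifs <;> simp

/-- `τ` as a real linear map. -/
def tauR : KM D →ₗ[ℝ] KM D where
  toFun := tau
  map_add' := map_add tau
  map_smul' r X := by
    change tau ((r : ℂ) • X) = (r : ℂ) • tau X
    rw [map_smulₛₗ, Complex.conj_ofReal]

/-- The action `σᵏ τᵇ` of the dihedral group element `sᵏ tᵇ` on the affine algebra. -/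
def act (k : ℕ) (b : Bool) : KM D →ₗ[ℝ] KM D :=
  ((sigma.restrictScalars ℝ : KM D →ₗ[ℝ] KM D) ^ k) ∘ₗ (if b then tauR else LinearMap.id)

theorem act_lie (k : ℕ) (b : Bool) (X Y : KM D) : act k b ⁅X, Y⁆ = ⁅act k b X, act k b Y⁆ := by
  have h : ∀ (k : ℕ) (X Y : KM D), ((sigma.restrictScalars ℝ : KM D →ₗ[ℝ] KM D) ^ k) ⁅X, Y⁆
      = ⁅((sigma.restrictScalars ℝ : KM D →ₗ[ℝ] KM D) ^ k) X,
        ((sigma.restrictScalars ℝ : KM D →ₗ[ℝ] KM D) ^ k) Y⁆ := by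
    intro k
    induction k with
    | zero => intro X Y; simp
    | succ k ih => intro X Y; simp only [pow_succ', Module.End.mul_apply, ih]; exact sigma_lie _ _
  cases b
  · exact h k X Y
  · change ((sigma.restrictScalars ℝ : KM D →ₗ[ℝ] KM D) ^ k) (tau ⁅X, Y⁆) = _
    rw [tau_lie]
    exact h k _ _

instance : LieAlgebra ℝ (KM D) where
  lie_smul r X Y := lie_smul (r : ℂ) X Y

/-- `𝖥ₙ = 𝔤 ⊗ tⁿ ℂ[t]`. -/
def filt (D : Datum 𝔤) (n : ℕ) : Submodule ℂ (KM D) where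
  carrier := {X | (∀ m : ℤ, m < n → loop X m = 0) ∧ cK X = 0 ∧ cD X = 0}
  zero_mem' := by simp
  add_mem' := by
    rintro X Y ⟨h1, h2, h3⟩ ⟨h1', h2', h3'⟩
    exact ⟨fun m hm => by simp [h1 m hm, h1' m hm], by simp [h2, h2'], by simp [h3, h3']⟩
  smul_mem' := by
    rintro c X ⟨h1, h2, h3⟩
    exact ⟨fun m hm => by simp [h1 m hm], by simp [h2], by simp [h3]⟩

/-- `𝖥̄ₙ = 𝔤 ⊗ t⁻ⁿ ℂ[t⁻¹]`. -/
def filtBar (D : Datum 𝔤) (n : ℕ) : Submodule ℂ (KM D) where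
  carrier := {X | (∀ m : ℤ, -(n : ℤ) < m → loop X m = 0) ∧ cK X = 0 ∧ cD X = 0}
  zero_mem' := by simp
  add_mem' := by
    rintro X Y ⟨h1, h2, h3⟩ ⟨h1', h2', h3'⟩
    exact ⟨fun m hm => by simp [h1 m hm, h1' m hm], by simp [h2, h2'], by simp [h3, h3']⟩
  smul_mem' := by
    rintro c X ⟨h1, h2, h3⟩
    exact ⟨fun m hm => by simp [h1 m hm], by simp [h2], by simp [h3]⟩

end KM

/-! ## Takiff algebras -/

/-- The Takiff algebra `L ⊗ ℂ[ε]/εⁿ`; the element `∑ₚ Xₚ εᵖ` is stored as `p ↦ Xₚ`. -/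
def Takiff (L : Type*) (n : ℕ) : Type _ := Fin n → L

namespace Takiff

variable {L : Type*} [LieRing L] {n : ℕ}

instance : AddCommGroup (Takiff L n) := inferInstanceAs (AddCommGroup (Fin n → L))
instance [LieAlgebra ℂ L] : Module ℂ (Takiff L n) := inferInstanceAs (Module ℂ (Fin n → L))

/-- `[X εᵖ, Y ε^q] = [X, Y] ε^{p+q}`. -/
instance : Bracket (Takiff L n) (Takiff L n) where
  bracket X Y r := ∑ p : Fin n, ∑ q : Fin n, if (p : ℕ) + q = r then ⁅X p, Y q⁆ else 0

theorem lie_apply (X Y : Takiff L n) (r : Fin n) :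
    ⁅X, Y⁆ r = ∑ p : Fin n, ∑ q : Fin n, if (p : ℕ) + q = r then ⁅X p, Y q⁆ else 0 := rfl

theorem sum_ite_eq_add (p q s r : Fin n) (v : L) :
    (∑ u : Fin n, if (p : ℕ) + u = r then (if (q : ℕ) + s = u then v else 0) else 0)
      = if (p : ℕ) + (q + s) = r then v else 0 := by
  by_cases h : (p : ℕ) + (q + s) = r
  · have hr := r.isLt
    rw [if_pos h, Finset.sum_eq_single_of_mem (⟨q + s, by omega⟩ : Fin n) (Finset.mem_univ _)]
    · simp [h]
    · intro u _ hu
      have : ¬ ((q : ℕ) + s = u) := fun e => hu (Fin.ext e.symm)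
      simp [this]
  · rw [if_neg h]
    refine Finset.sum_eq_zero fun u _ => ?_
    split_ifs with h1 h2
    · exact absurd (by rw [h2, h1]) h
    · rfl
    · rfl

theorem lie_lie_right (X Y Z : Takiff L n) (r : Fin n) : ⁅X, ⁅Y, Z⁆⁆ r =
    ∑ p : Fin n, ∑ q : Fin n, ∑ s : Fin n,
      if (p : ℕ) + (q + s) = r then ⁅X p, ⁅Y q, Z s⁆⁆ else 0 := by
  have h1 : ∀ p u : Fin n, (if (p : ℕ) + u = r then ⁅X p, ⁅Y, Z⁆ u⁆ else 0) =
      ∑ q : Fin n, ∑ s : Fin n,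
        if (p : ℕ) + u = r then (if (q : ℕ) + s = u then ⁅X p, ⁅Y q, Z s⁆⁆ else 0) else 0 := by
    intro p u
    split_ifs
    · rw [lie_apply, lie_sum]
      refine Finset.sum_congr rfl fun q _ => ?_
      rw [lie_sum]
      refine Finset.sum_congr rfl fun s _ => ?_
      split_ifs <;> simp
    · simp
  rw [lie_apply]
  refine Finset.sum_congr rfl fun p _ => ?_
  simp_rw [h1]
  rw [Finset.sum_comm]
  refine Finset.sum_congr rfl fun q _ => ?_
  rw [Finset.sum_comm]
  exact Finset.sum_congr rfl fun s _ => sum_ite_eq_add p q s r _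

theorem lie_skew' (X Y : Takiff L n) : ⁅X, Y⁆ = -⁅Y, X⁆ := by
  funext r
  change ⁅X, Y⁆ r = -(⁅Y, X⁆ r)
  rw [lie_apply, lie_apply, Finset.sum_comm, ← Finset.sum_neg_distrib]
  refine Finset.sum_congr rfl fun p _ => ?_
  rw [← Finset.sum_neg_distrib]
  refine Finset.sum_congr rfl fun q _ => ?_
  rw [add_comm (q : ℕ), ← lie_skew]
  split_ifs <;> simp

instance : LieRing (Takiff L n) where
  add_lie X Y Z := by
    funext r
    change ⁅X + Y, Z⁆ r = ⁅X, Z⁆ r + ⁅Y, Z⁆ r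
    simp only [lie_apply, ← Finset.sum_add_distrib]
    refine Finset.sum_congr rfl fun p _ => Finset.sum_congr rfl fun q _ => ?_
    split_ifs
    · exact add_lie (X p) (Y p) (Z q)
    · simp
  lie_add X Y Z := by
    funext r
    change ⁅X, Y + Z⁆ r = ⁅X, Y⁆ r + ⁅X, Z⁆ r
    simp only [lie_apply, ← Finset.sum_add_distrib]
    refine Finset.sum_congr rfl fun p _ => Finset.sum_congr rfl fun q _ => ?_
    split_ifs
    · exact lie_add (X p) (Y q) (Z q)
    · simp
  lie_self X := by
    have key : ∀ r, ⁅X, X⁆ r = 0 := by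
      intro r
      rw [lie_apply, ← Finset.sum_product']
      refine Finset.sum_involution (fun a _ => (a.2, a.1)) ?_ ?_ ?_ ?_
      · rintro ⟨p, q⟩ _
        simp only [add_comm (q : ℕ)]
        split_ifs
        · rw [← lie_skew (X p) (X q), neg_add_cancel]
        · simp
      · rintro ⟨p, q⟩ _ h e
        simp only [Prod.mk.injEq] at e
        obtain ⟨rfl, -⟩ := e
        simp at h
      · simp
      · simp
    funext r
    exact key r
  leibniz_lie X Y Z := by
    funext r
    change ⁅X, ⁅Y, Z⁆⁆ r = ⁅⁅X, Y⁆, Z⁆ r + ⁅Y, ⁅X, Z⁆⁆ r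
    rw [lie_skew' ⁅X, Y⁆ Z]
    change _ = -(⁅Z, ⁅X, Y⁆⁆ r) + _
    rw [lie_lie_right, lie_lie_right, lie_lie_right]
    have e1 : (∑ p : Fin n, ∑ q : Fin n, ∑ s : Fin n,
        if (p : ℕ) + (q + s) = r then ⁅Z p, ⁅X q, Y s⁆⁆ else 0) =
        ∑ p : Fin n, ∑ q : Fin n, ∑ s : Fin n,
        if (p : ℕ) + (q + s) = r then ⁅Z s, ⁅X p, Y q⁆⁆ else 0 := by
      rw [Finset.sum_comm]
      refine Finset.sum_congr rfl fun p _ => ?_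
      rw [Finset.sum_comm]
      refine Finset.sum_congr rfl fun q _ => Finset.sum_congr rfl fun s _ => ?_
      rw [show (s : ℕ) + (p + q) = p + (q + s) by ring]
    have e2 : (∑ p : Fin n, ∑ q : Fin n, ∑ s : Fin n,
        if (p : ℕ) + (q + s) = r then ⁅Y p, ⁅X q, Z s⁆⁆ else 0) =
        ∑ p : Fin n, ∑ q : Fin n, ∑ s : Fin n,
        if (p : ℕ) + (q + s) = r then ⁅Y q, ⁅X p, Z s⁆⁆ else 0 := by
      rw [Finset.sum_comm]
      refine Finset.sum_congr rfl fun p _ => Finset.sum_congr rfl fun q _ =>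
        Finset.sum_congr rfl fun s _ => ?_
      rw [show (q : ℕ) + (p + s) = p + (q + s) by ring]
    rw [e1, e2]
    simp only [← Finset.sum_neg_distrib, ← Finset.sum_add_distrib]
    refine Finset.sum_congr rfl fun p _ => Finset.sum_congr rfl fun q _ =>
      Finset.sum_congr rfl fun s _ => ?_
    split_ifs
    · rw [leibniz_lie (X p), lie_skew]
    · simp

instance [LieAlgebra ℂ L] : LieAlgebra ℂ (Takiff L n) where
  lie_smul c X Y := by
    funext r
    change ⁅X, c • Y⁆ r = c • ⁅X, Y⁆ r
    simp only [lie_apply, Finset.smul_sum]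
    refine Finset.sum_congr rfl fun p _ => Finset.sum_congr rfl fun q _ => ?_
    split_ifs
    · exact lie_smul c (X p) (Y q)
    · simp

end Takiff
/-! ## Marked points and the Lie algebra `𝔤̃^𝒟` -/

/-- The action of the dihedral group element `sᵏ tᵇ` on `ℂ`. -/
def Datum.mu (D : Datum 𝔤) (k : ℕ) (b : Bool) (x : ℂ) : ℂ := D.ω ^ k * (if b then conj x else x)

/-- A finite set of marked points of `ℂ`, pairwise in different dihedral orbits, together with
a positive integer attached to each of them and to the point at infinity (`none`). -/
structure Points (D : Datum 𝔤) where
  Z : Finset ℂ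
  orbits_disjoint : ∀ x ∈ Z, ∀ y ∈ Z, ∀ k b, D.mu k b x = y → x = y
  ord : Option Z → ℕ
  ord_pos : ∀ p, 0 < ord p

variable {D : Datum 𝔤} (P : Points D)

/-- The direct sum over all marked points of the Takiff algebras `𝔤̃ ⊗ ℂ[ε]/ε^{nₓ}`. -/
def TD : Type _ := ∀ x : Option P.Z, Takiff (KM D) (P.ord x)

instance : AddCommGroup (TD P) :=
  inferInstanceAs (AddCommGroup (∀ x : Option P.Z, Takiff (KM D) (P.ord x)))
instance : Module ℂ (TD P) :=
  inferInstanceAs (Module ℂ (∀ x : Option P.Z, Takiff (KM D) (P.ord x)))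
instance : LieRing (TD P) where
  bracket X Y x := ⁅X x, Y x⁆
  add_lie X Y Z := funext fun x => add_lie (X x) (Y x) (Z x)
  lie_add X Y Z := funext fun x => lie_add (X x) (Y x) (Z x)
  lie_self X := funext fun x => lie_self (X x)
  leibniz_lie X Y Z := funext fun x => leibniz_lie (X x) (Y x) (Z x)
instance : LieAlgebra ℂ (TD P) where
  lie_smul c X Y := funext fun x => lie_smul c (X x) (Y x)
instance : LieAlgebra ℝ (TD P) where
  lie_smul r X Y := lie_smul (r : ℂ) X Y

variable {P}

/-- `sᵏ tᵇ` fixes the given point. -/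
def Fixes (k : ℕ) (b : Bool) : Option P.Z → Prop
  | some x => D.mu k b x = x
  | none => True

/-- The root of unity by which `sᵏ` rescales `ε^p` at the given point: `ω^{-kp}` at a
point of `ℂ` and `ω^{kp}` at infinity. -/
def weight (k p : ℕ) : Option P.Z → ℂ
  | some _ => (D.ω ^ (k * p))⁻¹
  | none => D.ω ^ (k * p)

theorem TD.lie_apply (X Y : TD P) (x : Option P.Z) (r : Fin (P.ord x)) :
    ⁅X, Y⁆ x r = ∑ p : Fin (P.ord x), ∑ q : Fin (P.ord x),
      if (p : ℕ) + q = r then ⁅X x p, Y x q⁆ else 0 := rfl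

theorem weight_add (k p q : ℕ) (x : Option P.Z) :
    weight k (p + q) x = weight k p x * weight k q x := by
  cases x <;> simp [weight, mul_add, pow_add, mul_comm]

variable (P)

/-- The real Lie algebra `𝔤̃^𝒟`: the sum over all marked points of the invariants in the Takiff
algebra `𝔤̃ ⊗ ℂ[ε]/ε^{nₓ}` (or `𝔤̃ ⊗ ε ℂ[ε]/ε^{n_∞}` for the point at infinity)
under the stabiliser of the point. -/
def gD : LieSubalgebra ℝ (TD P) where
  carrier := {X | (∀ x k b, Fixes k b x → ∀ p : Fin (P.ord x), weight k p x • KM.act k b (X x p) = X x p) ∧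
    ∀ p : Fin (P.ord none), (p : ℕ) = 0 → X none p = 0}
  zero_mem' := by
    refine ⟨fun x k b _ p => ?_, fun p _ => rfl⟩
    change weight k p x • KM.act k b 0 = 0
    simp
  add_mem' := by
    rintro X Y ⟨h1, h2⟩ ⟨h1', h2'⟩
    refine ⟨fun x k b h p => ?_, fun p hp => ?_⟩
    · change weight k p x • KM.act k b (X x p + Y x p) = X x p + Y x p
      rw [map_add, smul_add, h1 x k b h, h1' x k b h]
    · change X none p + Y none p = 0
      rw [h2 p hp, h2' p hp, add_zero]
  smul_mem' := by
    rintro r X ⟨h1, h2⟩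
    refine ⟨fun x k b h p => ?_, fun p hp => ?_⟩
    · change weight k p x • KM.act k b (r • X x p) = r • X x p
      rw [map_smul, smul_comm, h1 x k b h]
    · change r • X none p = 0
      rw [h2 p hp, smul_zero]
  lie_mem' := by
    rintro X Y ⟨h1, h2⟩ ⟨h1', h2'⟩
    refine ⟨fun x k b h r => ?_, fun r hr => ?_⟩
    · rw [TD.lie_apply, map_sum, Finset.smul_sum]
      refine Finset.sum_congr rfl fun p _ => ?_
      rw [map_sum, Finset.smul_sum]
      refine Finset.sum_congr rfl fun q _ => ?_
      split_ifs with hpq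
      · rw [← hpq, KM.act_lie, weight_add, mul_smul, ← lie_smul, ← smul_lie, h1 x k b h,
          h1' x k b h]
      · simp
    · rw [TD.lie_apply]
      refine Finset.sum_eq_zero fun p _ => Finset.sum_eq_zero fun q _ => ?_
      split_ifs with hpq
      · rw [h2 p (by omega), zero_lie]
      · rfl

/-- The complexification `𝔤̃^𝒟_ℂ = ℂ ⊗_ℝ 𝔤̃^𝒟`. -/
abbrev WC : Type _ := ℂ ⊗[ℝ] (gD P)

/-- `a ⊗ u ↦ a u`, the complex linear extension of the inclusion of `𝔤̃^𝒟`. -/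
def phi : WC P →ₗ[ℂ] TD P :=
  LinearMap.liftBaseChange ℂ ((gD P).toSubmodule.subtype)

/-- The antilinear involution of `𝔤̃^𝒟_ℂ` acting by complex conjugation on the factor `ℂ`. -/
def conjW : WC P →ₛₗ[starRingEnd ℂ] WC P where
  toFun := TensorProduct.map (Complex.conjAe.toLinearMap) (LinearMap.id : gD P →ₗ[ℝ] gD P)
  map_add' := map_add _
  map_smul' a v := by
    induction v using TensorProduct.induction_on with
    | zero => simp
    | add v w hv hw => simp only [smul_add, map_add, hv, hw]
    | tmul z u => simp [TensorProduct.smul_tmul']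

/-- The elements of `TD` all of whose coefficients lie in a given subspace of `𝔤̃`. -/
def coeffIn (S : Submodule ℂ (KM D)) : Submodule ℂ (TD P) where
  carrier := {X | ∀ x p, X x p ∈ S}
  zero_mem' := fun _ _ => S.zero_mem
  add_mem' := fun h h' x p => S.add_mem (h x p) (h' x p)
  smul_mem' := fun c _ h x p => S.smul_mem c (h x p)

/-- The subspace `𝖥ₙ` of `𝔤̃^𝒟_ℂ`. Under the embedding `v ↦ (φ v, φ (c v))` of `𝔤̃^𝒟_ℂ` into two
copies of the Takiff algebras, it consists of the elements with coefficients in `𝖥ₙ` in the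
first copy and in `𝖥̄ₙ` in the second one. -/
def filtW (n : ℕ) : Submodule ℂ (WC P) :=
  (coeffIn P (KM.filt D n)).comap (phi P) ⊓ (coeffIn P (KM.filtBar D n)).comap (phi P ∘ₛₗ conjW P)

/-- The subspace `c(𝖥ₙ)` of `𝔤̃^𝒟_ℂ`. -/
def filtWBar (n : ℕ) : Submodule ℂ (WC P) := (filtW P n).comap (conjW P)

/-! ## Completions -/

section Completion

variable {M N Q : Type*} [AddCommGroup M] [Module ℂ M] [AddCommGroup N] [Module ℂ N]
  [AddCommGroup Q] [Module ℂ Q]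

/-- The subspace of compatible families in `∏ₙ M / Fₙ`. -/
def complSub (F : ℕ → Submodule ℂ M) : Submodule ℂ (∀ n, M ⧸ F n) where
  carrier := {x | ∀ m n, m ≤ n → ∃ a : M, (F m).mkQ a = x m ∧ (F n).mkQ a = x n}
  zero_mem' := fun _ _ _ => ⟨0, by simp, by simp⟩
  add_mem' := by
    intro x y hx hy m n hmn
    obtain ⟨a, h1, h2⟩ := hx m n hmn
    obtain ⟨b, h3, h4⟩ := hy m n hmn
    exact ⟨a + b, by rw [map_add, h1, h3]; rfl, by rw [map_add, h2, h4]; rfl⟩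
  smul_mem' := by
    intro c x hx m n hmn
    obtain ⟨a, h1, h2⟩ := hx m n hmn
    exact ⟨c • a, by rw [map_smul, h1]; rfl, by rw [map_smul, h2]; rfl⟩

/-- The completion `lim M / Fₙ` of `M` with respect to a descending filtration `F`. -/
def Compl (F : ℕ → Submodule ℂ M) : Type _ := complSub F

instance (F : ℕ → Submodule ℂ M) : AddCommGroup (Compl F) :=
  inferInstanceAs (AddCommGroup (complSub F))
instance (F : ℕ → Submodule ℂ M) : Module ℂ (Compl F) := inferInstanceAs (Module ℂ (complSub F))

/-- The projection of the completion to `M / Fₙ`. -/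
def Compl.proj (F : ℕ → Submodule ℂ M) (n : ℕ) : Compl F →ₗ[ℂ] M ⧸ F n where
  toFun x := x.1 n
  map_add' _ _ := rfl
  map_smul' _ _ := rfl

/-- The limit in the completion of a sequence whose `n`-th increment lies in `Fₙ`. -/
def Compl.ofSeq {F : ℕ → Submodule ℂ M} (hF : Antitone F) (s : ℕ → M)
    (hs : ∀ n, s (n + 1) - s n ∈ F n) : Compl F :=
  ⟨fun n => (F n).mkQ (s n), fun m n hmn => ⟨s n, by
    induction n, hmn using Nat.le_induction with
    | base => rfl
    | succ n hn ih =>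
      rw [← ih, ← sub_eq_zero, ← map_sub]
      exact (Submodule.Quotient.mk_eq_zero _).2 (hF hn (hs n)), rfl⟩⟩

/-- Continuity of a bilinear map for the topologies defined by three descending filtrations. -/
structure ContBilin (B : M →ₗ[ℂ] N →ₗ[ℂ] Q) (F : ℕ → Submodule ℂ M) (G : ℕ → Submodule ℂ N)
    (H : ℕ → Submodule ℂ Q) : Prop where
  antiF : Antitone F
  antiG : Antitone G
  antiH : Antitone H
  joint : ∀ n, ∃ m, ∀ x ∈ F m, ∀ y ∈ G m, B x y ∈ H n
  left : ∀ n y, ∃ m, ∀ x ∈ F m, B x y ∈ H n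
  right : ∀ n x, ∃ m, ∀ y ∈ G m, B x y ∈ H n

/-- `z` is the value at `(x, y)` of the continuous extension of `B`: modulo `Hₙ` it is `B a b`
whenever `a`, `b` are sufficiently good approximations of `x`, `y`. -/
def IsExtVal (B : M →ₗ[ℂ] N →ₗ[ℂ] Q) {F : ℕ → Submodule ℂ M} {G : ℕ → Submodule ℂ N}
    {H : ℕ → Submodule ℂ Q} (x : Compl F) (y : Compl G) (z : Compl H) : Prop :=
  ∀ n, ∃ m, ∀ m', m ≤ m' → ∀ a b, (F m').mkQ a = x.1 m' → (G m').mkQ b = y.1 m' →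
    (H n).mkQ (B a b) = z.1 n

theorem IsExtVal.unique {B : M →ₗ[ℂ] N →ₗ[ℂ] Q} {F : ℕ → Submodule ℂ M} {G : ℕ → Submodule ℂ N}
    {H : ℕ → Submodule ℂ Q} {x : Compl F} {y : Compl G} {z z' : Compl H}
    (h : IsExtVal B x y z) (h' : IsExtVal B x y z') : z = z' := by
  refine Subtype.ext (funext fun n => ?_)
  obtain ⟨m, hm⟩ := h n
  obtain ⟨m', hm'⟩ := h' n
  obtain ⟨a, ha⟩ := (F (max m m')).mkQ_surjective (x.1 (max m m'))
  obtain ⟨b, hb⟩ := (G (max m m')).mkQ_surjective (y.1 (max m m'))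
  rw [← hm _ (le_max_left _ _) a b ha hb, hm' _ (le_max_right _ _) a b ha hb]

theorem mkQ_eq_iff {F : Submodule ℂ M} {a b : M} : F.mkQ a = F.mkQ b ↔ a - b ∈ F :=
  Submodule.Quotient.eq F

theorem Compl.mkQ_of_le {F : ℕ → Submodule ℂ M} (hF : Antitone F) (x : Compl F) {m n : ℕ}
    (hmn : m ≤ n) {a : M} (ha : (F n).mkQ a = x.1 n) : (F m).mkQ a = x.1 m := by
  obtain ⟨b, h1, h2⟩ := x.2 m n hmn
  rw [← h1, mkQ_eq_iff]
  exact hF hmn (mkQ_eq_iff.1 (ha.trans h2.symm))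

theorem ContBilin.exists_level {B : M →ₗ[ℂ] N →ₗ[ℂ] Q} {F : ℕ → Submodule ℂ M}
    {G : ℕ → Submodule ℂ N} {H : ℕ → Submodule ℂ Q} (h : ContBilin B F G H)
    (x : Compl F) (y : Compl G) (n : ℕ) :
    ∃ m, ∀ m' m'', m ≤ m' → m ≤ m'' → ∀ a b a' b', (F m').mkQ a = x.1 m' →
      (G m').mkQ b = y.1 m' → (F m'').mkQ a' = x.1 m'' → (G m'').mkQ b' = y.1 m'' →
      B a b - B a' b' ∈ H n := by
  obtain ⟨m0, h0⟩ := h.joint n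
  obtain ⟨a0, ha0⟩ := (F m0).mkQ_surjective (x.1 m0)
  obtain ⟨b0, hb0⟩ := (G m0).mkQ_surjective (y.1 m0)
  obtain ⟨m1, h1⟩ := h.left n b0
  obtain ⟨m2, h2⟩ := h.right n a0
  refine ⟨max m0 (max m1 m2), fun m' m'' hm' hm'' a b a' b' ha hb ha' hb' => ?_⟩
  have l0 : m0 ≤ max m0 (max m1 m2) := le_max_left _ _
  have l1 : m1 ≤ max m0 (max m1 m2) := (le_max_left _ _).trans (le_max_right _ _)
  have l2 : m2 ≤ max m0 (max m1 m2) := (le_max_right _ _).trans (le_max_right _ _)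
  have key : ∀ k, k ≤ max m0 (max m1 m2) → a - a' ∈ F k ∧ b - b' ∈ G k := fun k hk =>
    ⟨mkQ_eq_iff.1 ((x.mkQ_of_le h.antiF (hk.trans hm') ha).trans
      (x.mkQ_of_le h.antiF (hk.trans hm'') ha').symm),
     mkQ_eq_iff.1 ((y.mkQ_of_le h.antiG (hk.trans hm') hb).trans
      (y.mkQ_of_le h.antiG (hk.trans hm'') hb').symm)⟩
  have hb1 : b - b0 ∈ G m0 :=
    mkQ_eq_iff.1 ((y.mkQ_of_le h.antiG (l0.trans hm') hb).trans hb0.symm)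
  have ha1 : a' - a0 ∈ F m0 :=
    mkQ_eq_iff.1 ((x.mkQ_of_le h.antiF (l0.trans hm'') ha').trans ha0.symm)
  have e : B a b - B a' b' = B (a - a') b0 + B (a - a') (b - b0) + B a0 (b - b')
      + B (a' - a0) (b - b') := by
    simp only [map_sub, LinearMap.sub_apply]; abel
  rw [e]
  exact (H n).add_mem ((H n).add_mem ((H n).add_mem (h1 _ (key m1 l1).1)
    (h0 _ (key m0 l0).1 _ hb1)) (h2 _ (key m2 l2).2)) (h0 _ ha1 _ (key m0 l0).2)

theorem ContBilin.exists_extVal {B : M →ₗ[ℂ] N →ₗ[ℂ] Q} {F : ℕ → Submodule ℂ M}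
    {G : ℕ → Submodule ℂ N} {H : ℕ → Submodule ℂ Q} (h : ContBilin B F G H)
    (x : Compl F) (y : Compl G) : ∃ z : Compl H, IsExtVal B x y z := by
  choose m hm using h.exists_level x y
  choose a ha using fun k => (F k).mkQ_surjective (x.1 k)
  choose b hb using fun k => (G k).mkQ_surjective (y.1 k)
  refine ⟨⟨fun n => (H n).mkQ (B (a (m n)) (b (m n))), fun k n hkn => ?_⟩, fun n => ?_⟩
  · refine ⟨B (a (max (m k) (m n))) (b (max (m k) (m n))), ?_, ?_⟩
    · exact mkQ_eq_iff.2 (hm k _ _ (le_max_left _ _) le_rfl _ _ _ _ (ha _) (hb _) (ha _) (hb _))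
    · exact mkQ_eq_iff.2 (hm n _ _ (le_max_right _ _) le_rfl _ _ _ _ (ha _) (hb _) (ha _) (hb _))
  · exact ⟨m n, fun m' hm' a' b' ha' hb' =>
      mkQ_eq_iff.2 (hm n _ _ hm' le_rfl _ _ _ _ ha' hb' (ha _) (hb _))⟩

/-- The extension of a continuous bilinear map to the completions. -/
def ContBilin.ext {B : M →ₗ[ℂ] N →ₗ[ℂ] Q} {F : ℕ → Submodule ℂ M}
    {G : ℕ → Submodule ℂ N} {H : ℕ → Submodule ℂ Q} (h : ContBilin B F G H) :
    Compl F →ₗ[ℂ] Compl G →ₗ[ℂ] Compl H :=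
  LinearMap.mk₂ ℂ (fun x y => (h.exists_extVal x y).choose)
    (fun x x' y => by
      refine IsExtVal.unique (h.exists_extVal (x + x') y).choose_spec fun n => ?_
      obtain ⟨m, hm⟩ := (h.exists_extVal x y).choose_spec n
      obtain ⟨m', hm'⟩ := (h.exists_extVal x' y).choose_spec n
      refine ⟨max m m', fun k hk c b hc hb => ?_⟩
      obtain ⟨a, ha⟩ := (F k).mkQ_surjective (x.1 k)
      have ha' : (F k).mkQ (c - a) = x'.1 k := by
        rw [map_sub, hc, ha]; exact add_sub_cancel_left (x.1 k) (x'.1 k)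
      have e : B c b = B a b + B (c - a) b := by
        rw [map_sub, LinearMap.sub_apply]; abel
      rw [e, map_add, hm k ((le_max_left _ _).trans hk) a b ha hb,
        hm' k ((le_max_right _ _).trans hk) _ b ha' hb]
      rfl)
    (fun c x y => by
      refine IsExtVal.unique (h.exists_extVal (c • x) y).choose_spec fun n => ?_
      obtain ⟨m, hm⟩ := (h.exists_extVal x y).choose_spec n
      obtain ⟨m', hm'⟩ := h.exists_level (c • x) y n
      refine ⟨max m m', fun k hk a b ha hb => ?_⟩
      obtain ⟨a', ha'⟩ := (F k).mkQ_surjective (x.1 k)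
      have hca : (F k).mkQ (c • a') = (c • x).1 k := by rw [map_smul, ha']; rfl
      have e := mkQ_eq_iff.2 (hm' k k ((le_max_right _ _).trans hk) ((le_max_right _ _).trans hk)
        a b (c • a') b ha hb hca hb)
      rw [e, map_smul, LinearMap.smul_apply, map_smul,
        hm k ((le_max_left _ _).trans hk) a' b ha' hb]
      rfl)
    (fun x y y' => by
      refine IsExtVal.unique (h.exists_extVal x (y + y')).choose_spec fun n => ?_
      obtain ⟨m, hm⟩ := (h.exists_extVal x y).choose_spec n
      obtain ⟨m', hm'⟩ := (h.exists_extVal x y').choose_spec n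
      refine ⟨max m m', fun k hk a c ha hc => ?_⟩
      obtain ⟨b, hb⟩ := (G k).mkQ_surjective (y.1 k)
      have hb' : (G k).mkQ (c - b) = y'.1 k := by
        rw [map_sub, hc, hb]; exact add_sub_cancel_left (y.1 k) (y'.1 k)
      have e : B a c = B a b + B a (c - b) := by rw [map_sub]; abel
      rw [e, map_add, hm k ((le_max_left _ _).trans hk) a b ha hb,
        hm' k ((le_max_right _ _).trans hk) a _ ha hb']
      rfl)
    (fun c x y => by
      refine IsExtVal.unique (h.exists_extVal x (c • y)).choose_spec fun n => ?_
      obtain ⟨m, hm⟩ := (h.exists_extVal x y).choose_spec n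
      obtain ⟨m', hm'⟩ := h.exists_level x (c • y) n
      refine ⟨max m m', fun k hk a b ha hb => ?_⟩
      obtain ⟨b', hb'⟩ := (G k).mkQ_surjective (y.1 k)
      have hcb : (G k).mkQ (c • b') = (c • y).1 k := by rw [map_smul, hb']; rfl
      have e := mkQ_eq_iff.2 (hm' k k ((le_max_right _ _).trans hk) ((le_max_right _ _).trans hk)
        a b a (c • b') ha hb ha hcb)
      rw [e, map_smul, map_smul, hm k ((le_max_left _ _).trans hk) a b' ha hb']
      rfl)

theorem ContBilin.isExtVal_ext {B : M →ₗ[ℂ] N →ₗ[ℂ] Q} {F : ℕ → Submodule ℂ M}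
    {G : ℕ → Submodule ℂ N} {H : ℕ → Submodule ℂ Q} (h : ContBilin B F G H)
    (x : Compl F) (y : Compl G) : IsExtVal B x y (h.ext x y) :=
  (h.exists_extVal x y).choose_spec

end Completion

/-! ## Bifiltered Lie algebras, tensor products and brackets in tensor index notation -/

section Tensor

/-- A descending filtration of a Lie algebra by subalgebras, for which every adjoint map is
continuous. -/
structure IsLieFilt {L : Type*} [LieRing L] [LieAlgebra ℂ L] (F : ℕ → Submodule ℂ L) : Prop where
  anti : Antitone F
  lie : ∀ n, ∀ x ∈ F n, ∀ y ∈ F n, ⁅x, y⁆ ∈ F n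
  absorb : ∀ n y, ∃ m, ∀ x ∈ F m, ⁅x, y⁆ ∈ F n

/-- A complex Lie algebra with a pair of descending filtrations `𝖥ₙ` (`pos`) and `𝖥̄ₙ` (`neg`). -/
structure BiFilt (L : Type*) [LieRing L] [LieAlgebra ℂ L] where
  pos : ℕ → Submodule ℂ L
  neg : ℕ → Submodule ℂ L
  isLieFilt_pos : IsLieFilt pos
  isLieFilt_neg : IsLieFilt neg

theorem IsLieFilt.absorb' {L : Type*} [LieRing L] [LieAlgebra ℂ L] {F : ℕ → Submodule ℂ L}
    (hF : IsLieFilt F) (n : ℕ) (y : L) : ∃ m, ∀ x ∈ F m, ⁅y, x⁆ ∈ F n := by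
  obtain ⟨m, hm⟩ := hF.absorb n y
  exact ⟨m, fun x hx => by rw [← lie_skew]; exact (F n).neg_mem (hm x hx)⟩

/-- `S ⊗ S'` as a subspace of `M ⊗ N`. -/
def tens {M N : Type*} [AddCommGroup M] [Module ℂ M] [AddCommGroup N] [Module ℂ N]
    (S : Submodule ℂ M) (S' : Submodule ℂ N) : Submodule ℂ (M ⊗[ℂ] N) :=
  Submodule.map₂ (TensorProduct.mk ℂ M N) S S'

variable {L₁ L₂ L₃ : Type*} [LieRing L₁] [LieAlgebra ℂ L₁] [LieRing L₂] [LieAlgebra ℂ L₂]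
  [LieRing L₃] [LieAlgebra ℂ L₃]

/-- `𝖥ₙ ⊗ 𝖥̄ₙ + 𝖥̄ₙ ⊗ 𝖥ₙ`. -/
def filt₂ (A : BiFilt L₁) (B : BiFilt L₂) (n : ℕ) : Submodule ℂ (L₁ ⊗[ℂ] L₂) :=
  tens (A.pos n) (B.neg n) ⊔ tens (A.neg n) (B.pos n)

/-- The sum of all subspaces of `L₁ ⊗ L₂ ⊗ L₃` with `𝖥ₙ` in one tensor factor, `𝖥̄ₙ` in another one
and the whole Lie algebra in the third one. -/
def filt₃ (A : BiFilt L₁) (B : BiFilt L₂) (C : BiFilt L₃) (n : ℕ) :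
    Submodule ℂ (L₁ ⊗[ℂ] (L₂ ⊗[ℂ] L₃)) :=
  (tens (A.pos n) (tens (B.neg n) ⊤) ⊔ tens (A.pos n) (tens ⊤ (C.neg n)) ⊔
    tens ⊤ (tens (B.pos n) (C.neg n))) ⊔
  (tens (A.neg n) (tens (B.pos n) ⊤) ⊔ tens (A.neg n) (tens ⊤ (C.pos n)) ⊔
    tens ⊤ (tens (B.neg n) (C.pos n)))

/-- The Lie bracket as a bilinear map. -/
def lieB (L : Type*) [LieRing L] [LieAlgebra ℂ L] : L →ₗ[ℂ] L →ₗ[ℂ] L :=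
  LinearMap.mk₂ ℂ (fun x y => ⁅x, y⁆) add_lie smul_lie lie_add lie_smul

variable (L₁ L₂ L₃)

/-- `[u₁₂, v₁₃] = [u¹, v¹] ⊗ u² ⊗ v²` for `u = u¹ ⊗ u²`, `v = v¹ ⊗ v²`. -/
def brk₁ : (L₁ ⊗[ℂ] L₂) →ₗ[ℂ] (L₁ ⊗[ℂ] L₃) →ₗ[ℂ] (L₁ ⊗[ℂ] (L₂ ⊗[ℂ] L₃)) :=
  TensorProduct.map₂ (lieB L₁) (TensorProduct.mk ℂ L₂ L₃)

/-- `[u₂₁, v₂₃] = u² ⊗ [u¹, v¹] ⊗ v²` for `u = u¹ ⊗ u²`, `v = v¹ ⊗ v²`. -/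
def brk₂ : (L₂ ⊗[ℂ] L₁) →ₗ[ℂ] (L₂ ⊗[ℂ] L₃) →ₗ[ℂ] (L₁ ⊗[ℂ] (L₂ ⊗[ℂ] L₃)) :=
  (TensorProduct.map₂ (lieB L₂) (TensorProduct.mk ℂ L₁ L₃)).compr₂
    (TensorProduct.leftComm ℂ L₂ L₁ L₃).toLinearMap

/-- `[u₁₃, v₂₃] = u¹ ⊗ v¹ ⊗ [u², v²]` for `u = u¹ ⊗ u²`, `v = v¹ ⊗ v²`. -/
def brk₃ : (L₁ ⊗[ℂ] L₃) →ₗ[ℂ] (L₂ ⊗[ℂ] L₃) →ₗ[ℂ] (L₁ ⊗[ℂ] (L₂ ⊗[ℂ] L₃)) :=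
  (TensorProduct.map₂ (TensorProduct.mk ℂ L₁ L₂) (lieB L₃)).compr₂
    (TensorProduct.assoc ℂ L₁ L₂ L₃).toLinearMap

variable {L₁ L₂ L₃}

@[simp] theorem brk₁_tmul (x : L₁) (y : L₂) (x' : L₁) (z : L₃) :
    brk₁ L₁ L₂ L₃ (x ⊗ₜ y) (x' ⊗ₜ z) = ⁅x, x'⁆ ⊗ₜ (y ⊗ₜ z) := rfl
@[simp] theorem brk₂_tmul (y : L₂) (x : L₁) (y' : L₂) (z : L₃) :
    brk₂ L₁ L₂ L₃ (y ⊗ₜ x) (y' ⊗ₜ z) = x ⊗ₜ (⁅y, y'⁆ ⊗ₜ z) := rfl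
@[simp] theorem brk₃_tmul (x : L₁) (z : L₃) (y : L₂) (z' : L₃) :
    brk₃ L₁ L₂ L₃ (x ⊗ₜ z) (y ⊗ₜ z') = x ⊗ₜ (y ⊗ₜ ⁅z, z'⁆) := rfl

theorem tens_mono {M N : Type*} [AddCommGroup M] [Module ℂ M] [AddCommGroup N] [Module ℂ N]
    {S T : Submodule ℂ M} {S' T' : Submodule ℂ N} (h : S ≤ T) (h' : S' ≤ T') :
    tens S S' ≤ tens T T' := Submodule.map₂_le_map₂ h h'

theorem tmul_mem {M N : Type*} [AddCommGroup M] [Module ℂ M] [AddCommGroup N] [Module ℂ N]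
    {S : Submodule ℂ M} {S' : Submodule ℂ N} {a : M} {b : N} (ha : a ∈ S) (hb : b ∈ S') :
    a ⊗ₜ b ∈ tens S S' := Submodule.apply_mem_map₂ (TensorProduct.mk ℂ M N) ha hb

theorem tens_induction {M N : Type*} [AddCommGroup M] [Module ℂ M] [AddCommGroup N] [Module ℂ N]
    {S : Submodule ℂ M} {S' : Submodule ℂ N} {p : Submodule ℂ (M ⊗[ℂ] N)}
    (h : ∀ a ∈ S, ∀ b ∈ S', a ⊗ₜ b ∈ p) : tens S S' ≤ p := Submodule.map₂_le.2 h

theorem antitone_filt₂ (A : BiFilt L₁) (B : BiFilt L₂) : Antitone (filt₂ A B) := fun _ _ h =>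
  sup_le_sup (tens_mono (A.isLieFilt_pos.anti h) (B.isLieFilt_neg.anti h))
    (tens_mono (A.isLieFilt_neg.anti h) (B.isLieFilt_pos.anti h))

theorem antitone_filt₃ (A : BiFilt L₁) (B : BiFilt L₂) (C : BiFilt L₃) :
    Antitone (filt₃ A B C) := fun _ _ h => by
  have a := A.isLieFilt_pos.anti h
  have a' := A.isLieFilt_neg.anti h
  have b := B.isLieFilt_pos.anti h
  have b' := B.isLieFilt_neg.anti h
  have c := C.isLieFilt_pos.anti h
  have c' := C.isLieFilt_neg.anti h
  exact sup_le_sup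
    (sup_le_sup (sup_le_sup (tens_mono a (tens_mono b' le_rfl)) (tens_mono a (tens_mono le_rfl c')))
      (tens_mono le_rfl (tens_mono b c')))
    (sup_le_sup (sup_le_sup (tens_mono a' (tens_mono b le_rfl)) (tens_mono a' (tens_mono le_rfl c)))
      (tens_mono le_rfl (tens_mono b' c)))

section Membership

variable {A : BiFilt L₁} {B : BiFilt L₂} {C : BiFilt L₃} {n : ℕ} {a : L₁} {b : L₂} {c : L₃}

theorem mem_pn (ha : a ∈ A.pos n) (hb : b ∈ B.neg n) : a ⊗ₜ (b ⊗ₜ c) ∈ filt₃ A B C n :=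
  Submodule.mem_sup_left (Submodule.mem_sup_left
    (Submodule.mem_sup_left (tmul_mem ha (tmul_mem hb Submodule.mem_top))))
theorem mem_p_n (ha : a ∈ A.pos n) (hc : c ∈ C.neg n) : a ⊗ₜ (b ⊗ₜ c) ∈ filt₃ A B C n :=
  Submodule.mem_sup_left (Submodule.mem_sup_left
    (Submodule.mem_sup_right (tmul_mem ha (tmul_mem Submodule.mem_top hc))))
theorem mem_pn_right (hb : b ∈ B.pos n) (hc : c ∈ C.neg n) : a ⊗ₜ (b ⊗ₜ c) ∈ filt₃ A B C n :=
  Submodule.mem_sup_left (Submodule.mem_sup_right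
    (tmul_mem Submodule.mem_top (tmul_mem hb hc)))
theorem mem_np (ha : a ∈ A.neg n) (hb : b ∈ B.pos n) : a ⊗ₜ (b ⊗ₜ c) ∈ filt₃ A B C n :=
  Submodule.mem_sup_right (Submodule.mem_sup_left
    (Submodule.mem_sup_left (tmul_mem ha (tmul_mem hb Submodule.mem_top))))
theorem mem_n_p (ha : a ∈ A.neg n) (hc : c ∈ C.pos n) : a ⊗ₜ (b ⊗ₜ c) ∈ filt₃ A B C n :=
  Submodule.mem_sup_right (Submodule.mem_sup_left
    (Submodule.mem_sup_right (tmul_mem ha (tmul_mem Submodule.mem_top hc))))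
theorem mem_np_right (hb : b ∈ B.neg n) (hc : c ∈ C.pos n) : a ⊗ₜ (b ⊗ₜ c) ∈ filt₃ A B C n :=
  Submodule.mem_sup_right (Submodule.mem_sup_right
    (tmul_mem Submodule.mem_top (tmul_mem hb hc)))

end Membership

theorem filt₂_le {A : BiFilt L₁} {B : BiFilt L₂} {n : ℕ} {p : Submodule ℂ (L₁ ⊗[ℂ] L₂)}
    (h : ∀ a ∈ A.pos n, ∀ b ∈ B.neg n, a ⊗ₜ b ∈ p) (h' : ∀ a ∈ A.neg n, ∀ b ∈ B.pos n, a ⊗ₜ b ∈ p) :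
    filt₂ A B n ≤ p := sup_le (tens_induction h) (tens_induction h')

/-- A criterion for the continuity of a bilinear map on tensor products, by means of
pure tensors. -/
theorem contBilin_of_tmul {K₁ K₂ K₃ K₄ : Type*} [LieRing K₁] [LieAlgebra ℂ K₁] [LieRing K₂]
    [LieAlgebra ℂ K₂] [LieRing K₃] [LieAlgebra ℂ K₃] [LieRing K₄] [LieAlgebra ℂ K₄]
    {A : BiFilt K₁} {B : BiFilt K₂} {A' : BiFilt K₃} {B' : BiFilt K₄}
    {Q : Type*} [AddCommGroup Q] [Module ℂ Q] {H : ℕ → Submodule ℂ Q} (hH : Antitone H)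
    (f : (K₁ ⊗[ℂ] K₂) →ₗ[ℂ] (K₃ ⊗[ℂ] K₄) →ₗ[ℂ] Q)
    (joint : ∀ n, ∃ m, ∀ a b a' b', (a ∈ A.pos m ∧ b ∈ B.neg m ∨ a ∈ A.neg m ∧ b ∈ B.pos m) →
      (a' ∈ A'.pos m ∧ b' ∈ B'.neg m ∨ a' ∈ A'.neg m ∧ b' ∈ B'.pos m) →
      f (a ⊗ₜ b) (a' ⊗ₜ b') ∈ H n)
    (left : ∀ n a' b', ∃ m, ∀ a b, (a ∈ A.pos m ∧ b ∈ B.neg m ∨ a ∈ A.neg m ∧ b ∈ B.pos m) →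
      f (a ⊗ₜ b) (a' ⊗ₜ b') ∈ H n)
    (right : ∀ n a b, ∃ m, ∀ a' b', (a' ∈ A'.pos m ∧ b' ∈ B'.neg m ∨ a' ∈ A'.neg m ∧ b' ∈ B'.pos m) →
      f (a ⊗ₜ b) (a' ⊗ₜ b') ∈ H n) :
    ContBilin f (filt₂ A B) (filt₂ A' B') H where
  antiF := antitone_filt₂ A B
  antiG := antitone_filt₂ A' B'
  antiH := hH
  joint n := by
    obtain ⟨m, hm⟩ := joint n
    refine ⟨m, fun x hx y hy => ?_⟩
    have h1 : ∀ a b, (a ∈ A.pos m ∧ b ∈ B.neg m ∨ a ∈ A.neg m ∧ b ∈ B.pos m) →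
        f (a ⊗ₜ b) y ∈ H n := fun a b hab =>
      (filt₂_le (p := (H n).comap (f (a ⊗ₜ b)))
        (fun a' ha' b' hb' => hm a b a' b' hab (Or.inl ⟨ha', hb'⟩))
        (fun a' ha' b' hb' => hm a b a' b' hab (Or.inr ⟨ha', hb'⟩))) hy
    exact (filt₂_le (p := (H n).comap (f.flip y)) (fun a ha b hb => h1 a b (Or.inl ⟨ha, hb⟩))
        (fun a ha b hb => h1 a b (Or.inr ⟨ha, hb⟩))) hx
  left n y := by
    induction y using TensorProduct.induction_on with
    | zero => exact ⟨0, fun x _ => by simp⟩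
    | add y y' h h' =>
      obtain ⟨m, hm⟩ := h
      obtain ⟨m', hm'⟩ := h'
      refine ⟨max m m', fun x hx => ?_⟩
      rw [map_add]
      exact (H n).add_mem (hm x (antitone_filt₂ A B (le_max_left _ _) hx))
        (hm' x (antitone_filt₂ A B (le_max_right _ _) hx))
    | tmul a' b' =>
      obtain ⟨m, hm⟩ := left n a' b'
      exact ⟨m, fun x hx => (filt₂_le (p := (H n).comap (f.flip (a' ⊗ₜ b')))
        (fun a ha b hb => hm a b (Or.inl ⟨ha, hb⟩)) (fun a ha b hb => hm a b (Or.inr ⟨ha, hb⟩))) hx⟩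
  right n x := by
    induction x using TensorProduct.induction_on with
    | zero => exact ⟨0, fun x _ => by simp⟩
    | add y y' h h' =>
      obtain ⟨m, hm⟩ := h
      obtain ⟨m', hm'⟩ := h'
      refine ⟨max m m', fun x hx => ?_⟩
      rw [map_add, LinearMap.add_apply]
      exact (H n).add_mem (hm x (antitone_filt₂ A' B' (le_max_left _ _) hx))
        (hm' x (antitone_filt₂ A' B' (le_max_right _ _) hx))
    | tmul a b =>
      obtain ⟨m, hm⟩ := right n a b
      exact ⟨m, fun x hx => (filt₂_le (p := (H n).comap (f (a ⊗ₜ b)))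
        (fun a ha b hb => hm a b (Or.inl ⟨ha, hb⟩)) (fun a ha b hb => hm a b (Or.inr ⟨ha, hb⟩))) hx⟩

theorem BiFilt.exists_absorb {L : Type*} [LieRing L] [LieAlgebra ℂ L] (A : BiFilt L) (n : ℕ)
    (y : L) : ∃ m, n ≤ m ∧ ∀ x, (x ∈ A.pos m → ⁅x, y⁆ ∈ A.pos n ∧ ⁅y, x⁆ ∈ A.pos n) ∧
      (x ∈ A.neg m → ⁅x, y⁆ ∈ A.neg n ∧ ⁅y, x⁆ ∈ A.neg n) := by
  obtain ⟨m, hm⟩ := A.isLieFilt_pos.absorb n y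
  obtain ⟨m', hm'⟩ := A.isLieFilt_neg.absorb n y
  refine ⟨max n (max m m'), le_max_left _ _, fun x => ⟨fun hx => ?_, fun hx => ?_⟩⟩
  · have h := hm x (A.isLieFilt_pos.anti ((le_max_left m m').trans (le_max_right _ _)) hx)
    exact ⟨h, by rw [← lie_skew]; exact (A.pos n).neg_mem h⟩
  · have h := hm' x (A.isLieFilt_neg.anti ((le_max_right m m').trans (le_max_right _ _)) hx)
    exact ⟨h, by rw [← lie_skew]; exact (A.neg n).neg_mem h⟩

variable (A : BiFilt L₁) (B : BiFilt L₂) (C : BiFilt L₃)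

theorem contBilin_brk₁ :
    ContBilin (brk₁ L₁ L₂ L₃) (filt₂ A B) (filt₂ A C) (filt₃ A B C) := by
  refine contBilin_of_tmul (antitone_filt₃ A B C) _ (fun n => ⟨n, ?_⟩) ?_ ?_
  · intro a b a' c h h'
    rw [brk₁_tmul]
    rcases h with ⟨ha, hb⟩ | ⟨ha, hb⟩ <;> rcases h' with ⟨ha', hc⟩ | ⟨ha', hc⟩
    · exact mem_pn (A.isLieFilt_pos.lie n _ ha _ ha') hb
    · exact mem_np_right hb hc
    · exact mem_pn_right hb hc
    · exact mem_np (A.isLieFilt_neg.lie n _ ha _ ha') hb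
  · intro n a' c
    obtain ⟨m, hnm, hm⟩ := A.exists_absorb n a'
    refine ⟨m, fun a b h => ?_⟩
    rw [brk₁_tmul]
    rcases h with ⟨ha, hb⟩ | ⟨ha, hb⟩
    · exact mem_pn ((hm a).1 ha).1 (B.isLieFilt_neg.anti hnm hb)
    · exact mem_np ((hm a).2 ha).1 (B.isLieFilt_pos.anti hnm hb)
  · intro n a b
    obtain ⟨m, hnm, hm⟩ := A.exists_absorb n a
    refine ⟨m, fun a' c h => ?_⟩
    rw [brk₁_tmul]
    rcases h with ⟨ha, hc⟩ | ⟨ha, hc⟩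
    · exact mem_p_n ((hm a').1 ha).2 (C.isLieFilt_neg.anti hnm hc)
    · exact mem_n_p ((hm a').2 ha).2 (C.isLieFilt_pos.anti hnm hc)

theorem contBilin_brk₂ :
    ContBilin (brk₂ L₁ L₂ L₃) (filt₂ B A) (filt₂ B C) (filt₃ A B C) := by
  refine contBilin_of_tmul (antitone_filt₃ A B C) _ (fun n => ⟨n, ?_⟩) ?_ ?_
  · intro b a b' c h h'
    rw [brk₂_tmul]
    rcases h with ⟨hb, ha⟩ | ⟨hb, ha⟩ <;> rcases h' with ⟨hb', hc⟩ | ⟨hb', hc⟩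
    · exact mem_np ha (B.isLieFilt_pos.lie n _ hb _ hb')
    · exact mem_n_p ha hc
    · exact mem_p_n ha hc
    · exact mem_pn ha (B.isLieFilt_neg.lie n _ hb _ hb')
  · intro n b' c
    obtain ⟨m, hnm, hm⟩ := B.exists_absorb n b'
    refine ⟨m, fun b a h => ?_⟩
    rw [brk₂_tmul]
    rcases h with ⟨hb, ha⟩ | ⟨hb, ha⟩
    · exact mem_np (A.isLieFilt_neg.anti hnm ha) ((hm b).1 hb).1
    · exact mem_pn (A.isLieFilt_pos.anti hnm ha) ((hm b).2 hb).1
  · intro n b a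
    obtain ⟨m, hnm, hm⟩ := B.exists_absorb n b
    refine ⟨m, fun b' c h => ?_⟩
    rw [brk₂_tmul]
    rcases h with ⟨hb, hc⟩ | ⟨hb, hc⟩
    · exact mem_pn_right ((hm b').1 hb).2 (C.isLieFilt_neg.anti hnm hc)
    · exact mem_np_right ((hm b').2 hb).2 (C.isLieFilt_pos.anti hnm hc)

theorem contBilin_brk₃ :
    ContBilin (brk₃ L₁ L₂ L₃) (filt₂ A C) (filt₂ B C) (filt₃ A B C) := by
  refine contBilin_of_tmul (antitone_filt₃ A B C) _ (fun n => ⟨n, ?_⟩) ?_ ?_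
  · intro a c b c' h h'
    rw [brk₃_tmul]
    rcases h with ⟨ha, hc⟩ | ⟨ha, hc⟩ <;> rcases h' with ⟨hb, hc'⟩ | ⟨hb, hc'⟩
    · exact mem_p_n ha (C.isLieFilt_neg.lie n _ hc _ hc')
    · exact mem_pn ha hb
    · exact mem_np ha hb
    · exact mem_n_p ha (C.isLieFilt_pos.lie n _ hc _ hc')
  · intro n b c'
    obtain ⟨m, hnm, hm⟩ := C.exists_absorb n c'
    refine ⟨m, fun a c h => ?_⟩
    rw [brk₃_tmul]
    rcases h with ⟨ha, hc⟩ | ⟨ha, hc⟩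
    · exact mem_p_n (A.isLieFilt_pos.anti hnm ha) ((hm c).2 hc).1
    · exact mem_n_p (A.isLieFilt_neg.anti hnm ha) ((hm c).1 hc).1
  · intro n a c
    obtain ⟨m, hnm, hm⟩ := C.exists_absorb n c
    refine ⟨m, fun b c' h => ?_⟩
    rw [brk₃_tmul]
    rcases h with ⟨hb, hc⟩ | ⟨hb, hc⟩
    · exact mem_pn_right (B.isLieFilt_pos.anti hnm hb) ((hm c').2 hc).2
    · exact mem_np_right (B.isLieFilt_neg.anti hnm hb) ((hm c').1 hc).2

end Tensor

/-! ## The filtrations of `𝔤̃` and `𝔤̃^𝒟_ℂ` are compatible with the brackets -/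

theorem IsLieFilt.comap {L L' : Type*} [LieRing L] [LieAlgebra ℂ L] [LieRing L'] [LieAlgebra ℂ L']
    {s : ℂ →+* ℂ} {F : ℕ → Submodule ℂ L'} (hF : IsLieFilt F) (f : L →ₛₗ[s] L')
    (hf : ∀ x y, f ⁅x, y⁆ = ⁅f x, f y⁆) : IsLieFilt fun n => (F n).comap f where
  anti _ _ h := Submodule.comap_mono (hF.anti h)
  lie n x hx y hy := by
    rw [Submodule.mem_comap, hf]; exact hF.lie n _ hx _ hy
  absorb n y := by
    obtain ⟨m, hm⟩ := hF.absorb n (f y)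
    exact ⟨m, fun x hx => by rw [Submodule.mem_comap, hf]; exact hm _ hx⟩

theorem IsLieFilt.inf {L : Type*} [LieRing L] [LieAlgebra ℂ L] {F G : ℕ → Submodule ℂ L}
    (hF : IsLieFilt F) (hG : IsLieFilt G) : IsLieFilt fun n => F n ⊓ G n where
  anti _ _ h := inf_le_inf (hF.anti h) (hG.anti h)
  lie n x hx y hy := ⟨hF.lie n x hx.1 y hy.1, hG.lie n x hx.2 y hy.2⟩
  absorb n y := by
    obtain ⟨m, hm⟩ := hF.absorb n y
    obtain ⟨m', hm'⟩ := hG.absorb n y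
    exact ⟨max m m', fun x hx => ⟨hm x (hF.anti (le_max_left _ _) hx.1),
      hm' x (hG.anti (le_max_right _ _) hx.2)⟩⟩

namespace KM

theorem isLieFilt_filt (D : Datum 𝔤) : IsLieFilt (filt D) where
  anti m n h X hX := ⟨fun k hk => hX.1 k (by omega), hX.2⟩
  lie n X hX Y hY := by
    refine ⟨fun k hk => ?_, ?_, rfl⟩
    · rw [lie_def, loop_mk, hX.2.2, hY.2.2, zero_smul, zero_smul, add_zero, sub_zero]
      unfold loopBracket
      rw [Finsupp.sum_apply]
      refine Finset.sum_eq_zero fun p hp => ?_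
      refine (Finsupp.sum_apply).trans (Finset.sum_eq_zero fun q hq => ?_)
      refine Finsupp.single_eq_of_ne' ?_
      have h1 : ¬ (p < n) := fun h => Finsupp.mem_support_iff.1 hp (hX.1 p h)
      have h2 : ¬ (q < n) := fun h => Finsupp.mem_support_iff.1 hq (hY.1 q h)
      omega
    · rw [lie_def, cK_mk]
      refine Finset.sum_eq_zero fun p hp => Finset.sum_eq_zero fun q hq => ?_
      have h1 : ¬ (p < n) := fun h => Finsupp.mem_support_iff.1 hp (hX.1 p h)
      have h2 : ¬ (q < n) := fun h => Finsupp.mem_support_iff.1 hq (hY.1 q h)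
      dsimp only
      split_ifs with h
      · obtain rfl : p = 0 := by omega
        simp
      · rfl
  absorb n Y := by
    obtain ⟨N, hN⟩ : ∃ N : ℕ, ∀ q ∈ (loop Y).support, -(N : ℤ) ≤ q := by
      refine ⟨(loop Y).support.sup Int.natAbs, fun q hq => ?_⟩
      have := Finset.le_sup (f := Int.natAbs) hq
      omega
    refine ⟨n + N + 1, fun X hX => ⟨fun k hk => ?_, ?_, rfl⟩⟩
    · rw [lie_def, loop_mk, hX.2.2, zero_smul, add_zero, Finsupp.sub_apply, Finsupp.smul_apply]
      have e1 : degree (loop X) k = 0 := by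
        unfold degree
        rw [Finsupp.sum_apply]
        refine Finset.sum_eq_zero fun p hp => Finsupp.single_eq_of_ne' ?_
        have h1 : ¬ (p < (n + N + 1 : ℕ)) := fun h => Finsupp.mem_support_iff.1 hp (hX.1 p h)
        omega
      rw [e1, smul_zero, sub_zero]
      unfold loopBracket
      rw [Finsupp.sum_apply]
      refine Finset.sum_eq_zero fun p hp => ?_
      refine (Finsupp.sum_apply).trans (Finset.sum_eq_zero fun q hq => ?_)
      refine Finsupp.single_eq_of_ne' ?_
      have h1 : ¬ (p < (n + N + 1 : ℕ)) := fun h => Finsupp.mem_support_iff.1 hp (hX.1 p h)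
      have h2 := hN q hq
      omega
    · rw [lie_def, cK_mk]
      refine Finset.sum_eq_zero fun p hp => Finset.sum_eq_zero fun q hq => ?_
      have h1 : ¬ (p < (n + N + 1 : ℕ)) := fun h => Finsupp.mem_support_iff.1 hp (hX.1 p h)
      have h2 := hN q hq
      exact if_neg (by omega)

theorem tau_tau (X : KM D) : tau (tau X) = X :=
  ext' (fun n => by simp [D.τ_τ]) (by simp) (by simp)

theorem filtBar_eq (D : Datum 𝔤) (n : ℕ) : filtBar D n = (filt D n).comap tau := by
  ext X
  constructor
  · rintro ⟨h1, h2, h3⟩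
    exact ⟨fun m hm => by rw [loop_tau, h1 _ (by omega), map_zero], by simp [h2], by simp [h3]⟩
  · rintro ⟨h1, h2, h3⟩
    refine ⟨fun m hm => ?_, by simpa using h2, by simpa using h3⟩
    have := h1 (-m) (by omega)
    rw [loop_tau, neg_neg] at this
    rw [← D.τ_τ (loop X m), this, map_zero]

theorem isLieFilt_filtBar (D : Datum 𝔤) : IsLieFilt (filtBar D) := by
  have h := (isLieFilt_filt D).comap (tau : KM D →ₛₗ[starRingEnd ℂ] KM D) tau_lie
  rwa [show (fun n => (filt D n).comap tau) = filtBar D from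
    funext fun n => (filtBar_eq D n).symm] at h

/-- `𝔤̃` with the filtrations `𝖥ₙ` and `𝖥̄ₙ`. -/
def biFilt (D : Datum 𝔤) : BiFilt (KM D) where
  pos := filt D
  neg := filtBar D
  isLieFilt_pos := isLieFilt_filt D
  isLieFilt_neg := isLieFilt_filtBar D

end KM

theorem isLieFilt_coeffIn {F : ℕ → Submodule ℂ (KM D)} (hF : IsLieFilt F) :
    IsLieFilt fun n => coeffIn P (F n) where
  anti _ _ h _ hX x p := hF.anti h (hX x p)
  lie n X hX Y hY x r := by
    rw [TD.lie_apply]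
    refine (F n).sum_mem fun p _ => (F n).sum_mem fun q _ => ?_
    split_ifs
    · exact hF.lie n _ (hX x p) _ (hY x q)
    · exact (F n).zero_mem
  absorb n Y := by
    choose m hm using fun y => hF.absorb n y
    refine ⟨Finset.univ.sup fun x => Finset.univ.sup fun q => m (Y x q), fun X hX x r => ?_⟩
    rw [TD.lie_apply]
    refine (F n).sum_mem fun p _ => (F n).sum_mem fun q _ => ?_
    split_ifs
    · refine hm _ _ (hF.anti ?_ (hX x p))
      exact (Finset.le_sup (f := fun q => m (Y x q)) (Finset.mem_univ q)).trans
        (Finset.le_sup (f := fun x => Finset.univ.sup fun q => m (Y x q)) (Finset.mem_univ x))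
    · exact (F n).zero_mem

theorem phi_lie (v w : WC P) : phi P ⁅v, w⁆ = ⁅phi P v, phi P w⁆ := by
  induction v using TensorProduct.induction_on with
  | zero => simp
  | add v v' h h' => rw [add_lie, map_add, map_add, add_lie, h, h']
  | tmul a u =>
    induction w using TensorProduct.induction_on with
    | zero =>
      rw [map_zero, lie_zero]
      exact (congrArg _ (lie_zero (a ⊗ₜ u : WC P))).trans (map_zero _)
    | add w w' h h' =>
      refine (congrArg _ (lie_add (a ⊗ₜ u : WC P) w w')).trans ?_
      rw [map_add, map_add, lie_add, h, h']
    | tmul b u' =>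
      rw [LieAlgebra.ExtendScalars.bracket_tmul]
      simp only [phi, LinearMap.liftBaseChange_tmul, smul_lie, lie_smul, smul_smul]
      rw [mul_comm b a]
      rfl

theorem conjW_lie (v w : WC P) : conjW P ⁅v, w⁆ = ⁅conjW P v, conjW P w⁆ := by
  have e : ∀ (a : ℂ) (u : gD P), conjW P (a ⊗ₜ u) = conj a ⊗ₜ u := fun _ _ => rfl
  induction v using TensorProduct.induction_on with
  | zero => simp
  | add v v' h h' => rw [add_lie, map_add, map_add, add_lie, h, h']
  | tmul a u =>
    induction w using TensorProduct.induction_on with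
    | zero =>
      refine (congrArg _ (lie_zero (a ⊗ₜ u : WC P))).trans ?_
      rw [map_zero]
      exact (lie_zero (conjW P (a ⊗ₜ u))).symm
    | add w w' h h' =>
      refine (congrArg _ (lie_add (a ⊗ₜ u : WC P) w w')).trans ?_
      rw [map_add, map_add, h, h']
      exact (lie_add (conjW P (a ⊗ₜ u)) (conjW P w) (conjW P w')).symm
    | tmul b u' =>
      rw [LieAlgebra.ExtendScalars.bracket_tmul, e, e, e, LieAlgebra.ExtendScalars.bracket_tmul,
        map_mul]

theorem isLieFilt_filtW : IsLieFilt (filtW P) :=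
  ((isLieFilt_coeffIn P (KM.isLieFilt_filt D)).comap (phi P) (phi_lie P)).inf
    ((isLieFilt_coeffIn P (KM.isLieFilt_filtBar D)).comap (phi P ∘ₛₗ conjW P)
      fun v w => by simp [conjW_lie, phi_lie])

/-- `𝔤̃^𝒟_ℂ` with the filtrations `𝖥ₙ` and `c(𝖥ₙ)`. -/
def biFiltW : BiFilt (WC P) where
  pos := filtW P
  neg := filtWBar P
  isLieFilt_pos := isLieFilt_filtW P
  isLieFilt_neg := (isLieFilt_filtW P).comap (conjW P) (conjW_lie P)

/-- The completed tensor product `𝔤̃ ⊗̂ 𝔤̃`. -/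
abbrev GG (D : Datum 𝔤) : Type _ := Compl (filt₂ (KM.biFilt D) (KM.biFilt D))

/-- The space `𝔉` of formal fields, the completion of `𝔤̃ ⊗ 𝔤̃^𝒟_ℂ` with respect to
`𝖥ₙ ⊗ c(𝖥ₙ) + 𝖥̄ₙ ⊗ 𝖥ₙ`. -/
abbrev FF : Type _ := Compl (filt₂ (KM.biFilt D) (biFiltW P))

/-- The completed triple tensor product `𝔤̃ ⊗̂ 𝔤̃ ⊗̂ 𝔤̃^𝒟_ℂ`. -/
abbrev GGW : Type _ := Compl (filt₃ (KM.biFilt D) (KM.biFilt D) (biFiltW P))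

/-! ## Rational functions -/

/-- Rational functions of one variable `z`. -/
abbrev Rat1 : Type := RatFunc ℂ

/-- The algebra `𝔄` of rational functions on `ℂ²`, with coordinates `z`, `z'`. -/
abbrev Rat2 : Type := FractionRing (MvPolynomial (Fin 2) ℂ)

/-- The coordinate `z` (`i = 0`) or `z'` (`i = 1`) on `ℂ²`. -/
def coord (i : Fin 2) : Rat2 := algebraMap (MvPolynomial (Fin 2) ℂ) Rat2 (MvPolynomial.X i)

theorem aeval_coord_injective (i : Fin 2) :
    Function.Injective (Polynomial.aeval (coord i) : Polynomial ℂ →ₐ[ℂ] Rat2) :=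
  transcendental_iff_injective.1 ((transcendental_algebraMap_iff
    (IsFractionRing.injective (MvPolynomial (Fin 2) ℂ) Rat2)).2 (MvPolynomial.transcendental_X ℂ i))

/-- The substitution `f ↦ f(z)` or `f ↦ f(z')`. -/
def subst (i : Fin 2) : Rat1 →ₐ[ℂ] Rat2 :=
  RatFunc.liftAlgHom (Polynomial.aeval (coord i))
    (nonZeroDivisors_le_comap_nonZeroDivisors_of_injective _ (aeval_coord_injective i))

/-- The union `Πz` of the dihedral orbits of the finite marked points. -/
def orbits : Set ℂ := {y | ∃ x ∈ P.Z, ∃ k b, D.mu k b x = y}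

/-- The algebra `R_{Πz}` of rational functions whose poles are in `Πz` or at infinity. -/
def regAlg : Subalgebra ℂ Rat1 where
  carrier := {f | ∀ a, f.denom.IsRoot a → a ∈ orbits P}
  mul_mem' := by
    intro f g hf hg a ha
    have := ha.dvd (RatFunc.denom_mul_dvd f g)
    rcases Polynomial.root_mul.1 this with h | h
    · exact hf a h
    · exact hg a h
  add_mem' := by
    intro f g hf hg a ha
    have := ha.dvd (RatFunc.denom_add_dvd f g)
    rcases Polynomial.root_mul.1 this with h | h
    · exact hf a h
    · exact hg a h
  algebraMap_mem' c a ha := by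
    rw [show algebraMap ℂ Rat1 c = RatFunc.C c from rfl, RatFunc.denom_C] at ha
    simp at ha

theorem comp_scale_injective (c : ℂ) (hc : c ≠ 0) : Function.Injective
    (Polynomial.aeval (Polynomial.C c * Polynomial.X) : Polynomial ℂ →ₐ[ℂ] Polynomial ℂ) := by
  intro p q h
  rw [← Polynomial.comp_eq_aeval, ← Polynomial.comp_eq_aeval] at h
  ext n
  have := congrArg (fun r => Polynomial.coeff r n) h
  simp only [Polynomial.comp_C_mul_X_coeff] at this
  exact mul_right_cancel₀ (pow_ne_zero n hc) this

/-- `f(z) dz ↦ ω⁻¹ f(ω⁻¹ z) dz`, the action of `s` on the coefficient `f` of a differential. -/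
def formS (D : Datum 𝔤) : Rat1 →ₗ[ℂ] Rat1 :=
  D.ω⁻¹ • (RatFunc.mapAlgHom (Polynomial.aeval (Polynomial.C D.ω⁻¹ * Polynomial.X))
    (nonZeroDivisors_le_comap_nonZeroDivisors_of_injective _ (comp_scale_injective D.ω⁻¹
      (inv_ne_zero (D.primitive.ne_zero D.T_pos.ne'))))).toLinearMap

/-- `f(z) ↦ \overline{f(\bar z)}`: all coefficients are conjugated. -/
def conjRat : Rat1 →+* Rat1 :=
  RatFunc.mapRingHom (Polynomial.mapRingHom (starRingEnd ℂ))
    (nonZeroDivisors_le_comap_nonZeroDivisors_of_injective (Polynomial.mapRingHom (starRingEnd ℂ))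
      (Polynomial.map_injective (starRingEnd ℂ) (starRingEnd ℂ).injective))

theorem conjRat_C (c : ℂ) : conjRat (RatFunc.C c) = RatFunc.C (conj c) := by
  have := RatFunc.map_apply_div (Polynomial.mapRingHom (starRingEnd ℂ))
    (nonZeroDivisors_le_comap_nonZeroDivisors_of_injective (Polynomial.mapRingHom (starRingEnd ℂ))
      (Polynomial.map_injective (starRingEnd ℂ) (starRingEnd ℂ).injective)) (Polynomial.C c) 1
  rw [map_one, map_one, map_one, div_one, div_one] at this
  refine Eq.trans this ?_
  simp

/-- `f(z) dz ↦ \overline{f(\bar z)} dz`, the action of `t` on the coefficient `f` of a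
differential. -/
def formT : Rat1 →ₛₗ[starRingEnd ℂ] Rat1 where
  toFun := conjRat
  map_add' := map_add _
  map_smul' c f := by
    rw [RatFunc.smul_eq_C_mul, RatFunc.smul_eq_C_mul, map_mul, conjRat_C]

/-! ## Dual bases -/

/-- The real form `{x | σᵏ τ x = ω^{kp} x}` of `𝔤`. -/
def gReal (D : Datum 𝔤) (k : ℕ) (p : ℤ) : Submodule ℝ 𝔤 where
  carrier := {x | D.σ^[k] (D.τ x) = D.ω ^ (k * p) • x}
  zero_mem' := by simp [iterate_map_zero]
  add_mem' := by
    rintro x y (hx : _ = _) (hy : _ = _)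
    simp only [Set.mem_ofPred_eq, map_add, iterate_map_add, hx, hy, smul_add]
  smul_mem' := by
    rintro r x (hx : _ = _)
    have e : r • x = (r : ℂ) • x := rfl
    have h : ∀ (k : ℕ) (y : 𝔤), D.σ^[k] ((r : ℂ) • y) = (r : ℂ) • D.σ^[k] y := by
      intro k
      induction k with
      | zero => intro y; rfl
      | succ k ih => intro y; rw [Function.iterate_succ_apply, map_smul, ih]; rfl
    simp only [Set.mem_ofPred_eq, e, map_smulₛₗ, Complex.conj_ofReal, h, hx]
    exact smul_comm _ _ _

/-- The real subspace `{x | σ x = ω^j x, τ x = x}` of the `j`-th eigenspace of `σ`. -/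
def gEig (D : Datum 𝔤) (j : ℤ) : Submodule ℝ 𝔤 where
  carrier := {x | D.σ x = D.ω ^ j • x ∧ D.τ x = x}
  zero_mem' := by simp
  add_mem' := by
    rintro x y ⟨hx, hx'⟩ ⟨hy, hy'⟩
    exact ⟨by rw [map_add, hx, hy, smul_add], by rw [map_add, hx', hy']⟩
  smul_mem' := by
    rintro r x ⟨hx, hx'⟩
    have e : r • x = (r : ℂ) • x := rfl
    refine ⟨?_, ?_⟩
    · rw [e, map_smul, hx]; exact smul_comm _ _ _
    · rw [e, map_smulₛₗ, Complex.conj_ofReal, hx']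

/-- A basis of a real subspace `U` of `𝔤`, with its dual basis in `U'` relative to the form. -/
structure DualBases (D : Datum 𝔤) (U U' : Submodule ℝ 𝔤) where
  basis : Module.Basis (Fin (Module.finrank ℝ U)) ℝ U
  dual : Fin (Module.finrank ℝ U) → 𝔤
  dual_mem : ∀ a, dual a ∈ U'
  form_basis_dual : ∀ a b, D.form (basis a) (dual b) = if a = b then 1 else 0

/-- A choice of bases and dual bases of the finite-dimensional real spaces above. The real
form `𝔤₀ = {x | τ x = x}` is the case `k = p = 0` of `real`. -/
structure Bases (D : Datum 𝔤) where
  real : ∀ (k : ℕ) (p : ℤ), DualBases D (gReal D k p) (gReal D k (-p))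
  eig : ∀ j : ℤ, DualBases D (gEig D j) (gEig D (-j))

/-- The index set of a basis of the affine algebra, given an index set `Fin d` in finite
dimension. -/
inductive Idx (d : ℕ)
  | loop (a : Fin d) (n : ℤ)
  | cK
  | cD

/-- The partial sum over all indices with mode number `|n| < N`. -/
def psum {d : ℕ} {A : Type*} [AddCommMonoid A] (N : ℕ) (f : Idx d → A) : A :=
  (∑ a, ∑ n ∈ Finset.Ioo (-(N : ℤ)) N, f (.loop a n)) + f .cK + f .cD

namespace Bases

variable (E : Bases D)

/-- The complex basis `Iᵃₙ`, `K`, `D` of `𝔤̃`, where `Iᵃ` is the basis of `𝔤₀`. -/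
def aff : Idx (Module.finrank ℝ (gReal D 0 0)) → KM D
  | .loop a n => KM.mode n ((E.real 0 0).basis a : 𝔤)
  | .cK => KM.K
  | .cD => KM.der

/-- The dual basis `I_{a,-n}`, `D`, `K`. -/
def affDual : Idx (Module.finrank ℝ (gReal D 0 0)) → KM D
  | .loop a n => KM.mode (-n) ((E.real 0 0).dual a)
  | .cK => KM.der
  | .cD => KM.K

/-- For `x ∈ 𝔤`: the elements `x₀`, `(xₙ + x₋ₙ)/√2` and `i(xₙ - x₋ₙ)/√2` for `n > 0`, the last ones
being indexed by `-n`. -/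
def realMode (D : Datum 𝔤) (n : ℤ) (x : 𝔤) : KM D :=
  if n = 0 then KM.mode 0 x
  else if 0 < n then ((Real.sqrt 2 : ℂ)⁻¹) • (KM.mode n x + KM.mode (-n) x)
  else (Complex.I * (Real.sqrt 2 : ℂ)⁻¹) • (KM.mode (-n) x - KM.mode n x)

/-- The square root `ω^{kp/2}`. -/
def eta (D : Datum 𝔤) (k : ℕ) (p : ℤ) : ℂ := (D.ω ^ (k * p)) ^ (1 / 2 : ℂ)

/-- The basis of the real form `{X | σᵏ τ X = ω^{kp} X}` of `𝔤̃`. -/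
def affReal (k : ℕ) (p : ℤ) : Idx (Module.finrank ℝ (gReal D k p)) → KM D
  | .loop a n => realMode D n ((E.real k p).basis a : 𝔤)
  | .cK => (Complex.I * (eta D k p)⁻¹) • KM.K
  | .cD => (Complex.I * (eta D k p)⁻¹) • KM.der

/-- The dual basis of `affReal k p`. -/
def affRealDual (k : ℕ) (p : ℤ) : Idx (Module.finrank ℝ (gReal D k p)) → KM D
  | .loop a n => realMode D n ((E.real k p).dual a)
  | .cK => (-Complex.I * eta D k p) • KM.der
  | .cD => (-Complex.I * eta D k p) • KM.K

/-- The basis of `{X | σ X = ω^j X, τ X = X}`; the elements `iK`, `iD` belong to it only if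
`T ∣ j` and are replaced by `0` otherwise. -/
def affEig (j : ℤ) : Idx (Module.finrank ℝ (gEig D j)) → KM D
  | .loop a n => realMode D n ((E.eig j).basis a : 𝔤)
  | .cK => if (D.T : ℤ) ∣ j then Complex.I • KM.K else 0
  | .cD => if (D.T : ℤ) ∣ j then Complex.I • KM.der else 0

/-- The dual basis of `affEig j`. -/
def affEigDual (j : ℤ) : Idx (Module.finrank ℝ (gEig D j)) → KM D
  | .loop a n => realMode D n ((E.eig j).dual a)
  | .cK => if (D.T : ℤ) ∣ j then -Complex.I • KM.der else 0
  | .cD => if (D.T : ℤ) ∣ j then -Complex.I • KM.K else 0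

end Bases

theorem Datum.ω_ne_zero (D : Datum 𝔤) : D.ω ≠ 0 := D.primitive.ne_zero D.T_pos.ne'

theorem Datum.norm_ω (D : Datum 𝔤) : ‖D.ω‖ = 1 := D.primitive.norm'_eq_one D.T_pos.ne'

theorem KM.sigma_realMode (j n : ℤ) (x : 𝔤) (hx : D.σ x = D.ω ^ j • x) :
    KM.sigma (Bases.realMode D n x) = D.ω ^ j • Bases.realMode D n x := by
  have h : ∀ n, KM.sigma (KM.mode n x : KM D) = D.ω ^ j • KM.mode n x := fun n => by
    refine (KM.sigma_elem n x 0 0).trans ?_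
    rw [hx]
    exact KM.ext' (fun m => by simp [KM.mode]) (by simp [KM.mode]) (by simp [KM.mode])
  unfold Bases.realMode
  split_ifs <;> simp only [map_smul, map_add, map_sub, h] <;> module

theorem KM.iterate_tau_realMode (f : KM D →ₗ[ℂ] KM D) (c : ℂ) (n : ℤ) (x : 𝔤)
    (h : ∀ n, f (KM.tau (KM.mode n x)) = c • KM.mode (-n) x) :
    f (KM.tau (Bases.realMode D n x)) = c • Bases.realMode D n x := by
  unfold Bases.realMode
  split_ifs
  · simpa using h 0
  · rw [map_smulₛₗ, map_smul, map_add, map_add, h, h, neg_neg, map_inv₀, Complex.conj_ofReal]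
    module
  · rw [map_smulₛₗ, map_smul, map_sub, map_sub, h, h, neg_neg, map_mul, map_inv₀,
      Complex.conj_ofReal, Complex.conj_I]
    module

theorem KM.sigma_pow_T (D : Datum 𝔤) : (KM.sigma : Module.End ℂ (KM D)) ^ D.T = 1 := by
  have h : ∀ (k : ℕ) (X : KM D), (((KM.sigma : Module.End ℂ (KM D)) ^ k) X) =
      KM.mk ((KM.loop X).mapRange (D.σ^[k]) (iterate_map_zero D.σ k)) (KM.cK X) (KM.cD X) := by
    intro k
    induction k with
    | zero => intro X; exact KM.ext' (fun n => by simp) (by simp) (by simp)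
    | succ k ih =>
      intro X
      rw [pow_succ', Module.End.mul_apply, ih]
      refine KM.ext' (fun n => ?_) (by simp) (by simp)
      rw [KM.loop_sigma, KM.loop_mk, KM.loop_mk, Finsupp.mapRange_apply, Finsupp.mapRange_apply,
        Function.iterate_succ_apply']
  ext1 X
  rw [h]
  exact KM.ext' (fun n => by simp [D.σ_iterate]) (by simp) (by simp)

theorem KM.sigma_pow_congr {k k' : ℕ} (h : D.ω ^ k = D.ω ^ k') :
    (KM.sigma : Module.End ℂ (KM D)) ^ k = KM.sigma ^ k' := by
  have h0 : D.ω ≠ 0 := D.ω_ne_zero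
  have h1 : D.ω ^ ((k' : ℤ) - k) = 1 := by
    rw [zpow_sub₀ h0, zpow_natCast, zpow_natCast, h, div_self (pow_ne_zero _ h0)]
  have h2 : k % D.T = k' % D.T := Nat.modEq_iff_dvd.2 ((D.primitive.zpow_eq_one_iff_dvd _).1 h1)
  rw [pow_eq_pow_mod k (KM.sigma_pow_T D), pow_eq_pow_mod k' (KM.sigma_pow_T D), h2]

theorem KM.act_apply (k : ℕ) (b : Bool) (X : KM D) : KM.act k b X =
    ((KM.sigma : Module.End ℂ (KM D)) ^ k) (if b then KM.tau X else X) := by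
  have h : ∀ (k : ℕ) (X : KM D), ((KM.sigma.restrictScalars ℝ : KM D →ₗ[ℝ] KM D) ^ k) X
      = ((KM.sigma : Module.End ℂ (KM D)) ^ k) X := by
    intro k
    induction k with
    | zero => intro X; rfl
    | succ k ih => intro X; rw [pow_succ', pow_succ', Module.End.mul_apply, ih]; rfl
  cases b
  · exact h k X
  · exact h k (KM.tau X)

theorem KM.sigma_pow_apply {c : ℂ} {X : KM D} (h : KM.sigma X = c • X) (k : ℕ) :
    ((KM.sigma : Module.End ℂ (KM D)) ^ k) X = c ^ k • X := by
  induction k with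
  | zero => simp
  | succ k ih => rw [pow_succ', Module.End.mul_apply, ih, map_smul, h, smul_smul, pow_succ]

theorem KM.sigma_pow_elem (k : ℕ) (n : ℤ) (x : 𝔤) (α a : ℂ) :
    ((KM.sigma : Module.End ℂ (KM D)) ^ k) (KM.elem n x α a) = KM.elem n (D.σ^[k] x) α a := by
  induction k with
  | zero => rfl
  | succ k ih =>
    rw [pow_succ', Module.End.mul_apply, ih, KM.sigma_elem, Function.iterate_succ_apply']

theorem Datum.norm_eta (D : Datum 𝔤) (k : ℕ) (p : ℤ) : ‖Bases.eta D k p‖ = 1 := by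
  have h : ‖Bases.eta D k p‖ ^ 2 = 1 := by
    rw [← norm_pow, Bases.eta, one_div, ← Nat.cast_ofNat (R := ℂ),
      Complex.cpow_nat_inv_pow _ two_ne_zero, norm_zpow, D.norm_ω, one_zpow]
  exact (pow_eq_one_iff_of_nonneg (norm_nonneg _) two_ne_zero).1 h

theorem Datum.eta_sq (D : Datum 𝔤) (k : ℕ) (p : ℤ) :
    Bases.eta D k p * Bases.eta D k p = D.ω ^ (k * p) := by
  rw [← sq, Bases.eta, one_div, ← Nat.cast_ofNat (R := ℂ), Complex.cpow_nat_inv_pow _ two_ne_zero]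

theorem Datum.conj_eta_inv (D : Datum 𝔤) (k : ℕ) (p : ℤ) :
    conj (Bases.eta D k p)⁻¹ = Bases.eta D k p := by
  rw [map_inv₀, ← Complex.inv_eq_conj (D.norm_eta k p), inv_inv]

theorem Datum.eta_ne_zero (D : Datum 𝔤) (k : ℕ) (p : ℤ) : Bases.eta D k p ≠ 0 :=
  norm_ne_zero_iff.1 (by rw [D.norm_eta]; exact one_ne_zero)

theorem KM.tau_K : KM.tau (KM.K : KM D) = -KM.K :=
  KM.ext' (fun n => by simp [KM.K]) (by simp [KM.K]) (by simp [KM.K])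
theorem KM.tau_der : KM.tau (KM.der : KM D) = -KM.der :=
  KM.ext' (fun n => by simp [KM.der]) (by simp [KM.der]) (by simp [KM.der])
theorem KM.sigma_K : KM.sigma (KM.K : KM D) = KM.K :=
  KM.ext' (fun n => by simp [KM.K]) (by simp [KM.K]) (by simp [KM.K])
theorem KM.sigma_der : KM.sigma (KM.der : KM D) = KM.der :=
  KM.ext' (fun n => by simp [KM.der]) (by simp [KM.der]) (by simp [KM.der])

namespace Bases

variable (E : Bases D)

/-- The elements of `affReal k p` belong to the real form `{X | σᵏ τ X = ω^{kp} X}`. -/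
theorem act_affReal (k : ℕ) (p : ℤ) (i : Idx (Module.finrank ℝ (gReal D k p))) :
    ((KM.sigma : Module.End ℂ (KM D)) ^ k) (KM.tau (E.affReal k p i))
      = D.ω ^ (k * p) • E.affReal k p i := by
  have key : ∀ X : KM D, KM.sigma X = X → KM.tau X = -X →
      ((KM.sigma : Module.End ℂ (KM D)) ^ k) (KM.tau ((Complex.I * (eta D k p)⁻¹) • X))
        = D.ω ^ (k * p) • (Complex.I * (eta D k p)⁻¹) • X := by
    intro X h1 h2
    rw [map_smulₛₗ, map_smul, h2, map_neg, KM.sigma_pow_apply (c := 1) (by rw [h1, one_smul]),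
      one_pow, one_smul, map_mul, D.conj_eta_inv, Complex.conj_I, smul_smul, ← D.eta_sq, smul_neg,
      ← neg_smul]
    congr 1
    field_simp [D.eta_ne_zero k p]
  cases i with
  | loop a n =>
    refine KM.iterate_tau_realMode _ _ n _ fun m => ?_
    have hx : D.σ^[k] (D.τ ((E.real k p).basis a)) = D.ω ^ (k * p) • ((E.real k p).basis a : 𝔤) :=
      ((E.real k p).basis a).2
    refine (congrArg _ (KM.tau_elem m _ 0 0)).trans ((KM.sigma_pow_elem k _ _ _ _).trans ?_)
    rw [hx]
    exact KM.ext' (fun m => by simp [KM.mode]) (by simp [KM.mode]) (by simp [KM.mode])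
  | cK => exact key _ KM.sigma_K KM.tau_K
  | cD => exact key _ KM.sigma_der KM.tau_der

theorem sigma_affEig (j : ℤ) (i : Idx (Module.finrank ℝ (gEig D j))) :
    KM.sigma (E.affEig j i) = D.ω ^ j • E.affEig j i := by
  have key : ∀ X : KM D, KM.sigma X = X →
      KM.sigma (if (D.T : ℤ) ∣ j then Complex.I • X else 0)
        = D.ω ^ j • (if (D.T : ℤ) ∣ j then Complex.I • X else 0) := by
    intro X h
    split_ifs with hj
    · rw [map_smul, h, (D.primitive.zpow_eq_one_iff_dvd j).2 hj, one_smul]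
    · simp
  cases i with
  | loop a n => exact KM.sigma_realMode j n _ ((E.eig j).basis a).2.1
  | cK => exact key _ KM.sigma_K
  | cD => exact key _ KM.sigma_der

theorem tau_affEig (j : ℤ) (i : Idx (Module.finrank ℝ (gEig D j))) :
    KM.tau (E.affEig j i) = E.affEig j i := by
  have key : ∀ X : KM D, KM.tau X = -X →
      KM.tau (if (D.T : ℤ) ∣ j then Complex.I • X else 0)
        = (if (D.T : ℤ) ∣ j then Complex.I • X else 0) := by
    intro X h
    split_ifs with hj
    · rw [map_smulₛₗ, h, Complex.conj_I, neg_smul, smul_neg, neg_neg]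
    · simp
  cases i with
  | loop a n =>
    have := KM.iterate_tau_realMode (D := D) LinearMap.id 1 n ((E.eig j).basis a : 𝔤) fun m => by
      refine (KM.tau_elem m _ 0 0).trans ?_
      rw [((E.eig j).basis a).2.2]
      exact KM.ext' (fun m => by simp [KM.mode]) (by simp [KM.mode]) (by simp [KM.mode])
    rwa [one_smul] at this
  | cK => exact key _ KM.tau_K
  | cD => exact key _ KM.tau_der

end Bases

/-! ## Elements of `𝔤̃^𝒟` with a single nonzero coefficient -/

/-- The element `X ε^p` of the Takiff algebra at the point `x`. -/
def TD.single (x : Option P.Z) (p : Fin (P.ord x)) (X : KM D) : TD P :=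
  fun y q => if y = x ∧ (q : ℕ) = p then X else 0

theorem single_mem (x : Option P.Z) (p : Fin (P.ord x)) (X : KM D)
    (h : ∀ k b, Fixes k b x → weight k p x • KM.act k b X = X) (h0 : x = none → (p : ℕ) ≠ 0) :
    TD.single P x p X ∈ gD P := by
  refine ⟨fun y k b hy q => ?_, fun q hq => ?_⟩
  · unfold TD.single
    split_ifs with hxy
    · obtain ⟨rfl, hq⟩ := hxy
      rw [hq]
      exact h k b hy
    · rw [map_zero, smul_zero]
  · unfold TD.single
    exact if_neg fun hxy => h0 hxy.1.symm (hxy.2.symm.trans hq)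

variable {P}

/-- `X ε^p` at a complex point, i.e. a nonzero point fixed by no reflection. -/
def genC (x : P.Z) (hx : (x : ℂ) ≠ 0) (hx' : ∀ k, D.mu k true x ≠ x) (p : Fin (P.ord (some x)))
    (X : KM D) : gD P :=
  ⟨TD.single P (some x) p X, single_mem P _ p X (by
    intro k b hb
    have hb' : D.mu k b x = x := hb
    cases b with
    | true => exact absurd hb' (hx' k)
    | false =>
      have hk : D.ω ^ k = 1 := mul_right_cancel₀ hx (hb'.trans (one_mul _).symm)
      have e : (KM.sigma : Module.End ℂ (KM D)) ^ k = 1 := by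
        rw [KM.sigma_pow_congr (hk.trans (pow_zero D.ω).symm), pow_zero]
      rw [KM.act_apply, e]
      simp [weight, pow_mul, hk]) (by simp)⟩

/-- `X ε^p` at a nonzero point fixed by the reflection `sᵏ t`, for `X` in the real
form `{X | σᵏ τ X = ω^{kp} X}`. -/
def genR (x : P.Z) (hx : (x : ℂ) ≠ 0) {k : ℕ} (hk : D.mu k true x = x) (p : Fin (P.ord (some x)))
    (X : KM D) (hX : ((KM.sigma : Module.End ℂ (KM D)) ^ k) (KM.tau X)
      = D.ω ^ ((k : ℤ) * (p : ℕ)) • X) : gD P :=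
  ⟨TD.single P (some x) p X, single_mem P _ p X (by
    intro k' b hb
    have hb' : D.mu k' b x = x := hb
    cases b with
    | true =>
      have h1 : D.ω ^ k' = D.ω ^ k :=
        mul_right_cancel₀ (b := conj (x : ℂ)) ((map_ne_zero _).2 hx) (hb'.trans hk.symm)
      rw [KM.act_apply, if_pos rfl, KM.sigma_pow_congr h1, hX, weight, smul_smul, pow_mul, h1,
        ← pow_mul, ← zpow_natCast, Nat.cast_mul, inv_mul_cancel₀, one_smul]
      exact zpow_ne_zero _ D.ω_ne_zero
    | false =>
      have h1 : D.ω ^ k' = 1 := mul_right_cancel₀ hx (hb'.trans (one_mul _).symm)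
      have e : (KM.sigma : Module.End ℂ (KM D)) ^ k' = 1 := by
        rw [KM.sigma_pow_congr (h1.trans (pow_zero D.ω).symm), pow_zero]
      rw [KM.act_apply, e]
      simp [weight, pow_mul, h1]) (by simp)⟩

/-- `X ε^p` at the origin, for `X` with `σ X = ω^p X` and `τ X = X`. -/
def genO (x : P.Z) (p : Fin (P.ord (some x))) (X : KM D)
    (hσ : KM.sigma X = D.ω ^ ((p : ℕ) : ℤ) • X) (hτ : KM.tau X = X) : gD P :=
  ⟨TD.single P (some x) p X, single_mem P _ p X (by
    intro k b _
    have h : KM.act k b X = (D.ω ^ ((p : ℕ) : ℤ)) ^ k • X := by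
      rw [KM.act_apply, hτ, ite_self, KM.sigma_pow_apply hσ]
    rw [h, weight, smul_smul, zpow_natCast, ← pow_mul, mul_comm (p : ℕ) k, inv_mul_cancel₀, one_smul]
    exact pow_ne_zero _ D.ω_ne_zero) (by simp)⟩

/-- `X ε^p` at infinity for `p ≠ 0`, for `X` with `σ X = ω^{-p} X` and `τ X = X`. -/
def genInf (p : Fin (P.ord none)) (hp : (p : ℕ) ≠ 0) (X : KM D)
    (hσ : KM.sigma X = D.ω ^ (-((p : ℕ) : ℤ)) • X) (hτ : KM.tau X = X) : gD P :=
  ⟨TD.single P none p X, single_mem P _ p X (by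
    intro k b _
    have h : KM.act k b X = (D.ω ^ (-((p : ℕ) : ℤ))) ^ k • X := by
      rw [KM.act_apply, hτ, ite_self, KM.sigma_pow_apply hσ]
    rw [h, weight, smul_smul, zpow_neg, zpow_natCast, inv_pow, ← pow_mul, mul_comm (p : ℕ) k,
      mul_inv_cancel₀, one_smul]
    exact pow_ne_zero _ D.ω_ne_zero) (fun _ => hp)⟩

/-! ## The canonical element -/

/-- The space of `𝔤̃`-valued rational differentials; `X ⊗ f` stands for `X ⊗ f(z) dz`. -/
abbrev Omega (D : Datum 𝔤) : Type _ := KM D ⊗[ℂ] Rat1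

/-- The action of the dihedral group element `sᵏ tᵇ` on `𝔤̃`-valued differentials. -/
def actOmega (D : Datum 𝔤) (k : ℕ) (b : Bool) (v : Omega D) : Omega D :=
  (TensorProduct.map (KM.sigma : KM D →ₗ[ℂ] KM D) (formS D))^[k]
    (if b then TensorProduct.map (KM.tau : KM D →ₛₗ[starRingEnd ℂ] KM D) formT v else v)

/-- `(z - x)^{-p-1}`. -/
def pole (x : ℂ) (p : ℕ) : Rat1 := ((RatFunc.X - RatFunc.C x) ^ (p + 1))⁻¹

variable (P) (E : Bases D)

/-- The contribution of a complex point `x` to the canonical element. -/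
def phiC (N : ℕ) (x : P.Z) (hx : (x : ℂ) ≠ 0) (hx' : ∀ k, D.mu k true x ≠ x) :
    Omega D ⊗[ℝ] gD P :=
  ∑ p : Fin (P.ord (some x)), psum N fun i =>
    (((2 * D.T : ℝ)⁻¹ • ∑ k ∈ Finset.range D.T, ∑ b : Bool,
      actOmega D k b (E.affDual i ⊗ₜ pole x p)) ⊗ₜ[ℝ] genC x hx hx' p (E.aff i) +
    ((2 * D.T : ℝ)⁻¹ • ∑ k ∈ Finset.range D.T, ∑ b : Bool,
      actOmega D k b ((-Complex.I • E.affDual i) ⊗ₜ pole x p)) ⊗ₜ[ℝ]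
        genC x hx hx' p (Complex.I • E.aff i))

/-- The contribution of a nonzero point fixed by a reflection `sᵏ t`. -/
def phiR (N : ℕ) (x : P.Z) (hx : (x : ℂ) ≠ 0) (k : ℕ) (hk : D.mu k true x = x) :
    Omega D ⊗[ℝ] gD P :=
  ∑ p : Fin (P.ord (some x)), psum N fun i =>
    ((D.T : ℝ)⁻¹ • ∑ l ∈ Finset.range D.T,
      actOmega D l false (E.affRealDual k (p : ℕ) i ⊗ₜ pole x p)) ⊗ₜ[ℝ]
        genR x hx hk p (E.affReal k (p : ℕ) i) (E.act_affReal k (p : ℕ) i)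

/-- The contribution of the origin. -/
def phiO (N : ℕ) (x : P.Z) : Omega D ⊗[ℝ] gD P :=
  ∑ p : Fin (P.ord (some x)), psum N fun i =>
    (E.affEigDual (p : ℕ) i ⊗ₜ[ℂ] pole 0 p) ⊗ₜ[ℝ]
      genO x p (E.affEig (p : ℕ) i) (E.sigma_affEig _ i) (E.tau_affEig _ i)

/-- The contribution of infinity. -/
def phiInf (N : ℕ) : Omega D ⊗[ℝ] gD P :=
  ∑ p : Fin (P.ord none), if hp : (p : ℕ) = 0 then 0 else psum N fun i =>
    (-(E.affEigDual (-((p : ℕ) : ℤ)) i ⊗ₜ[ℂ] ((RatFunc.X : Rat1) ^ ((p : ℕ) - 1)))) ⊗ₜ[ℝ]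
      genInf p hp (E.affEig (-((p : ℕ) : ℤ)) i) (E.sigma_affEig _ i) (E.tau_affEig _ i)

open Classical in
/-- The canonical element `Φ = I_A ⊗ I^A`, truncated to modes `|n| < N`. -/
def Phi (N : ℕ) : Omega D ⊗[ℝ] gD P :=
  (∑ x : P.Z, if hx : (x : ℂ) = 0 then phiO P E N x
    else if hk : ∃ k, D.mu k true x = x then phiR P E N x hx hk.choose hk.choose_spec
    else phiC P E N x hx (not_exists.1 hk)) + phiInf P E N

/-- `(X ⊗ f dz) ⊗ Y ↦ (X ⊗ (Y ⊗ 1)) ⊗ f`. -/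
def zeta : Omega D ⊗[ℝ] gD P →ₗ[ℝ] (KM D ⊗[ℂ] WC P) ⊗[ℂ] Rat1 :=
  TensorProduct.lift (LinearMap.mk₂ ℝ
    (fun (v : Omega D) (Y : gD P) => TensorProduct.map
      ((TensorProduct.mk ℂ (KM D) (WC P)).flip (1 ⊗ₜ[ℝ] Y)) LinearMap.id v)
    (fun v v' Y => by rw [map_add])
    (fun r v Y => LinearMap.map_smul_of_tower _ r v)
    (fun v Y Y' => by
      rw [TensorProduct.tmul_add, map_add, TensorProduct.map_add_left, LinearMap.add_apply])
    (fun r v Y => by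
      have h : (1 : ℂ) ⊗ₜ[ℝ] (r • Y) = (r : ℂ) • ((1 : ℂ) ⊗ₜ[ℝ] Y) := by
        rw [TensorProduct.tmul_smul]; rfl
      rw [h, map_smul, TensorProduct.map_smul_left, LinearMap.smul_apply]
      exact Complex.coe_smul r _))

/-! ## The formal Lax matrix and the formal `r`-matrix -/

/-- `L` is the formal Lax matrix: `ζ(Φ) = L(z) dz`, where `Φ` is the limit of its truncations. -/
def IsFormalLax (L : FF P ⊗[ℂ] regAlg P) : Prop :=
  ∀ N, TensorProduct.map (Compl.proj _ N) (regAlg P).val.toLinearMap L =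
    TensorProduct.map (filt₂ (KM.biFilt D) (biFiltW P) N).mkQ LinearMap.id (zeta P (Phi P E N))

/-- `L(z)` (`i = 0`) or `L(z')` (`i = 1`), with coefficients in `𝔄`. -/
def laxAt (i : Fin 2) : FF P ⊗[ℂ] regAlg P →ₗ[ℂ] FF P ⊗[ℂ] Rat2 :=
  TensorProduct.map LinearMap.id ((subst i).toLinearMap ∘ₗ (regAlg P).val.toLinearMap)

variable {P}

/-- The truncation of `σᵏ Iᵃ ⊗ I_a`, the sum being over the dual bases of `𝔤̃`. -/
def casSeq (k N : ℕ) : KM D ⊗[ℂ] KM D :=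
  psum N fun i => ((KM.sigma : Module.End ℂ (KM D)) ^ k) (E.aff i) ⊗ₜ E.affDual i

theorem casSeq_succ_sub (k N : ℕ) :
    casSeq E k (N + 1) - casSeq E k N ∈ filt₂ (KM.biFilt D) (KM.biFilt D) N := by
  have hsub : Finset.Ioo (-(N : ℤ)) N ⊆ Finset.Ioo (-((N + 1 : ℕ) : ℤ)) ((N + 1 : ℕ) : ℤ) :=
    Finset.Ioo_subset_Ioo (by omega) (by omega)
  unfold casSeq psum
  rw [add_sub_add_right_eq_sub, add_sub_add_right_eq_sub, ← Finset.sum_sub_distrib]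
  refine Submodule.sum_mem _ fun a _ => ?_
  rw [← Finset.sum_sdiff hsub, add_sub_cancel_right]
  refine Submodule.sum_mem _ fun n hn => ?_
  simp only [Finset.mem_sdiff, Finset.mem_Ioo] at hn
  have h1 : ((KM.sigma : Module.End ℂ (KM D)) ^ k) (E.aff (.loop a n))
      = KM.elem n (D.σ^[k] ((E.real 0 0).basis a : 𝔤)) 0 0 := KM.sigma_pow_elem k n _ 0 0
  have h2 : E.affDual (.loop a n) = KM.elem (-n) ((E.real 0 0).dual a) 0 0 := rfl
  beta_reduce
  rw [h1, h2]
  rcases le_total 0 n with h | h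
  · refine Submodule.mem_sup_left (tmul_mem ⟨fun m hm => ?_, rfl, rfl⟩ ⟨fun m hm => ?_, rfl, rfl⟩)
    · exact Finsupp.single_eq_of_ne' (by omega)
    · exact Finsupp.single_eq_of_ne' (by omega)
  · refine Submodule.mem_sup_right (tmul_mem ⟨fun m hm => ?_, rfl, rfl⟩ ⟨fun m hm => ?_, rfl, rfl⟩)
    · exact Finsupp.single_eq_of_ne' (by omega)
    · exact Finsupp.single_eq_of_ne' (by omega)

/-- `σᵏ Iᵃ ⊗ I_a` as an element of `𝔤̃ ⊗̂ 𝔤̃`. -/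
def cas (k : ℕ) : GG D := Compl.ofSeq (antitone_filt₂ _ _) (casSeq E k) (casSeq_succ_sub E k)

/-- The formal `r`-matrix `𝔯(u, v) = T⁻¹ ∑ₖ (σᵏ Iᵃ ⊗ I_a) / (v - ω⁻ᵏ u)`. -/
def rMat (u v : Rat2) : GG D ⊗[ℂ] Rat2 :=
  (D.T : ℂ)⁻¹ • ∑ k ∈ Finset.range D.T, cas E k ⊗ₜ (v - (D.ω ^ k)⁻¹ • u)⁻¹

variable (P)

/-- `[r₁₂, L₁]` for `r ∈ (𝔤̃ ⊗̂ 𝔤̃) ⊗ 𝔄` and `L ∈ 𝔉 ⊗ 𝔄`. -/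
def bracket₁₂₁ : GG D ⊗[ℂ] Rat2 →ₗ[ℂ] FF P ⊗[ℂ] Rat2 →ₗ[ℂ] GGW P ⊗[ℂ] Rat2 :=
  TensorProduct.map₂ (contBilin_brk₁ (KM.biFilt D) (KM.biFilt D) (biFiltW P)).ext
    (LinearMap.mul ℂ Rat2)

/-- `[r₂₁, L₂]` for `r ∈ (𝔤̃ ⊗̂ 𝔤̃) ⊗ 𝔄` and `L ∈ 𝔉 ⊗ 𝔄`. -/
def bracket₂₁₂ : GG D ⊗[ℂ] Rat2 →ₗ[ℂ] FF P ⊗[ℂ] Rat2 →ₗ[ℂ] GGW P ⊗[ℂ] Rat2 :=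
  TensorProduct.map₂ (contBilin_brk₂ (KM.biFilt D) (KM.biFilt D) (biFiltW P)).ext
    (LinearMap.mul ℂ Rat2)

/-- `{L₁, M₂}` for `L, M ∈ 𝔉 ⊗ 𝔄`, the bracket being that of `𝔤̃^𝒟_ℂ`. -/
def poisson₁₂ : FF P ⊗[ℂ] Rat2 →ₗ[ℂ] FF P ⊗[ℂ] Rat2 →ₗ[ℂ] GGW P ⊗[ℂ] Rat2 :=
  TensorProduct.map₂ (contBilin_brk₃ (KM.biFilt D) (KM.biFilt D) (biFiltW P)).ext
    (LinearMap.mul ℂ Rat2)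
end DihedralGaudin

end

noncomputable section
namespace DihedralGaudin

/-! ## Linear algebra and finite sums -/

section General

/-! The invariant form turns formal tensors into maps. A linear map J from 𝔤̃ to 𝔤̃^𝒟_ℂ that
respects the filtrations (`ContHom`) defines the element ∑ I_ã ⊗ J(I^ã) of 𝔉 (`canon`), and
contracting its partial sums with ⟨X, ·⟩ gives back J(X) once all modes of X are covered. The Lax
matrix is therefore built from a rational family 𝒥(z) of such maps.

Contract the first two tensor factors of the bracket identity with ⟨X, ·⟩ and ⟨Y, ·⟩. Invariance of
the form and ∑ ⟨Y, I_ã⟩ σ^k I^ã = σ^k Y turn it into [𝒥(z)X, 𝒥(z')Y] = T⁻¹ ∑ₖ 𝒥(z)[X, σ^k Y] / (z' -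
ω⁻ᵏz) - T⁻¹ ∑ₖ 𝒥(z')[Y, σ^k X] / (z - ω⁻ᵏz') (`coeff_brk₁`, `coeff_brk₂`, `coeff_brk₃`). Nothing is
lost, because these contractions separate the points of the completed triple product
(`coeff_separating`).

The remaining identity lives in 𝔤̃^𝒟_ℂ, which embeds by v ↦ (φ(v), τφ(cv)) into two copies of the
Takiff algebras; both maps are complex linear and respect brackets (`comp_separating`, `comp_lie`).
In either copy the coefficient of ε_y^p in 𝒥(z)X has the same shape T⁻¹ ∑ₖ σ^k X ⊗ ω^k h_p(ω^k z)
(`cyclo`). Here h_p(u) is (u - x)^(-p-1), with x equal to y or to its conjugate, and at infinity it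
is -u^(p-1), or 0 for p = 0. All terms become double sums of [σ^k X, σ^l Y], and their coefficients
agree by the partial fraction identity ∑_{p+q=r} h_p(u) h_q(v) = (h_r(u) - h_r(v)) / (v - u)
(`sum_poleFun_mul`, `lieRat_cyclo`).

It remains to see that ζ(Φ) comes from such a family (`exists_lax`). Each real form in use
complexifies to 𝔤 or to an eigenspace of σ, so its dual bases satisfy a completeness relation
(`psum_aff`, `psum_affReal`, `psum_affEig`). At a point with trivial stabiliser the two copies are
filled independently. At a nonzero point on a reflection line the second copy is determined by the
first. At 0 and ∞ both copies carry an eigenprojection of σ.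

Uniqueness is soft: 𝔉 embeds into the product of its quotients, and joint injectivity of a family,
even an infinite one, survives tensoring with a complex vector space (`tensor_separating`). -/

theorem sum_range_add_of_periodic {M : Type*} [AddCommMonoid M] {T : ℕ} {F : ℕ → M}
    (hF : ∀ k, F (k + T) = F k) (m : ℕ) :
    ∑ k ∈ Finset.range T, F (k + m) = ∑ k ∈ Finset.range T, F k := by
  induction m with
  | zero => rfl
  | succ m ih =>
    rw [← ih]
    have h1 := Finset.sum_range_succ' (fun k => F (k + m)) T
    have h2 := Finset.sum_range_succ (fun k => F (k + m)) T
    have h3 : F (T + m) = F (0 + m) := by rw [add_comm T m, hF, zero_add]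
    cases T with
    | zero => simp
    | succ T =>
      have e : ∀ k, F (k + 1 + m) = F (k + (m + 1)) := fun k => by congr 1; omega
      simp only [e] at h1
      rw [Finset.sum_range_succ, Finset.sum_range_succ' (fun k => F (k + m))]
      simp only [e]
      congr 1
      rw [← h3]
      congr 1
      omega

theorem sum_range_int_add_of_periodic {M : Type*} [AddCommMonoid M] {T : ℕ} {F : ℤ → M}
    (hF : ∀ k, F (k + T) = F k) (m : ℕ) :
    ∑ k ∈ Finset.range T, F (k + m) = ∑ k ∈ Finset.range T, F k := by
  have := sum_range_add_of_periodic (T := T) (F := fun k : ℕ => F k) (fun k => by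
    push_cast; exact hF k) m
  simpa using this

theorem sum_range_neg_of_periodic {M : Type*} [AddCommMonoid M] {T : ℕ} {F : ℤ → M}
    (hF : ∀ k, F (k + T) = F k) :
    ∑ k ∈ Finset.range T, F (-(k : ℤ)) = ∑ k ∈ Finset.range T, F k := by
  -- Reflection replaces -k by j + 1 - T; the shift by 1 on the other side and one period make the
  -- terms equal.
  rw [← Finset.sum_range_reflect, ← sum_range_int_add_of_periodic hF 1]
  refine Finset.sum_congr rfl fun j hj => ?_
  rw [← hF]
  congr 1
  have := Finset.mem_range.1 hj
  omega

variable {R V W : Type*} [AddCommGroup R] [Module ℂ R] [AddCommGroup V] [Module ℂ V]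
  [AddCommGroup W] [Module ℂ W]

/-- A jointly injective family of linear maps remains jointly injective after a base extension. -/
theorem tensor_separating {ι : Type*} {Q : ι → Type*} [∀ i, AddCommGroup (Q i)]
    [∀ i, Module ℂ (Q i)] (f : ∀ i, V →ₗ[ℂ] Q i) (hf : ∀ v, (∀ i, f i v = 0) → v = 0)
    (w : V ⊗[ℂ] R) (h : ∀ i, TensorProduct.map (f i) LinearMap.id w = 0) : w = 0 := by
  classical
  -- In a basis of `R` the tensor is a finitely supported family of vectors of `V`, on which every
  -- `f i` acts coordinatewise. This covers infinite families, for which the product of the targets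
  -- need not commute with the tensor product.
  let b := Module.Basis.ofVectorSpace ℂ R
  have key : ∀ i j (w : V ⊗[ℂ] R), TensorProduct.equivFinsuppOfBasisRight b
      (TensorProduct.map (f i) LinearMap.id w) j
        = f i (TensorProduct.equivFinsuppOfBasisRight b w j) := by
    intro i j w
    induction w using TensorProduct.induction_on with
    | zero => simp
    | add x y hx hy => simp only [map_add, Finsupp.add_apply, hx, hy]
    | tmul v r => simp
  rw [← (TensorProduct.equivFinsuppOfBasisRight b).map_eq_zero_iff]
  ext j
  refine hf _ fun i => ?_
  rw [← key, h i]
  simp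

theorem tensor_separating_eq {ι : Type*} {Q : ι → Type*} [∀ i, AddCommGroup (Q i)]
    [∀ i, Module ℂ (Q i)] (f : ∀ i, V →ₗ[ℂ] Q i) (hf : ∀ v, (∀ i, f i v = 0) → v = 0)
    {w w' : V ⊗[ℂ] R}
    (h : ∀ i, TensorProduct.map (f i) LinearMap.id w = TensorProduct.map (f i) LinearMap.id w') :
    w = w' := by
  rw [← sub_eq_zero]
  exact tensor_separating f hf _ fun i => by rw [map_sub, h i, sub_self]

/-- Contraction of the first tensor factor with a linear form. -/
def contract (φ : V →ₗ[ℂ] ℂ) : V ⊗[ℂ] W →ₗ[ℂ] W :=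
  (TensorProduct.lid ℂ W).toLinearMap ∘ₗ TensorProduct.map φ LinearMap.id

@[simp] theorem contract_tmul (φ : V →ₗ[ℂ] ℂ) (v : V) (w : W) :
    contract φ (v ⊗ₜ w) = φ v • w := by simp [contract]

theorem map_tens_le {V' W' : Type*} [AddCommGroup V'] [Module ℂ V'] [AddCommGroup W'] [Module ℂ W']
    {f : V →ₗ[ℂ] V'} {g : W →ₗ[ℂ] W'} {S : Submodule ℂ V} {S' : Submodule ℂ V'}
    {U : Submodule ℂ W} {U' : Submodule ℂ W'} (hf : S ≤ S'.comap f) (hg : U ≤ U'.comap g) :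
    tens S U ≤ (tens S' U').comap (TensorProduct.map f g) :=
  tens_induction fun a ha b hb => by
    rw [Submodule.mem_comap, TensorProduct.map_tmul]
    exact tmul_mem (hf ha) (hg hb)

/-! ### Linear maps on completions, and partial sums -/

variable {F : ℕ → Submodule ℂ V}

/-- The extension to the completion of a linear map that vanishes on some `Fₘ`. -/
def Compl.lift (F : ℕ → Submodule ℂ V) (f : V →ₗ[ℂ] W) (m : ℕ) (hf : F m ≤ LinearMap.ker f) :
    Compl F →ₗ[ℂ] W := (F m).liftQ f hf ∘ₗ Compl.proj F m

theorem Compl.lift_eq (hF : Antitone F) {f : V →ₗ[ℂ] W} {m : ℕ} (hf : F m ≤ LinearMap.ker f)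
    (x : Compl F) {n : ℕ} (hmn : m ≤ n) {a : V} (ha : (F n).mkQ a = x.1 n) :
    Compl.lift F f m hf x = f a := by
  change (F m).liftQ f hf (x.1 m) = f a
  rw [← x.mkQ_of_le hF hmn ha]
  rfl

theorem Compl.proj_separating (v : Compl F) (h : ∀ n, Compl.proj F n v = 0) : v = 0 :=
  Subtype.ext (funext h)

/-- A map vanishing on `H m` sees the extended bilinear map only modulo `H m`, where one
sufficiently late pair of approximants already decides the value. -/
theorem Compl.lift_ext {Q : Type*} [AddCommGroup Q] [Module ℂ Q] {G : ℕ → Submodule ℂ W}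
    {H : ℕ → Submodule ℂ Q} {B : V →ₗ[ℂ] W →ₗ[ℂ] Q} (h : ContBilin B F G H)
    {W' : Type*} [AddCommGroup W'] [Module ℂ W'] {f : Q →ₗ[ℂ] W'} {m : ℕ}
    (hf : H m ≤ LinearMap.ker f) {s : ℕ → V} {t : ℕ → W} (hs : ∀ n, s (n + 1) - s n ∈ F n)
    (ht : ∀ n, t (n + 1) - t n ∈ G n) {c : W'} {k : ℕ} (hc : ∀ n ≥ k, f (B (s n) (t n)) = c) :
    Compl.lift H f m hf (h.ext (Compl.ofSeq h.antiF s hs) (Compl.ofSeq h.antiG t ht)) = c := by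
  obtain ⟨N, hN⟩ := h.isExtVal_ext (Compl.ofSeq h.antiF s hs) (Compl.ofSeq h.antiG t ht) m
  rw [Compl.lift_eq h.antiH hf _ le_rfl
    (hN (max N k) (le_max_left _ _) (s (max N k)) (t (max N k)) rfl rfl)]
  exact hc _ (le_max_right _ _)

theorem psum_map {d : ℕ} {A B G : Type*} [AddCommMonoid A] [AddCommMonoid B] [FunLike G A B]
    [AddMonoidHomClass G A B] (g : G) (N : ℕ) (f : Idx d → A) :
    g (psum N f) = psum N fun i => g (f i) := by
  simp only [psum, map_add, map_sum]

theorem psum_smul {d : ℕ} {S A : Type*} [AddCommMonoid A] [DistribSMul S A] (c : S) (N : ℕ)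
    (f : Idx d → A) : c • psum N f = psum N fun i => c • f i := by
  simp only [psum, smul_add, Finset.smul_sum]

theorem psum_add {d : ℕ} {A : Type*} [AddCommMonoid A] (N : ℕ) (f g : Idx d → A) :
    (psum N fun i => f i + g i) = psum N f + psum N g := by
  simp only [psum, Finset.sum_add_distrib]
  abel

end General

/-! ### Partial fractions -/

/-- The functions `(u - x)^{-p-1}` for `x ∈ ℂ`, and `-u^{p-1}` for `p > 0` at infinity. -/
def poleFun {A : Type*} [Field A] [Algebra ℂ A] (x : Option ℂ) (p : ℕ) (u : A) : A :=
  match x with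
  | some x => ((u - algebraMap ℂ A x) ^ (p + 1))⁻¹
  | none => if p = 0 then 0 else -u ^ (p - 1)

theorem map_poleFun {A B : Type*} [Field A] [Algebra ℂ A] [Field B] [Algebra ℂ B] (f : A →ₐ[ℂ] B)
    (x : Option ℂ) (p : ℕ) (u : A) : f (poleFun x p u) = poleFun x p (f u) := by
  cases x with
  | some x => simp [poleFun]
  | none => unfold poleFun; split_ifs <;> simp

/-- The partial fraction identity satisfied by `poleFun`. -/
theorem sum_poleFun_mul {A : Type*} [Field A] [Algebra ℂ A] (x : Option ℂ) {u v : A} (huv : u ≠ v)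
    (hu : ∀ c, u ≠ algebraMap ℂ A c) (hv : ∀ c, v ≠ algebraMap ℂ A c) {n : ℕ} (r : Fin n) :
    (∑ p : Fin n, ∑ q : Fin n, if (p : ℕ) + q = r then poleFun x p u * poleFun x q v else 0)
      = (poleFun x r u - poleFun x r v) / (v - u) := by
  have hvu : v - u ≠ 0 := sub_ne_zero.2 huv.symm
  -- The cutoff `n` is harmless: `p + q = r < n` leaves exactly the indices `p ≤ r` with `q = r -
  -- p`.
  have e : (∑ p : Fin n, ∑ q : Fin n, if (p : ℕ) + q = r then poleFun x p u * poleFun x q v else 0)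
      = ∑ p ∈ Finset.range (r + 1), poleFun x p u * poleFun x (r - p) v := by
    have h1 : ∀ p : Fin n, (∑ q : Fin n, if (p : ℕ) + q = r then
        poleFun x p u * poleFun x q v else 0)
        = if (p : ℕ) ∈ Finset.range (r + 1) then poleFun x p u * poleFun x (r - p) v else 0 := by
      intro p
      by_cases hp : (p : ℕ) ≤ r
      · rw [Finset.sum_eq_single (⟨r - p, by omega⟩ : Fin n)]
        · rw [if_pos (by simp; omega), if_pos (by simp; omega)]
        · intro q _ hq
          exact if_neg fun h => hq (Fin.ext (by simp; omega))
        · simp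
      · rw [if_neg (by simp; omega)]
        exact Finset.sum_eq_zero fun q _ => if_neg (by omega)
    rw [Finset.sum_congr rfl fun p _ => h1 p,
      Fin.sum_univ_eq_sum_range (fun p => if p ∈ Finset.range (r + 1) then
        poleFun x p u * poleFun x (r - p) v else 0) n, Finset.sum_ite_mem]
    congr 1
    ext p
    simp only [Finset.mem_inter, Finset.mem_range]
    omega
  rw [e, eq_div_iff hvu]
  cases x with
  | some x =>
    have ha : u - algebraMap ℂ A x ≠ 0 := sub_ne_zero.2 (hu x)
    have hb : v - algebraMap ℂ A x ≠ 0 := sub_ne_zero.2 (hv x)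
    have hab : v - u = (v - algebraMap ℂ A x) - (u - algebraMap ℂ A x) := by ring
    rw [hab]
    simp only [poleFun]
    generalize u - algebraMap ℂ A x = a at *
    generalize v - algebraMap ℂ A x = b at *
    generalize (r : ℕ) = s
    -- With a = u - x and b = v - x the sum is (ab)⁻¹ times a geometric sum in a⁻¹ and b⁻¹, and b -
    -- a = (a⁻¹ - b⁻¹)ab.
    have h := Commute.mul_geom_sum₂ (Commute.all a⁻¹ b⁻¹) (s + 1)
    have e2 : b - a = (a⁻¹ - b⁻¹) * (a * b) := by field_simp
    rw [e2, ← inv_pow, ← inv_pow, ← h, mul_comm _ ((a⁻¹ - b⁻¹) * (a * b)), mul_assoc]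
    congr 1
    rw [Finset.mul_sum]
    refine Finset.sum_congr rfl fun i hi => ?_
    have hi' := Finset.mem_range.1 hi
    rw [Nat.add_sub_cancel, inv_pow, inv_pow, pow_succ a i, pow_succ b]
    field_simp
  | none =>
    simp only [poleFun]
    generalize (r : ℕ) = s
    cases s with
    | zero => simp
    | succ s =>
      -- The two extreme terms contain the factor of index 0, which is zero at infinity; what is
      -- left is the geometric sum for `v ^ s - u ^ s`.
      rw [Finset.sum_range_succ', Finset.sum_range_succ]
      simp only [Nat.sub_self, if_true, mul_zero, zero_mul, add_zero]
      have h := Commute.mul_geom_sum₂ (Commute.all v u) s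
      rw [if_neg (by omega), if_neg (by omega)]
      rw [show -u ^ (s + 1 - 1) - -v ^ (s + 1 - 1) = v ^ s - u ^ s by simp only [Nat.add_sub_cancel]; ring, ← h, mul_comm]
      congr 1
      rw [← Finset.sum_range_reflect]
      refine Finset.sum_congr rfl fun i hi => ?_
      have hi' := Finset.mem_range.1 hi
      rw [if_neg (by omega), if_neg (by omega), neg_mul_neg, mul_comm]
      congr 2 <;> omega

end DihedralGaudin
end

noncomputable section
namespace DihedralGaudin

variable {𝔤 : Type*} [LieRing 𝔤] [LieAlgebra ℂ 𝔤] {D : Datum 𝔤}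

namespace KM

/-! ## The invariant form on the affine algebra -/

/-- The invariant form: `⟨xₘ, yₙ⟩ = δ_{m+n,0} ⟨x, y⟩` and `⟨K, D⟩ = 1`. -/
def form (D : Datum 𝔤) : LinearMap.BilinForm ℂ (KM D) :=
  LinearMap.mk₂ ℂ (fun X Y => (loop X).sum (fun n x => D.form x (loop Y (-n)))
      + cK X * cD Y + cD X * cK Y)
    (fun X X' Y => by
      simp only [map_add]
      rw [Finsupp.sum_add_index' (by simp) (by simp)]
      ring)
    (fun c X Y => by
      simp only [map_smul, smul_eq_mul]
      rw [Finsupp.sum_smul_index' (by simp)]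
      simp only [map_smul, LinearMap.smul_apply, smul_eq_mul]
      simp only [Finsupp.sum, Finset.mul_sum, mul_add, mul_assoc])
    (fun X Y Y' => by
      simp only [map_add, Finsupp.add_apply, Finsupp.sum_add]
      ring)
    (fun c X Y => by
      simp only [map_smul, Finsupp.smul_apply, smul_eq_mul]
      simp only [← smul_eq_mul, ← Finsupp.smul_sum]
      simp only [smul_eq_mul]
      ring)

theorem form_apply (X Y : KM D) : form D X Y = (loop X).sum (fun n x => D.form x (loop Y (-n)))
      + cK X * cD Y + cD X * cK Y := rfl

theorem form_elem_left (n : ℤ) (x : 𝔤) (α a : ℂ) (Y : KM D) :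
    form D (elem n x α a) Y = D.form x (loop Y (-n)) + α * cD Y + a * cK Y := by
  rw [form_apply, loop_elem, Finsupp.sum_single_index (by simp)]
  simp

theorem form_elem (m n : ℤ) (x y : 𝔤) (α a β b : ℂ) :
    form D (elem m x α a) (elem n y β b)
      = (if m + n = 0 then D.form x y else 0) + α * b + a * β := by
  rw [form_elem_left]
  simp only [loop_elem, cK_elem, cD_elem, Finsupp.single_apply]
  by_cases h : m + n = 0
  · rw [if_pos (by omega), if_pos h]
  · rw [if_neg (by omega), if_neg h, map_zero]

theorem form_comm (X Y : KM D) : form D X Y = form D Y X := by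
  induction X using KM.induction with
  | hadd X X' h h' => simp only [map_add, LinearMap.add_apply, h, h']
  | h0 m x α a =>
    induction Y using KM.induction with
    | hadd Y Y' h h' => simp only [map_add, LinearMap.add_apply, h, h']
    | h0 n y β b => rw [form_elem, form_elem, D.form_symm, add_comm m n]; ring

theorem form_elem_right (n : ℤ) (y : 𝔤) (β b : ℂ) (X : KM D) :
    form D X (elem n y β b) = D.form (loop X (-n)) y + cK X * b + cD X * β := by
  rw [form_comm, form_elem_left, D.form_symm]; ring

/-- The loop part is the invariance of the form on 𝔤. The cocycle term of one bracket, paired with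
the `D`-coefficient of the remaining argument, matches the derivation term of the other bracket. -/
theorem form_lie (X Y Z : KM D) : form D ⁅X, Y⁆ Z = form D X ⁅Y, Z⁆ := by
  induction X using KM.induction with
  | hadd X X' h h' => simp only [add_lie, map_add, LinearMap.add_apply, h, h']
  | h0 m x α a =>
    induction Y using KM.induction with
    | hadd Y Y' h h' => simp only [lie_add, add_lie, map_add, LinearMap.add_apply, h, h']
    | h0 n y β b =>
      induction Z using KM.induction with
      | hadd Z Z' h h' => simp only [lie_add, map_add, h, h']
      | h0 p z γ c =>
        simp only [lie_elem', map_add, LinearMap.add_apply, form_elem, D.form_lie]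
        simp only [map_neg, map_smul, LinearMap.neg_apply, LinearMap.smul_apply, smul_eq_mul]
        by_cases h1 : m + n + p = 0
        · rw [if_pos h1, if_pos (show m + (n + p) = 0 by omega)]
          split_ifs <;> first | omega | skip
          all_goals try (have hh : n = -m := (by omega); subst hh)
          all_goals try (have hh : p = -m := (by omega); subst hh)
          all_goals try (have hh : p = -n := (by omega); subst hh)
          all_goals push_cast
          all_goals try ring
        · rw [if_neg h1, if_neg (show ¬ m + (n + p) = 0 by omega)]
          split_ifs <;> first | omega | skip
          all_goals try (have hh : n = -m := (by omega); subst hh)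
          all_goals try (have hh : p = -m := (by omega); subst hh)
          all_goals try (have hh : p = -n := (by omega); subst hh)
          all_goals push_cast
          all_goals try ring

theorem form_nondegenerate (X : KM D) (h : ∀ Y, form D Y X = 0) : X = 0 := by
  refine ext' (fun n => ?_) ?_ ?_
  · refine D.form_nondegenerate _ fun y => ?_
    have := h (elem (-n) y 0 0)
    rw [form_elem_left, neg_neg] at this
    simpa [D.form_symm y] using this
  · simpa [form_elem_left] using h (elem 0 0 0 1)
  · simpa [form_elem_left] using h (elem 0 0 1 0)

theorem form_sigma (X Y : KM D) : form D (sigma X) (sigma Y) = form D X Y := by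
  induction X using KM.induction with
  | hadd X X' h h' => simp only [map_add, LinearMap.add_apply, h, h']
  | h0 m x α a =>
    induction Y using KM.induction with
    | hadd Y Y' h h' => simp only [map_add, h, h']
    | h0 n y β b => rw [sigma_elem, sigma_elem, form_elem, form_elem, D.form_σ]

theorem form_tau (X Y : KM D) : form D (tau X) (tau Y) = conj (form D X Y) := by
  induction X using KM.induction with
  | hadd X X' h h' => simp only [map_add, LinearMap.add_apply, h, h']
  | h0 m x α a =>
    induction Y using KM.induction with
    | hadd Y Y' h h' => simp only [map_add, h, h']
    | h0 n y β b =>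
      rw [tau_elem, tau_elem, form_elem, form_elem, D.form_τ]
      have e : (-m + -n = 0) ↔ (m + n = 0) := by omega
      simp only [e, map_add, map_mul]
      split_ifs <;> simp

/-! ## Truncation to finitely many modes -/

/-- The projection to the modes `|n| < N` and to `K`, `D`. -/
def trunc (D : Datum 𝔤) (N : ℕ) : KM D →ₗ[ℂ] KM D where
  toFun X := mk ((loop X).filter fun n => n ∈ Finset.Ioo (-(N : ℤ)) N) (cK X) (cD X)
  map_add' X Y := ext' (fun n => by simp [Finsupp.filter_add]) (by simp) (by simp)
  map_smul' c X := ext' (fun n => by simp [Finsupp.filter_smul]) (by simp) (by simp)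

@[simp] theorem loop_trunc (N : ℕ) (X : KM D) (n : ℤ) :
    loop (trunc D N X) n = if n ∈ Finset.Ioo (-(N : ℤ)) N then loop X n else 0 := by
  change ((loop X).filter fun n => n ∈ Finset.Ioo (-(N : ℤ)) N) n = _
  rw [Finsupp.filter_apply]
@[simp] theorem cK_trunc (N : ℕ) (X : KM D) : cK (trunc D N X) = cK X := rfl
@[simp] theorem cD_trunc (N : ℕ) (X : KM D) : cD (trunc D N X) = cD X := rfl

/-- The form pairs mode n with mode -n and the window of modes is symmetric. Truncation of a tensor
can thus be moved to the vectors with which it is contracted. -/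
theorem form_trunc (N : ℕ) (X Y : KM D) : form D (trunc D N X) Y = form D X (trunc D N Y) := by
  have e : ∀ n x α a, trunc D N (elem n x α a)
      = elem n (if n ∈ Finset.Ioo (-(N : ℤ)) N then x else 0) α a := fun n x α a =>
    ext' (fun r => by
      by_cases h : n = r
      · subst h; simp
      · simp [h]) rfl rfl
  induction X using KM.induction with
  | hadd X X' h h' => simp only [map_add, LinearMap.add_apply, h, h']
  | h0 m x α a =>
    rw [e, form_elem_left, form_elem_left, loop_trunc, cK_trunc, cD_trunc]
    have e2 : -m ∈ Finset.Ioo (-(N : ℤ)) N ↔ m ∈ Finset.Ioo (-(N : ℤ)) N := by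
      simp only [Finset.mem_Ioo]; omega
    simp only [e2]
    split_ifs <;> simp

theorem exists_trunc_eq (X : KM D) : ∃ N, ∀ M, N ≤ M → trunc D M X = X := by
  refine ⟨(loop X).support.sup Int.natAbs + 1, fun M hM => ext' (fun n => ?_) rfl rfl⟩
  rw [loop_trunc]
  split_ifs with h
  · rfl
  · by_contra h0
    have := Finset.le_sup (f := Int.natAbs) (Finsupp.mem_support_iff.2 (Ne.symm h0))
    rw [Finset.mem_Ioo] at h
    omega

/-- A bound for the modes of an element. -/
def deg (X : KM D) : ℕ := (exists_trunc_eq X).choose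

theorem trunc_of_deg_le {X : KM D} {N : ℕ} (h : deg X ≤ N) : trunc D N X = X :=
  (exists_trunc_eq X).choose_spec N h

theorem trunc_filt (N n : ℕ) : filt D n ≤ (filt D n).comap (trunc D N) := fun X hX =>
  ⟨fun m hm => by rw [loop_trunc, hX.1 m hm, ite_self], hX.2⟩

theorem trunc_filtBar (N n : ℕ) : filtBar D n ≤ (filtBar D n).comap (trunc D N) := fun X hX =>
  ⟨fun m hm => by rw [loop_trunc, hX.1 m hm, ite_self], hX.2⟩

/-- Elements of the filtration have no `K` or `D` part, which truncation would keep. -/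
theorem trunc_eq_zero_of_mem_filt {N : ℕ} {X : KM D} (hX : X ∈ filt D N) : trunc D N X = 0 := by
  refine ext' (fun m => ?_) hX.2.1 hX.2.2
  rw [loop_trunc]
  split_ifs with h
  · exact hX.1 m (Finset.mem_Ioo.1 h).2
  · rfl

theorem trunc_eq_zero_of_mem_filtBar {N : ℕ} {X : KM D} (hX : X ∈ filtBar D N) :
    trunc D N X = 0 := by
  refine ext' (fun m => ?_) hX.2.1 hX.2.2
  rw [loop_trunc]
  split_ifs with h
  · exact hX.1 m (Finset.mem_Ioo.1 h).1
  · rfl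


/-! ## Integer powers of `σ` -/

/-- `σ` as an invertible endomorphism. -/
def sigmaUnit (D : Datum 𝔤) : (Module.End ℂ (KM D))ˣ :=
  Units.ofPowEqOne sigma D.T (sigma_pow_T D) D.T_pos.ne'

/-- `σ^j` for an integer `j`. -/
def sig (D : Datum 𝔤) (j : ℤ) : KM D →ₗ[ℂ] KM D := ((sigmaUnit D ^ j : (Module.End ℂ (KM D))ˣ) :
  Module.End ℂ (KM D))

theorem sig_natCast (k : ℕ) : sig D k = (sigma : Module.End ℂ (KM D)) ^ k := by
  unfold sig
  rw [zpow_natCast, Units.val_pow_eq_pow_val]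
  rfl

@[simp] theorem sig_zero : sig D 0 = LinearMap.id := by
  unfold sig; rw [zpow_zero]; rfl

theorem sig_one : sig D 1 = sigma := by
  unfold sig; rw [zpow_one]; rfl

theorem sig_add (j l : ℤ) (X : KM D) : sig D (j + l) X = sig D j (sig D l X) := by
  unfold sig
  rw [zpow_add, Units.val_mul]
  rfl

theorem sig_add_T (j : ℤ) : sig D (j + D.T) = sig D j := by
  unfold sig
  rw [zpow_add, zpow_natCast, sigmaUnit, Units.pow_ofPowEqOne, mul_one]

theorem sig_neg_sig (j : ℤ) (X : KM D) : sig D (-j) (sig D j X) = X := by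
  rw [← sig_add, neg_add_cancel, sig_zero]; rfl

theorem sig_sig_neg (j : ℤ) (X : KM D) : sig D j (sig D (-j) X) = X := by
  rw [← sig_add, add_neg_cancel, sig_zero]; rfl

/-- Every integer power of σ is a natural power, since σ has finite order. -/
theorem sig_induction {p : (KM D →ₗ[ℂ] KM D) → Prop} (h0 : p LinearMap.id)
    (h1 : ∀ f, p f → p (sigma ∘ₗ f)) (j : ℤ) : p (sig D j) := by
  have h : ∀ k : ℕ, p (sig D k) := by
    intro k
    induction k with
    | zero => simpa using h0
    | succ k ih => rw [sig_natCast, pow_succ', ← sig_natCast]; exact h1 _ ih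
  have e : ∀ (m : ℕ) (j : ℤ), sig D (j + m * D.T) = sig D j := by
    intro m
    induction m with
    | zero => simp
    | succ m ih => intro j; rw [Nat.cast_succ, add_mul, one_mul, ← add_assoc, sig_add_T, ih]
  have hT := D.T_pos
  -- Adding |j| periods reaches a nonnegative exponent because `T ≥ 1`.
  have h2 : (0 : ℤ) ≤ j + j.natAbs * D.T := by nlinarith [neg_abs_le j, Int.natCast_natAbs j]
  rw [← e j.natAbs j, ← Int.toNat_of_nonneg h2]
  exact h _

theorem form_sig (j : ℤ) (X Y : KM D) : form D (sig D j X) (sig D j Y) = form D X Y := by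
  refine sig_induction (p := fun f => form D (f X) (f Y) = form D X Y) rfl (fun f hf => ?_) j
  rw [LinearMap.comp_apply, LinearMap.comp_apply, form_sigma, hf]

theorem form_sig_right (j : ℤ) (X Y : KM D) : form D X (sig D j Y) = form D (sig D (-j) X) Y := by
  rw [← form_sig j (sig D (-j) X) Y, sig_sig_neg]

theorem sig_lie (j : ℤ) (X Y : KM D) : sig D j ⁅X, Y⁆ = ⁅sig D j X, sig D j Y⁆ := by
  refine sig_induction (p := fun f => f ⁅X, Y⁆ = ⁅f X, f Y⁆) rfl (fun f hf => ?_) j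
  rw [LinearMap.comp_apply, hf, sigma_lie]; rfl

theorem sigma_filt (n : ℕ) : filt D n ≤ (filt D n).comap sigma := fun X hX =>
  ⟨fun m hm => by rw [loop_sigma, hX.1 m hm, map_zero], hX.2⟩

theorem sigma_filtBar (n : ℕ) : filtBar D n ≤ (filtBar D n).comap sigma := fun X hX =>
  ⟨fun m hm => by rw [loop_sigma, hX.1 m hm, map_zero], hX.2⟩

theorem sig_filt (j : ℤ) (n : ℕ) : filt D n ≤ (filt D n).comap (sig D j) := by
  refine sig_induction (p := fun f => filt D n ≤ (filt D n).comap f) le_rfl (fun f hf => ?_) j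
  exact fun X hX => sigma_filt n (hf hX)

theorem sig_filtBar (j : ℤ) (n : ℕ) : filtBar D n ≤ (filtBar D n).comap (sig D j) := by
  refine sig_induction (p := fun f => filtBar D n ≤ (filtBar D n).comap f) le_rfl
    (fun f hf => ?_) j
  exact fun X hX => sigma_filtBar n (hf hX)

theorem tau_filtBar (n : ℕ) : filtBar D n ≤ (filt D n).comap tau := (filtBar_eq D n).le

theorem tau_filt (n : ℕ) : filt D n ≤ (filtBar D n).comap tau := fun X hX => by
  rw [Submodule.mem_comap, filtBar_eq, Submodule.mem_comap, tau_tau]; exact hX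

theorem trunc_sigma (N : ℕ) (X : KM D) : trunc D N (sigma X) = sigma (trunc D N X) :=
  ext' (fun n => by simp only [loop_trunc, loop_sigma]; split_ifs <;> simp) rfl rfl

theorem trunc_sig (N : ℕ) (j : ℤ) (X : KM D) : trunc D N (sig D j X) = sig D j (trunc D N X) := by
  refine sig_induction (p := fun f => trunc D N (f X) = f (trunc D N X)) rfl (fun f hf => ?_) j
  rw [LinearMap.comp_apply, trunc_sigma, hf]; rfl

theorem trunc_tau (N : ℕ) (X : KM D) : trunc D N (tau X) = tau (trunc D N X) := by
  have e2 : ∀ m : ℤ, -m ∈ Finset.Ioo (-(N : ℤ)) N ↔ m ∈ Finset.Ioo (-(N : ℤ)) N := fun m => by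
    simp only [Finset.mem_Ioo]; omega
  refine ext' (fun n => ?_) rfl rfl
  simp only [loop_trunc, loop_tau, e2]
  split_ifs <;> simp

end KM
end DihedralGaudin
end

noncomputable section
namespace DihedralGaudin

variable {𝔤 : Type*} [LieRing 𝔤] [LieAlgebra ℂ 𝔤] {D : Datum 𝔤}

/-! ## Eigenspaces and real forms of `𝔤` -/

namespace Datum

variable (D)

theorem ω_zpow_add_T (m j : ℤ) : D.ω ^ (m * (j + D.T)) = D.ω ^ (m * j) := by
  rw [mul_add, zpow_add₀ D.ω_ne_zero, (D.primitive.zpow_eq_one_iff_dvd _).2 (dvd_mul_left _ _),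
    mul_one]

/-- Needed because `τ_eigenspace` speaks of natural exponents only. -/
theorem exists_nat_zpow (j : ℤ) : ∃ n : ℕ, D.ω ^ j = D.ω ^ n := by
  have hT : (D.T : ℤ) ≠ 0 := by exact_mod_cast D.T_pos.ne'
  refine ⟨(j % D.T).toNat, ?_⟩
  rw [← zpow_natCast, Int.toNat_of_nonneg (Int.emod_nonneg _ hT)]
  conv_lhs => rw [← Int.emod_add_mul_ediv j D.T]
  rw [zpow_add₀ D.ω_ne_zero, (D.primitive.zpow_eq_one_iff_dvd _).2 (dvd_mul_right _ _), mul_one]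

theorem conj_ω_zpow (j : ℤ) : conj (D.ω ^ j) = D.ω ^ (-j) := by
  rw [map_zpow₀, ← Complex.inv_eq_conj D.norm_ω, inv_zpow, zpow_neg]

theorem T_cast_ne_zero : (D.T : ℂ) ≠ 0 := by exact_mod_cast D.T_pos.ne'

theorem σ_iterate_add_T (k : ℕ) (x : 𝔤) : D.σ^[k + D.T] x = D.σ^[k] x := by
  rw [Function.iterate_add_apply, D.σ_iterate]

theorem σ_iterate_smul (k : ℕ) (c : ℂ) (x : 𝔤) : D.σ^[k] (c • x) = c • D.σ^[k] x := by
  induction k with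
  | zero => rfl
  | succ k ih => rw [Function.iterate_succ_apply', Function.iterate_succ_apply', ih, map_smul]

theorem σ_iterate_of_eigen {x : 𝔤} {c : ℂ} (h : D.σ x = c • x) (k : ℕ) :
    D.σ^[k] x = c ^ k • x := by
  induction k with
  | zero => simp
  | succ k ih => rw [Function.iterate_succ_apply', ih, map_smul, h, smul_smul, pow_succ]

/-- The projection of `x` to the eigenspace of `σ` for the eigenvalue `ω^j`. -/
def eig (j : ℤ) (x : 𝔤) : 𝔤 :=
  (D.T : ℂ)⁻¹ • ∑ k ∈ Finset.range D.T, D.ω ^ (-j * k) • D.σ^[k] x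

theorem σ_eig (j : ℤ) (x : 𝔤) : D.σ (D.eig j x) = D.ω ^ j • D.eig j x := by
  have h := sum_range_add_of_periodic (T := D.T) (F := fun k : ℕ => D.ω ^ (-j * k) • D.σ^[k] x)
    (fun k => by
      rw [σ_iterate_add_T, Nat.cast_add, ω_zpow_add_T]) 1
  unfold eig
  rw [map_smul, map_sum, smul_comm]
  congr 1
  rw [← h, Finset.smul_sum]
  refine Finset.sum_congr rfl fun k _ => ?_
  rw [map_smul, ← Function.iterate_succ_apply' D.σ, smul_smul, ← zpow_add₀ D.ω_ne_zero]
  congr 2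
  push_cast; ring

/-- Orthogonality of characters: after exchanging the sums, ∑_j ω^(-jk) vanishes for 0 < k < T. -/
theorem sum_eig (x : 𝔤) : ∑ j ∈ Finset.range D.T, D.eig j x = x := by
  unfold eig
  rw [← Finset.smul_sum, Finset.sum_comm]
  simp only [← Finset.sum_smul]
  rw [Finset.sum_eq_single_of_mem 0 (Finset.mem_range.2 D.T_pos)]
  · simp [D.T_cast_ne_zero]
  · intro k hk hk0
    have h1 : (D.ω ^ (-(k : ℤ)) - 1) * ∑ j ∈ Finset.range D.T, (D.ω ^ (-(k : ℤ))) ^ j = 0 := by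
      rw [mul_geom_sum, ← zpow_natCast, ← zpow_mul,
        (D.primitive.zpow_eq_one_iff_dvd _).2 (dvd_mul_left _ _), sub_self]
    have h2 : D.ω ^ (-(k : ℤ)) ≠ 1 := fun h => by
      have := (D.primitive.zpow_eq_one_iff_dvd _).1 h
      rw [dvd_neg, Int.natCast_dvd_natCast] at this
      exact absurd (Nat.le_of_dvd (Nat.pos_of_ne_zero hk0) this)
        (not_le.2 (Finset.mem_range.1 hk))
    have h3 := (mul_eq_zero.1 h1).resolve_left (sub_ne_zero.2 h2)
    have e : ∀ j : ℕ, D.ω ^ (-(j : ℤ) * k) = (D.ω ^ (-(k : ℤ))) ^ j := fun j => by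
      rw [← zpow_natCast, ← zpow_mul]; congr 1; ring
    simp only [e, h3, zero_smul]

/-- This dihedral relation is not part of the data but follows from it. On the ω^j-eigenspace the
inner σ contributes ω^(-j) after passing the antilinear τ, and the outer one contributes ω^j because
τ preserves the eigenspace. -/
theorem σ_τ_σ (x : 𝔤) : D.σ (D.τ (D.σ x)) = D.τ x := by
  have h : ∀ j : ℕ, D.σ (D.τ (D.σ (D.eig j x))) = D.τ (D.eig j x) := fun j => by
    have h1 : D.σ (D.eig j x) = D.ω ^ j • D.eig j x := by rw [σ_eig, zpow_natCast]
    rw [h1, map_smulₛₗ, map_smul, D.τ_eigenspace j _ h1, ← zpow_natCast, conj_ω_zpow, smul_smul,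
      ← zpow_add₀ D.ω_ne_zero, neg_add_cancel, zpow_zero, one_smul]
  rw [← D.sum_eig x]
  simp only [map_sum, h]

theorem σ_τ_σ_iterate (k : ℕ) (x : 𝔤) : D.σ^[k] (D.τ (D.σ^[k] x)) = D.τ x := by
  induction k with
  | zero => rfl
  | succ k ih =>
    rw [Function.iterate_succ_apply' D.σ k x, Function.iterate_succ_apply D.σ, σ_τ_σ, ih]

/-- Since σ preserves the form, a vector of eigenvalue ω^(-j) pairs only with the ω^j-component. -/
theorem form_eig (j : ℤ) (x : 𝔤) {d : 𝔤} (hd : D.σ d = D.ω ^ (-j) • d) :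
    D.form (D.eig j x) d = D.form x d := by
  have h : ∀ k : ℕ, D.form (D.σ^[k] x) (D.σ^[k] d) = D.form x d := by
    intro k
    induction k with
    | zero => rfl
    | succ k ih => rw [Function.iterate_succ_apply', Function.iterate_succ_apply', D.form_σ, ih]
  have h2 : ∀ k : ℕ, D.ω ^ (-j * k) * D.form (D.σ^[k] x) d = D.form x d := fun k => by
    rw [← h k, D.σ_iterate_of_eigen hd k, map_smul, smul_eq_mul, ← zpow_natCast, ← zpow_mul]
  unfold eig
  rw [map_smul, map_sum, LinearMap.smul_apply, LinearMap.sum_apply]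
  simp only [map_smul, LinearMap.smul_apply, smul_eq_mul, h2]
  simp [D.T_cast_ne_zero]

end Datum

theorem DualBases.sum_form_dual_smul {U U' : Submodule ℝ 𝔤} (B : DualBases D U U') {x : 𝔤}
    (hx : x ∈ U) : ∑ a, D.form x (B.dual a) • (B.basis a : 𝔤) = x := by
  have h := B.basis.sum_repr ⟨x, hx⟩
  have h' : ∑ b, (B.basis.repr ⟨x, hx⟩ b : ℂ) • (B.basis b : 𝔤) = x := by
    have := congrArg (fun u : U => (u : 𝔤)) h
    simp only [Submodule.coe_sum, Submodule.coe_smul] at this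
    exact this
  have h2 : ∀ a, D.form x (B.dual a) = (B.basis.repr ⟨x, hx⟩ a : ℂ) := fun a => by
    conv_lhs => rw [← h']
    simp [map_sum, B.form_basis_dual]
  simp only [h2, h']

/-- The expansion is complex linear in `x`, so it extends from `U` to U + iU. -/
theorem DualBases.sum_form_dual_smul_complex {U U' : Submodule ℝ 𝔤} (B : DualBases D U U')
    {x y z : 𝔤} (hy : y ∈ U) (hz : z ∈ U) (h : x = y + Complex.I • z) :
    ∑ a, D.form x (B.dual a) • (B.basis a : 𝔤) = x := by
  rw [h]
  simp only [map_add, LinearMap.add_apply, map_smul, LinearMap.smul_apply, smul_eq_mul, add_smul,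
    mul_smul, Finset.sum_add_distrib, ← Finset.smul_sum]
  rw [B.sum_form_dual_smul hy, B.sum_form_dual_smul hz]

/-- Applied with `y` the image of `x` under an antilinear involution: the two vectors combined on
the right are then fixed by it, so `x` lies in the complex span of the fixed space. -/
theorem add_I_smul_eq (x y : 𝔤) : x = (1 / 2 : ℂ) • (x + y)
    + Complex.I • ((-Complex.I / 2) • (x - y)) := by
  have : Complex.I * (-Complex.I / 2) = 1 / 2 := by
    rw [neg_div, mul_neg, ← mul_div_assoc, Complex.I_mul_I]; norm_num
  rw [smul_smul, this]
  module

/-- The real form is the fixed space of θ = ω^(-kp) σ^k τ, which is an antilinear involution by the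
dihedral relation. Hence it spans 𝔤 over ℂ, and the real expansion becomes a complex one. -/
theorem sum_form_real (E : Bases D) (k : ℕ) (p : ℤ) (x : 𝔤) :
    ∑ a, D.form x ((E.real k p).dual a) • ((E.real k p).basis a : 𝔤) = x := by
  set θ : 𝔤 → 𝔤 := fun x => D.ω ^ (-(k * p)) • D.σ^[k] (D.τ x) with hθ
  have h0 : ∀ x, D.σ^[k] (D.τ x) = D.ω ^ (k * p) • θ x := fun x => by
    rw [hθ]; dsimp only
    rw [smul_smul, ← zpow_add₀ D.ω_ne_zero, add_neg_cancel, zpow_zero, one_smul]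
  have h1 : ∀ x, θ (θ x) = x := fun x => by
    rw [hθ]; dsimp only
    rw [map_smulₛₗ, D.conj_ω_zpow, D.σ_iterate_smul, smul_smul, ← zpow_add₀ D.ω_ne_zero, neg_neg,
      neg_add_cancel, zpow_zero, one_smul, D.σ_τ_σ_iterate, D.τ_τ]
  have h2 : ∀ (c : ℂ) x, θ (c • x) = conj c • θ x := fun c x => by
    rw [hθ]; dsimp only
    rw [map_smulₛₗ, D.σ_iterate_smul, smul_comm]
  have h3 : ∀ x y, θ (x + y) = θ x + θ y := fun x y => by
    rw [hθ]; dsimp only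
    rw [map_add, iterate_map_add, smul_add]
  have h4 : ∀ x, θ x = x → x ∈ gReal D k p := fun x hx => by
    change D.σ^[k] (D.τ x) = D.ω ^ (k * p) • x
    rw [h0, hx]
  refine (E.real k p).sum_form_dual_smul_complex (y := (1 / 2 : ℂ) • (x + θ x))
    (z := (-Complex.I / 2) • (x - θ x)) (h4 _ ?_) (h4 _ ?_) (add_I_smul_eq x (θ x))
  · rw [h2, h3, h1, add_comm, map_div₀, map_one, Complex.conj_ofNat]
  · rw [h2, sub_eq_add_neg, h3, ← neg_one_smul ℂ (θ x), h2, h1]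
    simp only [map_div₀, map_neg, Complex.conj_I, map_one, Complex.conj_ofNat]
    module

/-- The dual vectors see only the ω^j-component of `x`, and this component lies in the
complexification of the τ-fixed part of the eigenspace. That is why a projection appears instead of
the identity. -/
theorem sum_form_eig (E : Bases D) (j : ℤ) (x : 𝔤) :
    ∑ a, D.form x ((E.eig j).dual a) • ((E.eig j).basis a : 𝔤) = D.eig j x := by
  have h1 : ∀ a, D.form x ((E.eig j).dual a) = D.form (D.eig j x) ((E.eig j).dual a) := fun a =>
    (D.form_eig j x ((E.eig j).dual_mem a).1).symm
  simp only [h1]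
  set y := D.eig j x with hy
  have hy1 : D.σ y = D.ω ^ j • y := D.σ_eig j x
  have hy2 : D.σ (D.τ y) = D.ω ^ j • D.τ y := by
    obtain ⟨n, hn⟩ := D.exists_nat_zpow j
    rw [hn] at hy1 ⊢
    exact D.τ_eigenspace n y hy1
  refine (E.eig j).sum_form_dual_smul_complex (y := (1 / 2 : ℂ) • (y + D.τ y))
    (z := (-Complex.I / 2) • (y - D.τ y)) ⟨?_, ?_⟩ ⟨?_, ?_⟩ (add_I_smul_eq y (D.τ y))
  · rw [map_smul, map_add, hy1, hy2]; module
  · rw [map_smulₛₗ, map_add, D.τ_τ, add_comm, map_div₀, map_one, Complex.conj_ofNat]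
  · rw [map_smul, map_sub, hy1, hy2]; module
  · rw [map_smulₛₗ, map_sub, D.τ_τ]
    simp only [map_div₀, map_neg, Complex.conj_I, Complex.conj_ofNat]
    module

/-! ## Eigenspaces and real forms of `𝔤̃` -/

namespace KM

theorem sigma_tau_sigma (X : KM D) : sigma (tau (sigma X)) = tau X :=
  ext' (fun n => by simp [D.σ_τ_σ]) (by simp) (by simp)

theorem tau_sig (j : ℤ) (X : KM D) : tau (sig D j X) = sig D (-j) (tau X) := by
  have h : ∀ Y, sig D j (tau (sig D j Y)) = tau Y := by
    -- Commutation with `sigma` is carried along because the induction composes on the left, and the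
    -- outer `sigma` has to pass `f` in order to meet `tau`.
    refine (sig_induction (p := fun f => (∀ Z, f (sigma Z) = sigma (f Z)) ∧
      ∀ Y, f (tau (f Y)) = tau Y) ⟨fun _ => rfl, fun _ => rfl⟩ (fun f hf => ⟨fun Z => ?_,
      fun Y => ?_⟩) j).2
    · rw [LinearMap.comp_apply, hf.1]; rfl
    · rw [LinearMap.comp_apply, LinearMap.comp_apply, ← hf.1, sigma_tau_sigma, hf.2]
  rw [← h X, sig_neg_sig]

/-- The projection to the eigenspace of `σ` for the eigenvalue `ω^j`. -/
def eigProj (D : Datum 𝔤) (j : ℤ) : KM D →ₗ[ℂ] KM D :=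
  (D.T : ℂ)⁻¹ • ∑ k ∈ Finset.range D.T, D.ω ^ (-j * k) • sig D k

theorem eigProj_apply (j : ℤ) (X : KM D) : eigProj D j X =
    (D.T : ℂ)⁻¹ • ∑ k ∈ Finset.range D.T, D.ω ^ (-j * k) • sig D k X := by
  simp [eigProj]

theorem loop_sig_natCast (k : ℕ) (X : KM D) (n : ℤ) :
    loop (sig D k X) n = D.σ^[k] (loop X n) := by
  rw [sig_natCast]
  induction k with
  | zero => rfl
  | succ k ih => rw [pow_succ', Module.End.mul_apply, loop_sigma, ih, Function.iterate_succ_apply']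

theorem cK_sig (j : ℤ) (X : KM D) : cK (sig D j X) = cK X :=
  sig_induction (p := fun f => cK (f X) = cK X) rfl (fun f hf => by simpa using hf) j

theorem cD_sig (j : ℤ) (X : KM D) : cD (sig D j X) = cD X :=
  sig_induction (p := fun f => cD (f X) = cD X) rfl (fun f hf => by simpa using hf) j

theorem loop_eigProj (j : ℤ) (X : KM D) (n : ℤ) : loop (eigProj D j X) n = D.eig j (loop X n) := by
  rw [eigProj_apply, map_smul, map_sum, Finsupp.smul_apply, Finsupp.finsetSum_apply]
  simp only [map_smul, Finsupp.smul_apply, loop_sig_natCast]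
  rfl

theorem sigma_sig (j : ℤ) (X : KM D) : sigma (sig D j X) = sig D (j + 1) X := by
  rw [add_comm, sig_add, sig_one]

theorem sigma_eigProj (j : ℤ) (X : KM D) :
    sigma (eigProj D j X) = D.ω ^ j • eigProj D j X := by
  have h := sum_range_int_add_of_periodic (T := D.T)
    (F := fun k : ℤ => D.ω ^ (-j * k) • sig D k X)
    (fun k => by rw [sig_add_T, D.ω_zpow_add_T]) 1
  rw [eigProj_apply, map_smul, map_sum, smul_comm]
  congr 1
  rw [← h, Finset.smul_sum]
  refine Finset.sum_congr rfl fun k _ => ?_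
  rw [map_smul, sigma_sig, smul_smul, ← zpow_add₀ D.ω_ne_zero]
  congr 2
  push_cast; ring

theorem eigProj_of_eigen {j : ℤ} {X : KM D} (h : sigma X = D.ω ^ j • X) : eigProj D j X = X := by
  rw [eigProj_apply]
  have e : ∀ k : ℕ, D.ω ^ (-j * k) • sig D k X = X := fun k => by
    rw [sig_natCast, sigma_pow_apply h, smul_smul, ← zpow_natCast, ← zpow_mul,
      ← zpow_add₀ D.ω_ne_zero, ← add_mul, neg_add_cancel, zero_mul, zpow_zero, one_smul]
  simp only [e, Finset.sum_const, Finset.card_range, ← Nat.cast_smul_eq_nsmul ℂ, smul_smul]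
  rw [inv_mul_cancel₀ D.T_cast_ne_zero, one_smul]

/-- The projection of a fixed vector is both fixed and an eigenvector for ω^j, and ω^j = 1 only if
`T` divides `j`. This decides when `K` and `D` contribute at 0 and ∞. -/
theorem eigProj_of_fixed {j : ℤ} {X : KM D} (h : sigma X = X) :
    eigProj D j X = if (D.T : ℤ) ∣ j then X else 0 := by
  split_ifs with hj
  · exact eigProj_of_eigen (by rw [(D.primitive.zpow_eq_one_iff_dvd j).2 hj, one_smul, h])
  · have h0 : ∀ k : ℤ, sig D k X = X := sig_induction (p := fun f => f X = X) rfl fun f hf => by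
      rw [LinearMap.comp_apply, hf, h]
    have h1 := sigma_eigProj j X
    have h2 : sigma (eigProj D j X) = eigProj D j X := by
      rw [eigProj_apply]
      simp only [h0, map_smul, map_sum, h]
    rw [h2, ← sub_eq_zero] at h1
    have h3 : (1 - D.ω ^ j) • eigProj D j X = 0 := by rw [sub_smul, one_smul, h1]
    exact (smul_eq_zero.1 h3).resolve_left
      (sub_ne_zero.2 fun h => hj ((D.primitive.zpow_eq_one_iff_dvd j).1 h.symm))

end KM
end DihedralGaudin
end

noncomputable section
namespace DihedralGaudin

variable {𝔤 : Type*} [LieRing 𝔤] [LieAlgebra ℂ 𝔤] {D : Datum 𝔤}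

/-! ## Expansions with respect to dual bases -/

namespace KM

theorem mode_eq_elem (n : ℤ) (x : 𝔤) : (mode n x : KM D) = elem n x 0 0 := rfl

/-- Pairing with mode -n of a dual vector reads off the coefficient of t^n, so the
finite-dimensional completeness relation acts on each mode separately. -/
theorem sum_form_mode_smul {d : ℕ} {u v : Fin d → 𝔤} {Q : 𝔤 → 𝔤}
    (h : ∀ x, ∑ a, D.form x (v a) • u a = Q x) (N : ℕ) (X : KM D) :
    (∀ m, loop (∑ a, ∑ n ∈ Finset.Ioo (-(N : ℤ)) N, form D X (mode (-n) (v a)) • (mode n (u a) : KM D)) m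
      = if m ∈ Finset.Ioo (-(N : ℤ)) N then Q (loop X m) else 0) ∧
    cK (∑ a, ∑ n ∈ Finset.Ioo (-(N : ℤ)) N, form D X (mode (-n) (v a)) • (mode n (u a) : KM D)) = 0 ∧
    cD (∑ a, ∑ n ∈ Finset.Ioo (-(N : ℤ)) N, form D X (mode (-n) (v a)) • (mode n (u a) : KM D)) = 0 := by
  refine ⟨fun m => ?_, ?_, ?_⟩
  · simp only [map_sum, map_smul, Finsupp.finsetSum_apply, Finsupp.smul_apply, mode_eq_elem,
      loop_elem, form_elem_right, neg_neg, mul_zero, add_zero, Finsupp.single_apply, smul_ite,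
      smul_zero, Finset.sum_ite_eq']
    split_ifs
    · exact h _
    · exact Finset.sum_const_zero
  · simp [mode_eq_elem]
  · simp [mode_eq_elem]

/-- The cosine and sine combinations only change the basis of the span of the modes n and -n,
compatibly with the pairing. The terms at n and -n together therefore agree on both sides, and
symmetrising the sum gives twice the identity. -/
theorem sum_form_realMode_smul (N : ℕ) (X : KM D) (u v : 𝔤) :
    ∑ n ∈ Finset.Ioo (-(N : ℤ)) N, form D X (Bases.realMode D n v) • Bases.realMode D n u
      = ∑ n ∈ Finset.Ioo (-(N : ℤ)) N, form D X (mode (-n) v) • mode n u := by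
  set f : ℤ → KM D := fun n => form D X (Bases.realMode D n v) • Bases.realMode D n u
  set g : ℤ → KM D := fun n => form D X (mode (-n) v) • mode n u
  have hneg : ∀ f : ℤ → KM D, ∑ n ∈ Finset.Ioo (-(N : ℤ)) N, f (-n)
      = ∑ n ∈ Finset.Ioo (-(N : ℤ)) N, f n := fun f => by
    refine Finset.sum_nbij' (fun n => -n) (fun n => -n) ?_ ?_ ?_ ?_ ?_ <;> simp <;> omega
  have hs : ((Real.sqrt 2 : ℂ)⁻¹) * ((Real.sqrt 2 : ℂ)⁻¹) = 1 / 2 := by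
    rw [← mul_inv, ← Complex.ofReal_mul, Real.mul_self_sqrt (by norm_num)]; norm_num
  have hpos : ∀ n : ℤ, 0 < n → f n + f (-n) = g n + g (-n) := by
    intro n hn
    have r1 : ∀ w, Bases.realMode D n w
        = ((Real.sqrt 2 : ℂ)⁻¹) • (mode n w + mode (-n) w) := fun w => by
      unfold Bases.realMode
      rw [if_neg hn.ne', if_pos hn]
    have r2 : ∀ w, Bases.realMode D (-n) w
        = (Complex.I * (Real.sqrt 2 : ℂ)⁻¹) • (mode n w - mode (-n) w) := fun w => by
      unfold Bases.realMode
      rw [if_neg (by omega), if_neg (by omega), neg_neg]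
    simp only [f, g, r1, r2, neg_neg]
    simp only [map_smul, map_add, map_sub, smul_eq_mul, smul_smul]
    generalize form D X (mode n v) = a
    generalize form D X (mode (-n) v) = b
    have e1 : (Real.sqrt 2 : ℂ)⁻¹ * (a + b) * (Real.sqrt 2 : ℂ)⁻¹ = (a + b) / 2 := by
      linear_combination (a + b) * hs
    have e2 : Complex.I * (Real.sqrt 2 : ℂ)⁻¹ * (a - b) * (Complex.I * (Real.sqrt 2 : ℂ)⁻¹)
        = -((a - b) / 2) := by
      linear_combination Complex.I ^ 2 * (a - b) * hs + (a - b) / 2 * Complex.I_sq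
    rw [e1, e2]
    module
  have key : ∀ n, f n + f (-n) = g n + g (-n) := by
    intro n
    rcases lt_trichotomy n 0 with h | rfl | h
    · have := hpos (-n) (by omega)
      rw [neg_neg] at this
      rw [add_comm, this, add_comm]
    · simp only [f, g, Bases.realMode, neg_zero, if_true]
    · exact hpos n h
  have h2 : (2 : ℂ) • ∑ n ∈ Finset.Ioo (-(N : ℤ)) N, f n
      = (2 : ℂ) • ∑ n ∈ Finset.Ioo (-(N : ℤ)) N, g n := by
    rw [two_smul, two_smul]
    nth_rewrite 2 [← hneg f]
    nth_rewrite 2 [← hneg g]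
    rw [← Finset.sum_add_distrib, ← Finset.sum_add_distrib]
    exact Finset.sum_congr rfl fun n _ => key n
  exact smul_right_injective _ two_ne_zero h2

theorem form_K_right (X : KM D) : form D X K = cD X := by
  have := form_elem_right 0 (0 : 𝔤) 1 0 X
  simp only [map_zero, mul_zero, mul_one, zero_add] at this
  rw [← this]; congr 1
  exact ext' (by simp [K]) (by simp [K]) (by simp [K])

theorem form_der_right (X : KM D) : form D X der = cK X := by
  have := form_elem_right 0 (0 : 𝔤) 0 1 X
  simp only [map_zero, mul_zero, mul_one, zero_add, add_zero] at this
  rw [← this]; congr 1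
  exact ext' (by simp [der]) (by simp [der]) (by simp [der])

end KM

namespace Bases

variable (E : Bases D)

/-- Pairing with `D` gives the coefficient of `K` and conversely, so these two terms restore the
part outside the loop algebra. -/
theorem psum_aff (N : ℕ) (X : KM D) :
    psum N (fun i => KM.form D X (E.affDual i) • E.aff i) = KM.trunc D N X := by
  obtain ⟨h1, h2, h3⟩ := KM.sum_form_mode_smul (sum_form_real E 0 0) N X
  refine KM.ext' (fun n => ?_) ?_ ?_
  · simp only [psum, aff, affDual, map_add, Finsupp.add_apply, h1, KM.loop_trunc, map_smul]
    simp [KM.K, KM.der]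
  · simp only [psum, aff, affDual, map_add, h2, KM.cK_trunc, map_smul, KM.form_der_right]
    simp [KM.K, KM.der]
  · simp only [psum, aff, affDual, map_add, h3, KM.cD_trunc, map_smul, KM.form_K_right]
    simp [KM.K, KM.der]

theorem psum_affReal (k : ℕ) (p : ℤ) (N : ℕ) (X : KM D) :
    psum N (fun i => KM.form D X (E.affRealDual k p i) • E.affReal k p i) = KM.trunc D N X := by
  obtain ⟨h1, h2, h3⟩ := KM.sum_form_mode_smul (sum_form_real E k p) N X
  -- The phases of the `K` and `D` vectors cancel against those of their duals: (-iη)(iη⁻¹) = 1.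
  have e : ∀ c : ℂ, -Complex.I * eta D k p * c * (Complex.I * (eta D k p)⁻¹) = c := fun c => by
    have : eta D k p ≠ 0 := D.eta_ne_zero k p
    field_simp
    simp
  refine KM.ext' (fun n => ?_) ?_ ?_
  · simp only [psum, affReal, affRealDual, map_add, Finsupp.add_apply, KM.sum_form_realMode_smul,
      h1, KM.loop_trunc, map_smul]
    simp [KM.K, KM.der]
  · simp only [psum, affReal, affRealDual, map_add, KM.sum_form_realMode_smul, h2, KM.cK_trunc,
      map_smul, KM.form_der_right, smul_smul, smul_eq_mul, e]
    simp [KM.K, KM.der]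
  · simp only [psum, affReal, affRealDual, map_add, KM.sum_form_realMode_smul, h3, KM.cD_trunc,
      map_smul, KM.form_K_right, smul_smul, smul_eq_mul, e]
    simp [KM.K, KM.der]

theorem psum_affEig (j : ℤ) (N : ℕ) (X : KM D) :
    psum N (fun i => KM.form D X (E.affEigDual j i) • E.affEig j i)
      = KM.eigProj D j (KM.trunc D N X) := by
  obtain ⟨h1, h2, h3⟩ := KM.sum_form_mode_smul (sum_form_eig E j) N X
  -- As σ fixes `K`, this coefficient survives the averaging exactly when `T ∣ j`, the case in which
  -- iK belongs to the basis.
  have hcK : ∀ Y : KM D, KM.cK (KM.eigProj D j Y) = if (D.T : ℤ) ∣ j then KM.cK Y else 0 := by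
    intro Y
    have h := congrArg KM.cK (KM.eigProj_of_fixed (j := j) (KM.sigma_K (D := D)))
    rw [KM.eigProj_apply, map_smul, map_sum] at h ⊢
    simp only [map_smul, KM.cK_sig, smul_eq_mul, ← Finset.sum_mul] at h ⊢
    have hK : KM.cK (KM.K : KM D) = 1 := rfl
    rw [hK, mul_one] at h
    rw [← mul_assoc, h]
    split_ifs <;> simp [KM.K]
  have hcD : ∀ Y : KM D, KM.cD (KM.eigProj D j Y) = if (D.T : ℤ) ∣ j then KM.cD Y else 0 := by
    intro Y
    have h := congrArg KM.cD (KM.eigProj_of_fixed (j := j) (KM.sigma_der (D := D)))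
    rw [KM.eigProj_apply, map_smul, map_sum] at h ⊢
    simp only [map_smul, KM.cD_sig, smul_eq_mul, ← Finset.sum_mul] at h ⊢
    have hK : KM.cD (KM.der : KM D) = 1 := rfl
    rw [hK, mul_one] at h
    rw [← mul_assoc, h]
    split_ifs <;> simp [KM.der]
  have e : ∀ c : ℂ, -Complex.I * c * Complex.I = c := fun c => by
    linear_combination (-c) * Complex.I_sq
  refine KM.ext' (fun n => ?_) ?_ ?_
  · rw [KM.loop_eigProj]
    simp only [psum, affEig, affEigDual, map_add, Finsupp.add_apply, KM.sum_form_realMode_smul,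
      h1, KM.loop_trunc, map_smul]
    split_ifs <;> simp [KM.K, KM.der, Datum.eig, iterate_map_zero]
  · rw [hcK]
    simp only [psum, affEig, affEigDual, map_add, KM.sum_form_realMode_smul, h2, KM.cK_trunc]
    split_ifs
    · simp only [map_smul, KM.form_der_right, smul_smul, smul_eq_mul, e]
      simp [KM.K, KM.der]
    · simp
  · rw [hcD]
    simp only [psum, affEig, affEigDual, map_add, KM.sum_form_realMode_smul, h3, KM.cD_trunc]
    split_ifs
    · simp only [map_smul, KM.form_K_right, smul_smul, smul_eq_mul, e]
      simp [KM.K, KM.der]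
    · simp

end Bases
end DihedralGaudin
end

noncomputable section
namespace DihedralGaudin

variable {𝔤 : Type*} [LieRing 𝔤] [LieAlgebra ℂ 𝔤] {D : Datum 𝔤}

/-! ## Contractions with the invariant form -/

section Contraction

variable {W : Type*} [AddCommGroup W] [Module ℂ W]

theorem contract_form_separating (w : KM D ⊗[ℂ] W)
    (h : ∀ X, contract (KM.form D X) w = 0) : w = 0 := by
  refine tensor_separating (fun X : KM D => KM.form D X) KM.form_nondegenerate w fun X => ?_
  exact (TensorProduct.lid ℂ W).map_eq_zero_iff.1 (h X)

/-- Contraction of the first two tensor factors with `⟨X, ·⟩` and `⟨Y, ·⟩`. -/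
def contract₂ (X Y : KM D) : KM D ⊗[ℂ] (KM D ⊗[ℂ] W) →ₗ[ℂ] W :=
  contract (KM.form D Y) ∘ₗ contract (KM.form D X)

@[simp] theorem contract₂_tmul (X Y A B : KM D) (w : W) :
    contract₂ X Y (A ⊗ₜ (B ⊗ₜ w)) = (KM.form D X A * KM.form D Y B) • w := by
  simp [contract₂, mul_smul]

theorem contract₂_separating (w : KM D ⊗[ℂ] (KM D ⊗[ℂ] W))
    (h : ∀ X Y, contract₂ X Y w = 0) : w = 0 :=
  contract_form_separating w fun X => contract_form_separating _ fun Y => h X Y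

/-- Truncation of the first two tensor factors. -/
def trunc₂ (N : ℕ) : KM D ⊗[ℂ] (KM D ⊗[ℂ] W) →ₗ[ℂ] KM D ⊗[ℂ] (KM D ⊗[ℂ] W) :=
  TensorProduct.map (KM.trunc D N) (TensorProduct.map (KM.trunc D N) LinearMap.id)

theorem contract₂_trunc₂ (X Y : KM D) (N : ℕ) (w : KM D ⊗[ℂ] (KM D ⊗[ℂ] W)) :
    contract₂ X Y (trunc₂ N w) = contract₂ (KM.trunc D N X) (KM.trunc D N Y) w := by
  induction w using TensorProduct.induction_on with
  | zero => simp
  | add w w' h h' => rw [map_add, map_add, map_add, h, h']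
  | tmul A w =>
    induction w using TensorProduct.induction_on with
    | zero => simp
    | add w w' h h' => rw [TensorProduct.tmul_add, map_add, map_add, map_add, h, h']
    | tmul B w => simp [trunc₂, KM.form_trunc]

theorem exists_trunc₂_eq (w : KM D ⊗[ℂ] (KM D ⊗[ℂ] W)) :
    ∃ N, ∀ M, N ≤ M → trunc₂ M w = w := by
  have hadd : ∀ w w' : KM D ⊗[ℂ] (KM D ⊗[ℂ] W), (∃ N, ∀ M, N ≤ M → trunc₂ M w = w) →
      (∃ N, ∀ M, N ≤ M → trunc₂ M w' = w') → ∃ N, ∀ M, N ≤ M → trunc₂ M (w + w') = w + w' := by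
    rintro w w' ⟨N, hN⟩ ⟨N', hN'⟩
    exact ⟨max N N', fun M hM => by
      rw [map_add, hN M (le_of_max_le_left hM), hN' M (le_of_max_le_right hM)]⟩
  induction w using TensorProduct.induction_on with
  | zero => exact ⟨0, fun M _ => map_zero _⟩
  | add w w' h h' => exact hadd w w' h h'
  | tmul A w =>
    induction w using TensorProduct.induction_on with
    | zero => exact ⟨0, fun M _ => by simp⟩
    | add w w' h h' => rw [TensorProduct.tmul_add]; exact hadd _ _ h h'
    | tmul B w =>
      refine ⟨max (KM.deg A) (KM.deg B), fun M hM => ?_⟩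
      simp only [trunc₂, TensorProduct.map_tmul, LinearMap.id_apply]
      rw [KM.trunc_of_deg_le (le_of_max_le_left hM), KM.trunc_of_deg_le (le_of_max_le_right hM)]

end Contraction

/-! ### Coefficients in the completed triple tensor product -/

variable (P : Points D)

local notation "filtT" => filt₃ (KM.biFilt D) (KM.biFilt D) (biFiltW P)

theorem trunc₂_mem (N n : ℕ) : filtT n ≤ (filtT n).comap (trunc₂ N) := by
  have p := KM.trunc_filt (D := D) N n
  have q := KM.trunc_filtBar (D := D) N n
  have i : ∀ S : Submodule ℂ (WC P), S ≤ S.comap LinearMap.id := fun S => le_rfl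
  refine sup_le (sup_le (sup_le ?_ ?_) ?_) (sup_le (sup_le ?_ ?_) ?_)
  · exact (map_tens_le p (map_tens_le q (i _))).trans (Submodule.comap_mono
      (le_sup_of_le_left (le_sup_of_le_left le_sup_left)))
  · exact (map_tens_le p (map_tens_le (S' := ⊤) le_top (i _))).trans (Submodule.comap_mono
      (le_sup_of_le_left (le_sup_of_le_left le_sup_right)))
  · exact (map_tens_le (S' := ⊤) le_top (map_tens_le p (i _))).trans (Submodule.comap_mono
      (le_sup_of_le_left le_sup_right))
  · exact (map_tens_le q (map_tens_le p (i _))).trans (Submodule.comap_mono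
      (le_sup_of_le_right (le_sup_of_le_left le_sup_left)))
  · exact (map_tens_le q (map_tens_le (S' := ⊤) le_top (i _))).trans (Submodule.comap_mono
      (le_sup_of_le_right (le_sup_of_le_left le_sup_right)))
  · exact (map_tens_le (S' := ⊤) le_top (map_tens_le q (i _))).trans (Submodule.comap_mono
      (le_sup_of_le_right le_sup_right))

/-- Each of the six subspaces constrains two of the three factors, hence at least one of the first
two, and truncation at `N` kills that factor. -/
theorem trunc₂_eq_zero (N : ℕ) : filtT N ≤ LinearMap.ker (trunc₂ N) := by
  have p : ∀ X ∈ (KM.biFilt D).pos N, KM.trunc D N X = 0 :=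
    fun X hX => KM.trunc_eq_zero_of_mem_filt hX
  have q : ∀ X ∈ (KM.biFilt D).neg N, KM.trunc D N X = 0 :=
    fun X hX => KM.trunc_eq_zero_of_mem_filtBar hX
  have h : ∀ {S : Submodule ℂ (KM D)} {U : Submodule ℂ (KM D ⊗[ℂ] WC P)},
      (∀ X ∈ S, KM.trunc D N X = 0) → tens S U ≤ LinearMap.ker (trunc₂ N) := by
    intro S U hS
    refine tens_induction fun a ha b _ => ?_
    rw [LinearMap.mem_ker, trunc₂, TensorProduct.map_tmul, hS a ha, TensorProduct.zero_tmul]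
  have h' : ∀ {S : Submodule ℂ (KM D)} {U : Submodule ℂ (WC P)},
      (∀ X ∈ S, KM.trunc D N X = 0) → tens ⊤ (tens S U) ≤ LinearMap.ker (trunc₂ N) := by
    intro S U hS
    refine tens_induction fun a _ b hb => ?_
    have e : TensorProduct.map (KM.trunc D N) (LinearMap.id : WC P →ₗ[ℂ] WC P) b = 0 :=
      (tens_induction (p := LinearMap.ker (TensorProduct.map (KM.trunc D N) LinearMap.id))
        fun c hc d _ => by
          rw [LinearMap.mem_ker, TensorProduct.map_tmul, hS c hc, TensorProduct.zero_tmul]) hb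
    rw [LinearMap.mem_ker, trunc₂, TensorProduct.map_tmul, e, TensorProduct.tmul_zero]
  exact sup_le (sup_le (sup_le (h p) (h p)) (h' p)) (sup_le (sup_le (h q) (h q)) (h' q))

/-- Once the level bounds the modes of `X` and `Y`, the contraction factors through the truncation,
which vanishes there. -/
theorem filtT_le_ker_contract₂ (X Y : KM D) :
    filtT (max (KM.deg X) (KM.deg Y)) ≤ LinearMap.ker (contract₂ X Y) := by
  intro w hw
  have h := contract₂_trunc₂ X Y (max (KM.deg X) (KM.deg Y)) w
  rw [KM.trunc_of_deg_le (le_max_left _ _), KM.trunc_of_deg_le (le_max_right _ _),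
    LinearMap.mem_ker.1 (trunc₂_eq_zero P _ hw), map_zero] at h
  exact h.symm

/-- The coefficient of an element of `𝔤̃ ⊗̂ 𝔤̃ ⊗̂ 𝔤̃^𝒟_ℂ`, obtained by contraction with `X`, `Y`. -/
def coeff (X Y : KM D) : GGW P →ₗ[ℂ] WC P :=
  Compl.lift (filtT) (contract₂ X Y) _ (filtT_le_ker_contract₂ P X Y)

/-- A representative of `w` modulo a given level involves only finitely many modes in the first two
factors, so a large truncation fixes it. Truncation preserves every level, so one may pass to the
truncation of a finer representative, and contractions detect that this is zero. -/
theorem coeff_separating (w : GGW P) (h : ∀ X Y, coeff P X Y w = 0) : w = 0 := by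
  refine Compl.proj_separating w fun m => ?_
  obtain ⟨t, ht⟩ := (filtT m).mkQ_surjective (w.1 m)
  obtain ⟨N, hN⟩ := exists_trunc₂_eq t
  obtain ⟨s, hs⟩ := (filtT (max m N)).mkQ_surjective (w.1 (max m N))
  have hs' := w.mkQ_of_le (antitone_filt₃ _ _ _) (le_max_left m N) hs
  have hts : t - s ∈ filtT m := mkQ_eq_iff.1 (ht.trans hs'.symm)
  have h0 : trunc₂ (max m N) s = 0 := by
    refine contract₂_separating _ fun X Y => ?_
    set M := max m N
    set X' := KM.trunc D M X
    set Y' := KM.trunc D M Y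
    -- The chosen bound for the modes of the truncated vectors may exceed `M`. A representative at a
    -- higher level is used instead; it has the same truncation at `M`.
    set M' := max M (max (KM.deg X') (KM.deg Y'))
    obtain ⟨s', hs'⟩ := (filtT M').mkQ_surjective (w.1 M')
    have h1 : s - s' ∈ filtT M := mkQ_eq_iff.1
      (hs.trans (w.mkQ_of_le (antitone_filt₃ _ _ _) (le_max_left _ _) hs').symm)
    have h2 : trunc₂ M s = trunc₂ M s' := by
      rw [← sub_eq_zero, ← map_sub]; exact trunc₂_eq_zero P M h1
    rw [h2, contract₂_trunc₂, ← Compl.lift_eq (antitone_filt₃ _ _ _)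
      (filtT_le_ker_contract₂ P X' Y') w (le_max_right _ _) hs']
    exact h X' Y'
  have h1 := trunc₂_mem P (max m N) m hts
  rw [Submodule.mem_comap, map_sub, hN _ (le_max_right _ _), h0, sub_zero] at h1
  change w.1 m = 0
  rw [← ht]
  exact (Submodule.Quotient.mk_eq_zero _).2 h1

/-! ## Continuous maps and the elements of `𝔉` which they define -/

/-- The linear maps `𝔤̃ → 𝔤̃^𝒟_ℂ` compatible with the filtrations. -/
def ContHom : Submodule ℂ (KM D →ₗ[ℂ] WC P) where
  carrier := {J | ∀ n, (∀ X ∈ KM.filt D n, J X ∈ filtW P n) ∧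
    ∀ X ∈ KM.filtBar D n, J X ∈ filtWBar P n}
  zero_mem' _ := ⟨fun _ _ => Submodule.zero_mem _, fun _ _ => Submodule.zero_mem _⟩
  add_mem' h h' n := ⟨fun X hX => Submodule.add_mem _ ((h n).1 X hX) ((h' n).1 X hX),
    fun X hX => Submodule.add_mem _ ((h n).2 X hX) ((h' n).2 X hX)⟩
  smul_mem' c _ h n := ⟨fun X hX => Submodule.smul_mem _ c ((h n).1 X hX),
    fun X hX => Submodule.smul_mem _ c ((h n).2 X hX)⟩

variable {P} (E : Bases D)

/-- The partial sums of `∑ I_a ⊗ J(Iᵃ)`. -/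
def canonSeq (N : ℕ) : (KM D →ₗ[ℂ] WC P) →ₗ[ℂ] KM D ⊗[ℂ] WC P where
  toFun J := psum N fun i => E.affDual i ⊗ₜ J (E.aff i)
  map_add' J J' := by simp only [LinearMap.add_apply, TensorProduct.tmul_add, psum_add]
  map_smul' c J := by
    simp only [LinearMap.smul_apply, TensorProduct.tmul_smul, RingHom.id_apply, psum_smul]

/-- Exhibits the partial sums as images of the truncated Casimir element, whose convergence is
known; a map compatible with the filtrations transports it. -/
theorem canonSeq_eq (N : ℕ) (J : KM D →ₗ[ℂ] WC P) : canonSeq E N J =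
    TensorProduct.comm ℂ (WC P) (KM D) (TensorProduct.map J LinearMap.id (casSeq E 0 N)) := by
  unfold casSeq
  rw [psum_map, psum_map]
  rfl

theorem canonSeq_succ_sub (J : ContHom P) (N : ℕ) :
    canonSeq E (N + 1) J.1 - canonSeq E N J.1 ∈ filt₂ (KM.biFilt D) (biFiltW P) N := by
  rw [canonSeq_eq, canonSeq_eq, ← map_sub, ← map_sub]
  have h := casSeq_succ_sub E 0 N
  revert h
  generalize casSeq E 0 (N + 1) - casSeq E 0 N = w
  intro h
  refine (filt₂_le (p := (filt₂ (KM.biFilt D) (biFiltW P) N).comap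
    ((TensorProduct.comm ℂ (WC P) (KM D)).toLinearMap ∘ₗ TensorProduct.map J.1 LinearMap.id))
    (fun a ha b hb => ?_) (fun a ha b hb => ?_)) h
  · exact Submodule.mem_sup_right (tmul_mem hb ((J.2 N).1 a ha))
  · exact Submodule.mem_sup_left (tmul_mem hb ((J.2 N).2 a ha))

/-- The element `∑ I_a ⊗ J(Iᵃ)` of `𝔉`. -/
def canon : ContHom P →ₗ[ℂ] FF P where
  toFun J := Compl.ofSeq (antitone_filt₂ _ _) (fun N => canonSeq E N J.1) (canonSeq_succ_sub E J)
  map_add' J J' := Subtype.ext (funext fun N => by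
    change (filt₂ (KM.biFilt D) (biFiltW P) N).mkQ (canonSeq E N (J.1 + J'.1)) = _
    rw [map_add, map_add]; rfl)
  map_smul' c J := Subtype.ext (funext fun N => by
    change (filt₂ (KM.biFilt D) (biFiltW P) N).mkQ (canonSeq E N (c • J.1)) = _
    rw [map_smul, map_smul]; rfl)

/-- The scalars ⟨X, I_ã⟩ move inside `J`, where the completeness relation recombines them with the
basis. -/
theorem contract_canonSeq (N : ℕ) (J : KM D →ₗ[ℂ] WC P) (X : KM D) :
    contract (KM.form D X) (canonSeq E N J) = J (KM.trunc D N X) := by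
  rw [← E.psum_aff, psum_map]
  refine (psum_map (contract (KM.form D X)) N fun i => E.affDual i ⊗ₜ[ℂ] J (E.aff i)).trans ?_
  simp only [contract_tmul, map_smul]

/-- Contractions of the first two factors commute with the bracket in the third one. -/
theorem coeff_brk₃ (J J' : ContHom P) (X Y : KM D) :
    coeff P X Y ((contBilin_brk₃ (KM.biFilt D) (KM.biFilt D) (biFiltW P)).ext
      (canon E J) (canon E J')) = ⁅J.1 X, J'.1 Y⁆ := by
  refine Compl.lift_ext _ _ (canonSeq_succ_sub E J) (canonSeq_succ_sub E J')
     (k := max (KM.deg X) (KM.deg Y)) fun N hN => ?_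
  have h : ∀ u v : KM D ⊗[ℂ] WC P, contract₂ X Y (brk₃ (KM D) (KM D) (WC P) u v)
      = ⁅contract (KM.form D X) u, contract (KM.form D Y) v⁆ := by
    intro u v
    induction u using TensorProduct.induction_on with
    | zero => simp
    | add u u' h h' => simp only [map_add, LinearMap.add_apply, add_lie, h, h']
    | tmul a w =>
      induction v using TensorProduct.induction_on with
      | zero => simp
      | add u u' h h' =>
        simp only [map_add, h, h']
        exact (lie_add (contract (KM.form D X) (a ⊗ₜ[ℂ] w)) _ _).symm
      | tmul b w' => simp [mul_smul]
  rw [h, contract_canonSeq, contract_canonSeq, KM.trunc_of_deg_le (le_of_max_le_left hN),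
    KM.trunc_of_deg_le (le_of_max_le_right hN)]

theorem psum_sigma_aff (k N : ℕ) (Y : KM D) :
    psum N (fun i => KM.form D Y (E.affDual i) • ((KM.sigma : Module.End ℂ (KM D)) ^ k) (E.aff i))
      = KM.sig D k (KM.trunc D N Y) := by
  rw [← E.psum_aff, psum_map, KM.sig_natCast]
  simp only [map_smul]

theorem psum_contract_form_lie {d : ℕ} (N : ℕ) (X : KM D) (f : Idx d → KM D)
    (v : KM D ⊗[ℂ] WC P) :
    psum N (fun i => contract (KM.form D ⁅X, f i⁆) v) = contract (KM.form D ⁅X, psum N f⁆) v := by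
  induction v using TensorProduct.induction_on with
  | zero => simp [psum]
  | add u u' h h' => simp only [map_add, psum_add, h, h']
  | tmul b w =>
    simp only [contract_tmul, psum, lie_add, lie_sum, map_add, map_sum, LinearMap.add_apply,
      LinearMap.sum_apply, add_smul, Finset.sum_smul]

/-- Invariance moves the bracket onto `X`, by ⟨X, [a, v]⟩ = ⟨[X, a], v⟩. The completeness relation
then sums ⟨Y, I_ã⟩ σ^k I^ã to σ^k Y. -/
theorem coeff_brk₁ (k : ℕ) (J : ContHom P) (X Y : KM D) :
    coeff P X Y ((contBilin_brk₁ (KM.biFilt D) (KM.biFilt D) (biFiltW P)).ext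
      (cas E k) (canon E J)) = J.1 ⁅X, KM.sig D k Y⁆ := by
  refine Compl.lift_ext _ _ (casSeq_succ_sub E k) (canonSeq_succ_sub E J)
     -- The first bound makes the truncated Casimir sum exact on `Y`, the second makes the partial
     -- sum of `canon` exact on the resulting bracket.
     (k := max (KM.deg Y) (KM.deg ⁅X, KM.sig D k Y⁆)) fun N hN => ?_
  have h : ∀ (a b : KM D) (v : KM D ⊗[ℂ] WC P),
      contract₂ X Y (brk₁ (KM D) (KM D) (WC P) (a ⊗ₜ b) v)
        = contract (KM.form D ⁅X, KM.form D Y b • a⁆) v := by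
    intro a b v
    induction v using TensorProduct.induction_on with
    | zero => simp
    | add u u' h h' => simp only [map_add, h, h']
    | tmul b w' => simp [KM.form_lie, mul_comm]
  have h3 : contract₂ X Y (brk₁ (KM D) (KM D) (WC P) (casSeq E k N) (canonSeq E N J.1))
      = psum N fun i => contract₂ X Y (brk₁ (KM D) (KM D) (WC P)
        (((KM.sigma : Module.End ℂ (KM D)) ^ k) (E.aff i) ⊗ₜ E.affDual i) (canonSeq E N J.1)) := by
    unfold casSeq
    exact psum_map (contract₂ X Y ∘ₗ
      (brk₁ (KM D) (KM D) (WC P)).flip (canonSeq E N J.1)) N _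
  rw [h3]
  simp only [h]
  rw [psum_contract_form_lie, psum_sigma_aff, KM.trunc_of_deg_le (le_of_max_le_left hN), contract_canonSeq,
    KM.trunc_of_deg_le (le_of_max_le_right hN)]

/-- The mechanism of `coeff_brk₁` with `X` and `Y` exchanged, since the first leg of the Casimir
element now acts in the second factor. -/
theorem coeff_brk₂ (k : ℕ) (J : ContHom P) (X Y : KM D) :
    coeff P X Y ((contBilin_brk₂ (KM.biFilt D) (KM.biFilt D) (biFiltW P)).ext
      (cas E k) (canon E J)) = J.1 ⁅Y, KM.sig D k X⁆ := by
  refine Compl.lift_ext _ _ (casSeq_succ_sub E k) (canonSeq_succ_sub E J)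
     (k := max (KM.deg X) (KM.deg ⁅Y, KM.sig D k X⁆)) fun N hN => ?_
  have h : ∀ (a b : KM D) (v : KM D ⊗[ℂ] WC P),
      contract₂ X Y (brk₂ (KM D) (KM D) (WC P) (a ⊗ₜ b) v)
        = contract (KM.form D ⁅Y, KM.form D X b • a⁆) v := by
    intro a b v
    induction v using TensorProduct.induction_on with
    | zero => simp
    | add u u' h h' => simp only [map_add, h, h']
    | tmul b w' => simp [KM.form_lie]
  have h3 : contract₂ X Y (brk₂ (KM D) (KM D) (WC P) (casSeq E k N) (canonSeq E N J.1))
      = psum N fun i => contract₂ X Y (brk₂ (KM D) (KM D) (WC P)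
        (((KM.sigma : Module.End ℂ (KM D)) ^ k) (E.aff i) ⊗ₜ E.affDual i) (canonSeq E N J.1)) := by
    unfold casSeq
    exact psum_map (contract₂ X Y ∘ₗ
      (brk₂ (KM D) (KM D) (WC P)).flip (canonSeq E N J.1)) N _
  rw [h3]
  simp only [h]
  rw [psum_contract_form_lie, psum_sigma_aff, KM.trunc_of_deg_le (le_of_max_le_left hN), contract_canonSeq,
    KM.trunc_of_deg_le (le_of_max_le_right hN)]

end DihedralGaudin
end

noncomputable section
namespace DihedralGaudin

variable {𝔤 : Type*} [LieRing 𝔤] [LieAlgebra ℂ 𝔤] {D : Datum 𝔤}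

/-! ## Components of `𝔤̃^𝒟_ℂ` -/

section Components

variable (P : Points D)

/-- Writing v = 1 ⊗ u + i ⊗ w with real u and w, the two images are u + iw and u - iw, which
together determine u and w. -/
theorem phi_conjW_separating (v : WC P) (h : phi P v = 0) (h' : phi P (conjW P v) = 0) :
    v = 0 := by
  obtain ⟨u, w, rfl⟩ : ∃ u w : gD P, v = (1 : ℂ) ⊗ₜ[ℝ] u + Complex.I ⊗ₜ[ℝ] w := by
    clear h h'
    induction v using TensorProduct.induction_on with
    | zero => exact ⟨0, 0, by simp⟩
    | add v v' h h' =>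
      obtain ⟨u, w, rfl⟩ := h
      obtain ⟨u', w', rfl⟩ := h'
      exact ⟨u + u', w + w', by simp only [TensorProduct.tmul_add]; abel⟩
    | tmul a u =>
      refine ⟨a.re • u, a.im • u, ?_⟩
      rw [← TensorProduct.smul_tmul, ← TensorProduct.smul_tmul, ← TensorProduct.add_tmul]
      congr 1
      apply Complex.ext <;> simp
  have e1 : phi P ((1 : ℂ) ⊗ₜ[ℝ] u + Complex.I ⊗ₜ[ℝ] w) = (u : TD P) + Complex.I • (w : TD P) := by
    rw [map_add, phi, LinearMap.liftBaseChange_tmul, LinearMap.liftBaseChange_tmul, one_smul]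
    rfl
  have e2 : phi P (conjW P ((1 : ℂ) ⊗ₜ[ℝ] u + Complex.I ⊗ₜ[ℝ] w))
      = (u : TD P) - Complex.I • (w : TD P) := by
    have : conjW P ((1 : ℂ) ⊗ₜ[ℝ] u + Complex.I ⊗ₜ[ℝ] w)
      = (conj (1 : ℂ)) ⊗ₜ[ℝ] u + (conj Complex.I) ⊗ₜ[ℝ] w := map_add _ _ _
    rw [this, map_add, phi, LinearMap.liftBaseChange_tmul, LinearMap.liftBaseChange_tmul, map_one,
      one_smul, Complex.conj_I, neg_smul, sub_eq_add_neg]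
    rfl
  rw [e1] at h
  rw [e2] at h'
  have hu : (2 : ℂ) • (u : TD P) = 0 := by
    rw [show (2 : ℂ) • (u : TD P) = ((u : TD P) + Complex.I • (w : TD P))
      + ((u : TD P) - Complex.I • (w : TD P)) by module, h, h', add_zero]
  have hw : (2 * Complex.I) • (w : TD P) = 0 := by
    rw [show (2 * Complex.I) • (w : TD P) = ((u : TD P) + Complex.I • (w : TD P))
      - ((u : TD P) - Complex.I • (w : TD P)) by module, h, h', sub_zero]
  have hu' : u = 0 := Subtype.ext ((smul_eq_zero.1 hu).resolve_left two_ne_zero)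
  have hw' : w = 0 := Subtype.ext ((smul_eq_zero.1 hw).resolve_left
    (mul_ne_zero two_ne_zero Complex.I_ne_zero))
  rw [hu', hw', TensorProduct.tmul_zero, TensorProduct.tmul_zero, add_zero]

/-- The coefficient of `ε_y^q` in `φ(v)` (for `b = false`), or `τ` applied to the coefficient of
`ε_y^q` in `φ(c v)` (for `b = true`). -/
def comp (b : Bool) (y : Option P.Z) (q : Fin (P.ord y)) : WC P →ₗ[ℂ] KM D where
  toFun v := if b then KM.tau (phi P (conjW P v) y q) else phi P v y q
  map_add' v w := by
    cases b
    · exact congrFun (congrFun (map_add (phi P) v w) y) q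
    · change KM.tau (phi P (conjW P (v + w)) y q) = _
      rw [map_add, map_add]
      exact map_add KM.tau _ _
  map_smul' c v := by
    cases b
    · exact congrFun (congrFun (map_smul (phi P) c v) y) q
    -- Both `conjW` and τ are antilinear, so this component is complex linear like the other one.
    · change KM.tau (phi P (conjW P (c • v)) y q) = _
      rw [map_smulₛₗ, map_smul]
      refine (map_smulₛₗ KM.tau _ _).trans ?_
      rw [Complex.conj_conj]
      rfl

theorem comp_false (y : Option P.Z) (q : Fin (P.ord y)) (v : WC P) :
    comp P false y q v = phi P v y q := rfl

theorem comp_true (y : Option P.Z) (q : Fin (P.ord y)) (v : WC P) :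
    comp P true y q v = KM.tau (phi P (conjW P v) y q) := rfl

theorem comp_separating (v : WC P)
    (h : ∀ i : Bool × (y : Option P.Z) × Fin (P.ord y), comp P i.1 i.2.1 i.2.2 v = 0) : v = 0 := by
  refine phi_conjW_separating P v (funext fun y => funext fun q => h (false, ⟨y, q⟩))
    (funext fun y => funext fun q => ?_)
  have := h (true, ⟨y, q⟩)
  change KM.tau (phi P (conjW P v) y q) = 0 at this
  rw [← KM.tau_tau (phi P (conjW P v) y q), this, map_zero]
  rfl

theorem comp_lie (b : Bool) (y : Option P.Z) (r : Fin (P.ord y)) (v w : WC P) :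
    comp P b y r ⁅v, w⁆ = ∑ p : Fin (P.ord y), ∑ q : Fin (P.ord y),
      if (p : ℕ) + q = r then ⁅comp P b y p v, comp P b y q w⁆ else 0 := by
  cases b
  · rw [comp_false, phi_lie, TD.lie_apply]; rfl
  · rw [comp_true, conjW_lie, phi_lie, TD.lie_apply, map_sum]
    refine Finset.sum_congr rfl fun p _ => ?_
    rw [map_sum]
    refine Finset.sum_congr rfl fun q _ => ?_
    split_ifs
    · rw [KM.tau_lie]; rfl
    · simp

/-- The Lie bracket extended to rational functions. -/
def lieRat (L : Type*) [LieRing L] [LieAlgebra ℂ L] :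
    L ⊗[ℂ] Rat2 →ₗ[ℂ] L ⊗[ℂ] Rat2 →ₗ[ℂ] L ⊗[ℂ] Rat2 :=
  TensorProduct.map₂ (lieB L) (LinearMap.mul ℂ Rat2)

@[simp] theorem lieRat_tmul {L : Type*} [LieRing L] [LieAlgebra ℂ L] (x y : L) (f g : Rat2) :
    lieRat L (x ⊗ₜ f) (y ⊗ₜ g) = ⁅x, y⁆ ⊗ₜ (f * g) := rfl

theorem map_comp_lieRat (b : Bool) (y : Option P.Z) (r : Fin (P.ord y)) (v w : WC P ⊗[ℂ] Rat2) :
    TensorProduct.map (comp P b y r) LinearMap.id (lieRat (WC P) v w)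
      = ∑ p : Fin (P.ord y), ∑ q : Fin (P.ord y), if (p : ℕ) + q = r then
        lieRat (KM D) (TensorProduct.map (comp P b y p) LinearMap.id v)
          (TensorProduct.map (comp P b y q) LinearMap.id w) else 0 := by
  induction v using TensorProduct.induction_on with
  | zero => simp
  | add v v' h h' =>
    simp only [map_add, LinearMap.add_apply, h, h', ← Finset.sum_add_distrib]
    refine Finset.sum_congr rfl fun p _ => Finset.sum_congr rfl fun q _ => ?_
    split_ifs <;> simp
  | tmul a f =>
    induction w using TensorProduct.induction_on with
    | zero => simp
    | add v v' h h' =>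
      simp only [map_add, h, h', ← Finset.sum_add_distrib]
      refine Finset.sum_congr rfl fun p _ => Finset.sum_congr rfl fun q _ => ?_
      split_ifs <;> simp
    | tmul a' g =>
      simp only [lieRat_tmul, TensorProduct.map_tmul, comp_lie, TensorProduct.sum_tmul,
        LinearMap.id_apply]
      refine Finset.sum_congr rfl fun p _ => Finset.sum_congr rfl fun q _ => ?_
      split_ifs <;> simp

end Components

/-! ## The classical Yang-Baxter structure of the components -/

theorem smul_coord_ne_algebraMap (i : Fin 2) {c : ℂ} (hc : c ≠ 0) (a : ℂ) :
    c • coord i ≠ algebraMap ℂ Rat2 a := fun h => by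
  have := aeval_coord_injective i (a₁ := c • Polynomial.X) (a₂ := Polynomial.C a) (by simpa using h)
  have h2 := congrArg (fun p => p.coeff 1) this
  simp at h2
  exact hc h2

theorem smul_coord_zero_ne (a c : ℂ) (ha : a ≠ 0) : a • coord 0 ≠ c • coord 1 := fun h => by
  have h1 : a • (MvPolynomial.X 0 : MvPolynomial (Fin 2) ℂ) = c • MvPolynomial.X 1 := by
    apply IsFractionRing.injective (MvPolynomial (Fin 2) ℂ) Rat2
    simpa [coord, Algebra.smul_def, IsScalarTower.algebraMap_apply ℂ (MvPolynomial (Fin 2) ℂ) Rat2]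
      using h
  have h2 := congrArg (MvPolynomial.eval ![1, 0]) h1
  simp [MvPolynomial.smul_eval] at h2
  exact ha h2

/-- `∑ₖ σᵏ X ⊗ ωᵏ h(ωᵏ u)`, where `h` is a function with values in the rational functions. -/
def cyclo (D : Datum 𝔤) {A : Type*} [Field A] [Algebra ℂ A] (h : A → A) (u : A) (X : KM D) :
    KM D ⊗[ℂ] A :=
  (D.T : ℂ)⁻¹ • ∑ k ∈ Finset.range D.T, KM.sig D k X ⊗ₜ (D.ω ^ k • h (D.ω ^ k • u))

theorem Datum.ω_pow_add_T (D : Datum 𝔤) (k : ℕ) : D.ω ^ (k + D.T) = D.ω ^ k := by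
  rw [pow_add, D.primitive.pow_eq_one, mul_one]

theorem KM.sig_natCast_add_T (k : ℕ) : KM.sig D ((k + D.T : ℕ) : ℤ) = KM.sig D k := by
  rw [Nat.cast_add, KM.sig_add_T]

theorem sum_comm₄ {ι κ M : Type*} [AddCommMonoid M] (s : Finset ι) (t : Finset κ)
    (f : ι → ι → κ → κ → M) : ∑ p ∈ s, ∑ q ∈ s, ∑ k ∈ t, ∑ l ∈ t, f p q k l
      = ∑ k ∈ t, ∑ l ∈ t, ∑ p ∈ s, ∑ q ∈ s, f p q k l := by
  have h : ∀ p, ∑ q ∈ s, ∑ k ∈ t, ∑ l ∈ t, f p q k l = ∑ k ∈ t, ∑ l ∈ t, ∑ q ∈ s, f p q k l :=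
    fun p => by
      rw [Finset.sum_comm]
      exact Finset.sum_congr rfl fun k _ => Finset.sum_comm
  simp only [h]
  rw [Finset.sum_comm]
  exact Finset.sum_congr rfl fun k _ => Finset.sum_comm

/-- Rescales a denominator v - ω⁻ᵐu of the r-matrix to the symmetric form ω^l v - ω^k u. For `e = 0`
both sides vanish by the convention on inverses. -/
theorem smul_inv_mul_eq {A : Type*} [Field A] [Algebra ℂ A] (a : ℂ) {d : ℂ} (hd : d ≠ 0) (g e : A) :
    a • (e⁻¹ * g) = (a * d) • (g / (d • e)) := by
  have hd' : algebraMap ℂ A d ≠ 0 := (map_ne_zero _).2 hd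
  by_cases he : e = 0
  · simp [he]
  · rw [Algebra.smul_def, Algebra.smul_def d e, Algebra.smul_def, map_mul]
    field_simp

theorem neg_smul_inv_mul_eq {A : Type*} [Field A] [Algebra ℂ A] (a : ℂ) {d : ℂ} (hd : d ≠ 0)
    (g e : A) : -(a • (e⁻¹ * g)) = (d * a) • (g / -(d • e)) := by
  rw [smul_inv_mul_eq a hd, div_neg, smul_neg, mul_comm a d]

/-- Every term is a double sum of [σ^k X, σ^l Y] over residues k, l modulo `T`. On the left, partial
fractions split each coefficient into a part with its pole function in z and one with its pole
function in z'. On the right, σ is pulled through the bracket and the sum over the r-matrix index is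
shifted; the two r-matrix terms are exactly these two parts. -/
theorem lieRat_cyclo (x : Option ℂ) {n : ℕ} (r : Fin n) (X Y : KM D) :
    (∑ p : Fin n, ∑ q : Fin n, if (p : ℕ) + q = r then
      lieRat (KM D) (cyclo D (poleFun x p) (coord 0) X) (cyclo D (poleFun x q) (coord 1) Y) else 0)
    = (D.T : ℂ)⁻¹ • ∑ k ∈ Finset.range D.T, TensorProduct.map LinearMap.id
        (LinearMap.mul ℂ Rat2 (coord 1 - (D.ω ^ k)⁻¹ • coord 0)⁻¹)
        (cyclo D (poleFun x r) (coord 0) ⁅X, KM.sig D k Y⁆)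
      - (D.T : ℂ)⁻¹ • ∑ k ∈ Finset.range D.T, TensorProduct.map LinearMap.id
        (LinearMap.mul ℂ Rat2 (coord 0 - (D.ω ^ k)⁻¹ • coord 1)⁻¹)
        (cyclo D (poleFun x r) (coord 1) ⁅Y, KM.sig D k X⁆) := by
  set z := coord 0
  set w := coord 1
  set c : ℕ → ℂ := fun k => D.ω ^ k with hc
  have hc0 : ∀ k, c k ≠ 0 := fun k => pow_ne_zero _ D.ω_ne_zero
  have hcT : ∀ k, c (k + D.T) = c k := D.ω_pow_add_T
  have hcadd : ∀ k m, c (k + m) = c k * c m := fun k m => pow_add _ _ _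
  set h := poleFun (A := Rat2) x r
  have hsub : ∀ k l, c l • w - c k • z ≠ 0 := fun k l =>
    sub_ne_zero.2 (smul_coord_zero_ne _ _ (hc0 k)).symm
  -- the left hand side
  have hL : (∑ p : Fin n, ∑ q : Fin n, if (p : ℕ) + q = r then
      lieRat (KM D) (cyclo D (poleFun x p) z X) (cyclo D (poleFun x q) w Y) else 0)
      = (D.T : ℂ)⁻¹ • (D.T : ℂ)⁻¹ • ∑ k ∈ Finset.range D.T, ∑ l ∈ Finset.range D.T,
        ⁅KM.sig D k X, KM.sig D l Y⁆ ⊗ₜ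
          ((c k * c l) • ((h (c k • z) - h (c l • w)) / (c l • w - c k • z))) := by
    have h1 : ∀ p q : Fin n, lieRat (KM D) (cyclo D (poleFun x p) z X) (cyclo D (poleFun x q) w Y)
        = (D.T : ℂ)⁻¹ • (D.T : ℂ)⁻¹ • ∑ k ∈ Finset.range D.T, ∑ l ∈ Finset.range D.T,
          ⁅KM.sig D k X, KM.sig D l Y⁆ ⊗ₜ
            ((c k * c l) • (poleFun x p (c k • z) * poleFun x q (c l • w))) := by
      intro p q
      simp only [cyclo, map_smul, LinearMap.smul_apply, map_sum, LinearMap.sum_apply, lieRat_tmul,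
        hc, smul_mul_smul_comm, ← Finset.smul_sum]
      refine congrArg _ (congrArg _ ?_)
      exact Finset.sum_comm
    have h2 : ∀ p q : Fin n, (if (p : ℕ) + q = r then
        lieRat (KM D) (cyclo D (poleFun x p) z X) (cyclo D (poleFun x q) w Y) else 0)
        = (D.T : ℂ)⁻¹ • (D.T : ℂ)⁻¹ • ∑ k ∈ Finset.range D.T, ∑ l ∈ Finset.range D.T,
          ⁅KM.sig D k X, KM.sig D l Y⁆ ⊗ₜ
            ((c k * c l) • if (p : ℕ) + q = r then
              (poleFun x p (c k • z) * poleFun x q (c l • w)) else 0) := by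
      intro p q
      split_ifs
      · exact h1 p q
      · simp
    simp only [h2, ← Finset.smul_sum]
    congr 2
    rw [sum_comm₄]
    refine Finset.sum_congr rfl fun k _ => Finset.sum_congr rfl fun l _ => ?_
    simp only [← TensorProduct.tmul_sum, ← Finset.smul_sum]
    -- Multiples of z and z' by roots of unity are nonconstant and distinct, even for k = l, so no
    -- denominator vanishes.
    rw [sum_poleFun_mul x (smul_coord_zero_ne _ _ (hc0 k)) (smul_coord_ne_algebraMap 0 (hc0 k))
      (smul_coord_ne_algebraMap 1 (hc0 l))]
  have hR1 : ∑ m ∈ Finset.range D.T, TensorProduct.map LinearMap.id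
        (LinearMap.mul ℂ Rat2 (w - (D.ω ^ m)⁻¹ • z)⁻¹) (cyclo D h z ⁅X, KM.sig D m Y⁆)
      = (D.T : ℂ)⁻¹ • ∑ k ∈ Finset.range D.T, ∑ l ∈ Finset.range D.T,
        ⁅KM.sig D k X, KM.sig D l Y⁆ ⊗ₜ
          ((c k * c l) • (h (c k • z) / (c l • w - c k • z))) := by
    simp only [cyclo, map_smul, map_sum, TensorProduct.map_tmul, LinearMap.id_apply,
      ← Finset.smul_sum]
    congr 1
    rw [Finset.sum_comm]
    refine Finset.sum_congr rfl fun k _ => ?_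
    -- For fixed k, periodicity permits the substitution l = k + m.
    refine Eq.trans ?_ (sum_range_add_of_periodic
      (fun l => by simp only [KM.sig_natCast_add_T, hcT]) k)
    refine Finset.sum_congr rfl fun m _ => ?_
    rw [KM.sig_lie, add_comm m k, Nat.cast_add, KM.sig_add]
    congr 1
    have e : c (k + m) • w - c k • z = c (k + m) • (w - (c m)⁻¹ • z) := by
      rw [smul_sub, smul_smul, hcadd, mul_assoc, mul_inv_cancel₀ (hc0 m), mul_one]
    rw [e]
    exact smul_inv_mul_eq (c k) (hc0 (k + m)) _ _
  have hR2 : ∑ m ∈ Finset.range D.T, TensorProduct.map LinearMap.id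
        (LinearMap.mul ℂ Rat2 (z - (D.ω ^ m)⁻¹ • w)⁻¹) (cyclo D h w ⁅Y, KM.sig D m X⁆)
      = (D.T : ℂ)⁻¹ • ∑ k ∈ Finset.range D.T, ∑ l ∈ Finset.range D.T,
        ⁅KM.sig D k X, KM.sig D l Y⁆ ⊗ₜ
          ((c k * c l) • (h (c l • w) / (c l • w - c k • z))) := by
    simp only [cyclo, map_smul, map_sum, TensorProduct.map_tmul, LinearMap.id_apply,
      ← Finset.smul_sum]
    congr 1
    rw [Finset.sum_comm, Finset.sum_comm (s := Finset.range D.T) (t := Finset.range D.T)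
      (f := fun k l => ⁅KM.sig D k X, KM.sig D l Y⁆ ⊗ₜ[ℂ] _)]
    refine Finset.sum_congr rfl fun l _ => ?_
    refine Eq.trans ?_ (sum_range_add_of_periodic
      (fun k => by simp only [KM.sig_natCast_add_T, hcT]) l)
    refine Finset.sum_congr rfl fun m _ => ?_
    -- Here k = l + m, and skew symmetry supplies the sign by which ω^l z' - ω^k z differs from the
    -- rescaled denominator of the second r-matrix.
    rw [KM.sig_lie, add_comm m l, Nat.cast_add, KM.sig_add, ← lie_skew, TensorProduct.neg_tmul,
      ← TensorProduct.tmul_neg]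
    congr 1
    have e : c l • w - c (l + m) • z = - (c (l + m) • (z - (c m)⁻¹ • w)) := by
      rw [smul_sub, smul_smul, hcadd, mul_assoc, mul_inv_cancel₀ (hc0 m), mul_one, neg_sub]
    rw [e]
    exact neg_smul_inv_mul_eq (c l) (hc0 (l + m)) _ _
  rw [hL, hR1, hR2, ← smul_sub, ← smul_sub, ← Finset.sum_sub_distrib]
  congr 2
  refine Finset.sum_congr rfl fun k _ => ?_
  rw [← Finset.sum_sub_distrib]
  refine Finset.sum_congr rfl fun l _ => ?_
  rw [← TensorProduct.tmul_sub, ← smul_sub, sub_div]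

end DihedralGaudin
end

noncomputable section
namespace DihedralGaudin

variable {𝔤 : Type*} [LieRing 𝔤] [LieAlgebra ℂ 𝔤] {D : Datum 𝔤}

/-! ## Lax matrices as rational families of continuous maps -/

section Lax

variable {P : Points D}

/-- Evaluation of a continuous map. -/
def evalHom (P : Points D) (X : KM D) : ContHom P →ₗ[ℂ] WC P :=
  LinearMap.applyₗ X ∘ₗ (ContHom P).subtype

/-- The value at `X` of a rational family of continuous maps, as a function of `z` or of `z'`. -/
def evalAt (i : Fin 2) (X : KM D) : ContHom P ⊗[ℂ] regAlg P →ₗ[ℂ] WC P ⊗[ℂ] Rat2 :=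
  TensorProduct.map (evalHom P X) ((subst i).toLinearMap ∘ₗ (regAlg P).val.toLinearMap)

variable (E : Bases D)

/-- The element of `𝔉 ⊗ R_{Πz}` defined by a rational family of continuous maps. -/
def laxOf : ContHom P ⊗[ℂ] regAlg P →ₗ[ℂ] FF P ⊗[ℂ] regAlg P :=
  TensorProduct.map (canon E) LinearMap.id

theorem coeff_poisson (𝒥 𝒥' : ContHom P ⊗[ℂ] regAlg P) (X Y : KM D) :
    TensorProduct.map (coeff P X Y) LinearMap.id
      (poisson₁₂ P (laxAt P 0 (laxOf E 𝒥)) (laxAt P 1 (laxOf E 𝒥')))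
      = lieRat (WC P) (evalAt 0 X 𝒥) (evalAt 1 Y 𝒥') := by
  induction 𝒥 using TensorProduct.induction_on with
  | zero => simp
  | add u u' h h' => simp only [map_add, LinearMap.add_apply, h, h']
  | tmul J f =>
    induction 𝒥' using TensorProduct.induction_on with
    | zero => simp
    | add u u' h h' => simp only [map_add, h, h']
    | tmul J' g => exact congrArg (· ⊗ₜ[ℂ] _) (coeff_brk₃ E J J' X Y)

theorem coeff_bracket₁₂₁ (u v : Rat2) (i : Fin 2) (𝒥 : ContHom P ⊗[ℂ] regAlg P) (X Y : KM D) :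
    TensorProduct.map (coeff P X Y) LinearMap.id (bracket₁₂₁ P (rMat E u v) (laxAt P i (laxOf E 𝒥)))
      = (D.T : ℂ)⁻¹ • ∑ k ∈ Finset.range D.T, TensorProduct.map LinearMap.id
        (LinearMap.mul ℂ Rat2 (v - (D.ω ^ k)⁻¹ • u)⁻¹) (evalAt i ⁅X, KM.sig D k Y⁆ 𝒥) := by
  simp only [rMat, map_smul, map_sum, LinearMap.smul_apply, LinearMap.sum_apply]
  congr 1
  refine Finset.sum_congr rfl fun k _ => ?_
  induction 𝒥 using TensorProduct.induction_on with
  | zero => simp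
  | add u u' h h' => simp only [map_add, h, h']
  | tmul J f => exact congrArg (· ⊗ₜ[ℂ] _) (coeff_brk₁ E k J X Y)

theorem coeff_bracket₂₁₂ (u v : Rat2) (i : Fin 2) (𝒥 : ContHom P ⊗[ℂ] regAlg P) (X Y : KM D) :
    TensorProduct.map (coeff P X Y) LinearMap.id (bracket₂₁₂ P (rMat E u v) (laxAt P i (laxOf E 𝒥)))
      = (D.T : ℂ)⁻¹ • ∑ k ∈ Finset.range D.T, TensorProduct.map LinearMap.id
        (LinearMap.mul ℂ Rat2 (v - (D.ω ^ k)⁻¹ • u)⁻¹) (evalAt i ⁅Y, KM.sig D k X⁆ 𝒥) := by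
  simp only [rMat, map_smul, map_sum, LinearMap.smul_apply, LinearMap.sum_apply]
  congr 1
  refine Finset.sum_congr rfl fun k _ => ?_
  induction 𝒥 using TensorProduct.induction_on with
  | zero => simp
  | add u u' h h' => simp only [map_add, h, h']
  | tmul J f => exact congrArg (· ⊗ₜ[ℂ] _) (coeff_brk₂ E k J X Y)

/-- Enlarging the regular functions to all rational functions stays injective after tensoring, by
flatness; then the projections to the quotients separate points. -/
theorem isFormalLax_unique {L L' : FF P ⊗[ℂ] regAlg P} (h : IsFormalLax P E L)
    (h' : IsFormalLax P E L') : L' = L := by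
  have hinj : Function.Injective (TensorProduct.map (LinearMap.id : FF P →ₗ[ℂ] FF P)
      (regAlg P).val.toLinearMap) :=
    Module.Flat.lTensor_preserves_injective_linearMap _ Subtype.val_injective
  refine hinj (tensor_separating_eq (Compl.proj _) Compl.proj_separating fun N => ?_)
  have e : ∀ M : FF P ⊗[ℂ] regAlg P, TensorProduct.map (Compl.proj _ N) LinearMap.id
      (TensorProduct.map (LinearMap.id : FF P →ₗ[ℂ] FF P) (regAlg P).val.toLinearMap M)
      = TensorProduct.map (Compl.proj _ N) (regAlg P).val.toLinearMap M := fun M => by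
    rw [← LinearMap.comp_apply, ← TensorProduct.map_comp]; rfl
  rw [e, e, h N, h' N]

/-- Level `N` of `canon` is by construction the class of the partial sum at `N`, so it suffices to
match partial sums before any quotient is taken. -/
theorem isFormalLax_laxOf {𝒥 : ContHom P ⊗[ℂ] regAlg P}
    (h : ∀ N, TensorProduct.map (canonSeq E N ∘ₗ (ContHom P).subtype) (regAlg P).val.toLinearMap 𝒥
      = zeta P (Phi P E N)) : IsFormalLax P E (laxOf E 𝒥) := fun N => by
  rw [← h N, laxOf, ← LinearMap.comp_apply, ← LinearMap.comp_apply, ← TensorProduct.map_comp,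
    ← TensorProduct.map_comp]
  rfl

/-- The point at which the component `comp P b y` of a Lax matrix has its poles. -/
def polePoint (b : Bool) (y : Option P.Z) : Option ℂ :=
  y.map fun x => if b then conj (x : ℂ) else x

theorem map_cyclo (i : Fin 2) (x : Option ℂ) (q : ℕ) (X : KM D) :
    TensorProduct.map LinearMap.id (subst i).toLinearMap (cyclo D (poleFun x q) RatFunc.X X)
      = cyclo D (poleFun x q) (coord i) X := by
  have hX : subst i (RatFunc.X : Rat1) = coord i := by
    have h := RatFunc.liftAlgHom_apply_div (K := ℂ) (φ := Polynomial.aeval (coord i))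
      (nonZeroDivisors_le_comap_nonZeroDivisors_of_injective _ (aeval_coord_injective i))
      Polynomial.X 1
    simpa [subst] using h
  simp only [cyclo, map_smul, map_sum, TensorProduct.map_tmul, LinearMap.id_apply]
  congr 1
  refine Finset.sum_congr rfl fun k _ => ?_
  change _ ⊗ₜ[ℂ] (_ • (subst i) _) = _
  have e : D.ω ^ k • coord i = subst i (D.ω ^ k • RatFunc.X) := by
    rw [← hX]; exact (map_smul (subst i).toLinearMap _ _).symm
  rw [map_poleFun, e]

/-- Coefficients separate the completed triple product and components separate 𝔤̃^𝒟_ℂ. At each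
marked point, and in each of the two copies, what remains is `lieRat_cyclo`; the second copy merely
has its pole at the conjugate point. -/
theorem poisson_laxOf {𝒥 : ContHom P ⊗[ℂ] regAlg P}
    (h : ∀ b y q X, TensorProduct.map (comp P b y q ∘ₗ evalHom P X) (regAlg P).val.toLinearMap 𝒥
      = cyclo D (poleFun (polePoint b y) q) RatFunc.X X) :
    poisson₁₂ P (laxAt P 0 (laxOf E 𝒥)) (laxAt P 1 (laxOf E 𝒥)) =
      bracket₁₂₁ P (rMat E (coord 0) (coord 1)) (laxAt P 0 (laxOf E 𝒥))
        - bracket₂₁₂ P (rMat E (coord 1) (coord 0)) (laxAt P 1 (laxOf E 𝒥)) := by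
  have hev : ∀ (i : Fin 2) (X : KM D) b y q, TensorProduct.map (comp P b y q) LinearMap.id
      (evalAt i X 𝒥) = cyclo D (poleFun (polePoint b y) q) (coord i) X := fun i X b y q => by
    rw [← map_cyclo, ← h b y q X, evalAt, ← LinearMap.comp_apply, ← LinearMap.comp_apply,
      ← TensorProduct.map_comp, ← TensorProduct.map_comp]
    rfl
  have hmul : ∀ (f : Rat2) b y q (w : WC P ⊗[ℂ] Rat2), TensorProduct.map (comp P b y q) LinearMap.id
      (TensorProduct.map LinearMap.id (LinearMap.mul ℂ Rat2 f) w)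
      = TensorProduct.map LinearMap.id (LinearMap.mul ℂ Rat2 f)
        (TensorProduct.map (comp P b y q) LinearMap.id w) := fun f b y q w => by
    rw [← LinearMap.comp_apply, ← LinearMap.comp_apply, ← TensorProduct.map_comp,
      ← TensorProduct.map_comp]
    rfl
  refine tensor_separating_eq (fun XY : KM D × KM D => coeff P XY.1 XY.2)
    (fun w hw => coeff_separating P w fun X Y => hw (X, Y)) fun ⟨X, Y⟩ => ?_
  rw [map_sub, coeff_poisson, coeff_bracket₁₂₁, coeff_bracket₂₁₂]
  refine tensor_separating_eq (fun i : Bool × (y : Option P.Z) × Fin (P.ord y) =>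
    comp P i.1 i.2.1 i.2.2) (comp_separating P) fun ⟨b, y, r⟩ => ?_
  simp only [map_sub, map_smul, map_sum, hmul, map_comp_lieRat, hev]
  exact lieRat_cyclo _ r X Y

end Lax

end DihedralGaudin
end

noncomputable section
namespace DihedralGaudin

variable {𝔤 : Type*} [LieRing 𝔤] [LieAlgebra ℂ 𝔤] {D : Datum 𝔤}

/-! ## Rational functions with poles at the marked points -/

theorem pole_eq_poleFun (x : ℂ) (p : ℕ) : pole x p = poleFun (some x) p (RatFunc.X : Rat1) := rfl

theorem formS_smul_poleFun (x : Option ℂ) (p : ℕ) (a b : ℂ) :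
    formS D (a • poleFun x p (b • (RatFunc.X : Rat1)))
      = (D.ω⁻¹ * a) • poleFun x p ((D.ω⁻¹ * b) • (RatFunc.X : Rat1)) := by
  set g : Rat1 →ₐ[ℂ] Rat1 := RatFunc.mapAlgHom
    (Polynomial.aeval (Polynomial.C D.ω⁻¹ * Polynomial.X))
    (nonZeroDivisors_le_comap_nonZeroDivisors_of_injective _ (comp_scale_injective D.ω⁻¹
      (inv_ne_zero (D.primitive.ne_zero D.T_pos.ne')))) with hg
  have hX : g RatFunc.X = D.ω⁻¹ • RatFunc.X := by
    have h := RatFunc.map_apply_div (K := ℂ)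
      (Polynomial.aeval (Polynomial.C D.ω⁻¹ * Polynomial.X) : Polynomial ℂ →ₐ[ℂ] Polynomial ℂ)
      (nonZeroDivisors_le_comap_nonZeroDivisors_of_injective _ (comp_scale_injective D.ω⁻¹
        (inv_ne_zero (D.primitive.ne_zero D.T_pos.ne')))) Polynomial.X 1
    rw [map_one, map_one, map_one, div_one, div_one, RatFunc.algebraMap_X] at h
    refine Eq.trans h ?_
    rw [Polynomial.aeval_X, map_mul, RatFunc.algebraMap_C, RatFunc.algebraMap_X,
      RatFunc.smul_eq_C_mul]
  have hb : (D.ω⁻¹ * b) • (RatFunc.X : Rat1) = g (b • RatFunc.X) := by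
    rw [map_smul g.toLinearMap b RatFunc.X |> (id : _ → g (b • RatFunc.X) = b • g RatFunc.X), hX,
      smul_smul, mul_comm]
  rw [hb, ← map_poleFun, map_smul, mul_comm, mul_smul]
  refine congrArg (a • ·) ?_
  rfl

theorem formS_iterate_pole (k : ℕ) (x : ℂ) (p : ℕ) : (formS D)^[k] (pole x p)
    = D.ω ^ (-(k : ℤ)) • poleFun (some x) p (D.ω ^ (-(k : ℤ)) • (RatFunc.X : Rat1)) := by
  induction k with
  | zero => simp [pole_eq_poleFun]
  | succ k ih =>
    have e : D.ω⁻¹ * D.ω ^ (-(k : ℤ)) = D.ω ^ (-((k + 1 : ℕ) : ℤ)) := by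
      rw [← zpow_neg_one, ← zpow_add₀ D.ω_ne_zero]; congr 1; push_cast; ring
    rw [Function.iterate_succ_apply', ih, formS_smul_poleFun, e]

theorem formT_pole (x : ℂ) (p : ℕ) : formT (pole x p) = pole (conj x) p := by
  have hX : conjRat RatFunc.X = RatFunc.X := by
    have h := RatFunc.map_apply_div (K := ℂ) (Polynomial.mapRingHom (starRingEnd ℂ))
      (nonZeroDivisors_le_comap_nonZeroDivisors_of_injective (Polynomial.mapRingHom (starRingEnd ℂ))
        (Polynomial.map_injective (starRingEnd ℂ) (starRingEnd ℂ).injective)) Polynomial.X 1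
    rw [map_one, map_one, map_one, div_one, div_one, RatFunc.algebraMap_X] at h
    refine Eq.trans h ?_
    simp
  change conjRat (pole x p) = _
  rw [pole, pole, map_inv₀, map_pow, map_sub, hX, conjRat_C]

/-- The only possible pole is at c⁻¹x. -/
theorem poleFun_smul_X_mem (P : Points D) (x : ℂ) (p : ℕ) {c : ℂ} (hc : c ≠ 0)
    (h : c⁻¹ * x ∈ orbits P) : poleFun (some x) p (c • (RatFunc.X : Rat1)) ∈ regAlg P := by
  intro a ha
  set Q : Polynomial ℂ := (Polynomial.C c * Polynomial.X - Polynomial.C x) ^ (p + 1)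
  have e : poleFun (some x) p (c • (RatFunc.X : Rat1))
      = algebraMap (Polynomial ℂ) Rat1 1 / algebraMap (Polynomial ℂ) Rat1 Q := by
    rw [map_one, one_div, map_pow, map_sub, map_mul, RatFunc.algebraMap_C, RatFunc.algebraMap_C,
      RatFunc.algebraMap_X, ← RatFunc.smul_eq_C_mul]
    rfl
  rw [e] at ha
  have h1 := ha.dvd (RatFunc.denom_div_dvd 1 Q)
  have h2 : c * a - x = 0 := by
    have : (c * a - x) ^ (p + 1) = 0 := by simpa [Q] using h1
    exact pow_eq_zero_iff (Nat.succ_ne_zero p) |>.1 this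
  rwa [← sub_eq_zero.1 h2, inv_mul_cancel_left₀ hc] at h

theorem X_pow_mem (P : Points D) (q : ℕ) : (RatFunc.X : Rat1) ^ q ∈ regAlg P := by
  refine pow_mem (fun a ha => ?_) q
  rw [RatFunc.denom_X] at ha
  simp at ha

theorem formS_iterate_pole_mem (P : Points D) (x : P.Z) (b : Bool) (k p : ℕ) :
    (formS D)^[k] (pole (if b then conj (x : ℂ) else x) p) ∈ regAlg P := by
  rw [formS_iterate_pole]
  refine Subalgebra.smul_mem _ (poleFun_smul_X_mem P _ p (zpow_ne_zero _ D.ω_ne_zero) ?_) _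
  refine ⟨x, x.2, k, b, ?_⟩
  rw [Datum.mu, zpow_neg, inv_inv, zpow_natCast]

/-- `cyclo` in terms of the action of the cyclic group on differentials. -/
theorem cyclo_pole (x : ℂ) (p : ℕ) (X : KM D) (m : ℕ) :
    cyclo D (poleFun (some x) p) (RatFunc.X : Rat1) X = (D.T : ℂ)⁻¹ • ∑ k ∈ Finset.range D.T,
      KM.sig D (-(k + m : ℕ)) X ⊗ₜ[ℂ] (formS D)^[k + m] (pole x p) := by
  set F : ℤ → KM D ⊗[ℂ] Rat1 := fun j =>
    KM.sig D j X ⊗ₜ (D.ω ^ j • poleFun (some x) p (D.ω ^ j • (RatFunc.X : Rat1)))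
  have hF : ∀ j, F (j + D.T) = F j := fun j => by
    have := D.ω_zpow_add_T 1 j
    simp only [one_mul] at this
    simp only [F, KM.sig_add_T, this]
  have hF' : ∀ j, F (-(j + D.T)) = F (-j) := fun j => by
    rw [← hF (-(j + D.T))]; congr 1; ring
  have e1 : cyclo D (poleFun (some x) p) (RatFunc.X : Rat1) X
      = (D.T : ℂ)⁻¹ • ∑ k ∈ Finset.range D.T, F k := by
    simp only [cyclo, F, zpow_natCast]
  -- The index is negated because the adjoint of σ^k is σ^(-k). The extra shift by `m` is needed at
  -- points fixed by a reflection, where it absorbs a rotation.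
  rw [e1, ← sum_range_neg_of_periodic hF,
    ← sum_range_int_add_of_periodic (F := fun j => F (-j)) hF' m]
  congr 1
  refine Finset.sum_congr rfl fun k _ => ?_
  rw [formS_iterate_pole, Nat.cast_add]

/-- For the monomials attached to 0 and ∞ a rotation only multiplies by a character, so averaging
over the cyclic group becomes a projection to an eigenspace of σ. -/
theorem cyclo_of_homogeneous {A : Type*} [Field A] [Algebra ℂ A] (h : A → A) (u : A) (j : ℤ)
    (hh : ∀ k : ℕ, D.ω ^ k • h (D.ω ^ k • u) = D.ω ^ (-j * k) • h u) (X : KM D) :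
    cyclo D h u X = KM.eigProj D j X ⊗ₜ h u := by
  simp only [cyclo, hh, KM.eigProj_apply, TensorProduct.smul_tmul', TensorProduct.sum_tmul,
    TensorProduct.tmul_smul, Finset.smul_sum]

/-! ## Continuous maps with a single component -/

section Single

variable {P : Points D}

theorem TD.single_add (x : Option P.Z) (p : Fin (P.ord x)) (X Y : KM D) :
    TD.single P x p (X + Y) = TD.single P x p X + TD.single P x p Y := by
  funext y q
  change TD.single P x p (X + Y) y q = TD.single P x p X y q + TD.single P x p Y y q
  unfold TD.single
  split_ifs <;> simp

theorem TD.single_smul (x : Option P.Z) (p : Fin (P.ord x)) (c : ℂ) (X : KM D) :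
    TD.single P x p (c • X) = c • TD.single P x p X := by
  funext y q
  change TD.single P x p (c • X) y q = c • TD.single P x p X y q
  unfold TD.single
  split_ifs <;> simp

theorem TD.single_mem_coeffIn (x : Option P.Z) (p : Fin (P.ord x)) {S : Submodule ℂ (KM D)}
    {X : KM D} (hX : X ∈ S) : TD.single P x p X ∈ coeffIn P S := fun y q => by
  unfold TD.single
  split_ifs
  · exact hX
  · exact S.zero_mem

theorem phi_tmul (a : ℂ) (u : gD P) : phi P (a ⊗ₜ u) = a • (u : TD P) :=
  LinearMap.liftBaseChange_tmul _ _ _ _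

theorem conjW_tmul (a : ℂ) (u : gD P) : conjW P (a ⊗ₜ u) = conj a ⊗ₜ u := rfl

theorem conjW_conjW (v : WC P) : conjW P (conjW P v) = v := by
  induction v using TensorProduct.induction_on with
  | zero => simp
  | add v w h h' => rw [map_add, map_add, h, h']
  | tmul a u => rw [conjW_tmul, conjW_tmul, Complex.conj_conj]

theorem phi_conjW_ext {v w : WC P} (h : phi P v = phi P w)
    (h' : phi P (conjW P v) = phi P (conjW P w)) : v = w := by
  rw [← sub_eq_zero]
  exact phi_conjW_separating P _ (by rw [map_sub, h, sub_self])
    (by rw [map_sub, map_sub, h', sub_self])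

/-- The endomorphisms of `𝔤̃` compatible with both filtrations. -/
def FiltEnd (A : KM D →ₗ[ℂ] KM D) : Prop :=
  ∀ n, KM.filt D n ≤ (KM.filt D n).comap A ∧ KM.filtBar D n ≤ (KM.filtBar D n).comap A

theorem filtEnd_id : FiltEnd (LinearMap.id : KM D →ₗ[ℂ] KM D) := fun _ => ⟨le_rfl, le_rfl⟩
theorem filtEnd_zero : FiltEnd (0 : KM D →ₗ[ℂ] KM D) := fun n =>
  ⟨fun _ _ => (KM.filt D n).zero_mem, fun _ _ => (KM.filtBar D n).zero_mem⟩
theorem filtEnd_sig (j : ℤ) : FiltEnd (KM.sig D j) := fun n =>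
  ⟨KM.sig_filt j n, KM.sig_filtBar j n⟩
theorem FiltEnd.smul {A : KM D →ₗ[ℂ] KM D} (hA : FiltEnd A) (c : ℂ) : FiltEnd (c • A) := fun n =>
  ⟨fun _ hX => (KM.filt D n).smul_mem c ((hA n).1 hX),
    fun _ hX => (KM.filtBar D n).smul_mem c ((hA n).2 hX)⟩
theorem filtEnd_eigProj (j : ℤ) : FiltEnd (KM.eigProj D j) := fun n =>
  ⟨fun X hX => by
    rw [Submodule.mem_comap, KM.eigProj_apply]
    exact Submodule.smul_mem _ _ (Submodule.sum_mem _ fun k _ =>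
      Submodule.smul_mem _ _ (KM.sig_filt k n hX)),
  fun X hX => by
    rw [Submodule.mem_comap, KM.eigProj_apply]
    exact Submodule.smul_mem _ _ (Submodule.sum_mem _ fun k _ =>
      Submodule.smul_mem _ _ (KM.sig_filtBar k n hX))⟩

/-- There is a continuous map `J` with `φ(J X) = A X ε^p` and `φ(c J X) = τ(C X) ε^p`. -/
theorem exists_contHom (x : Option P.Z) (p : Fin (P.ord x)) {A C : KM D →ₗ[ℂ] KM D}
    (hA : FiltEnd A) (hC : FiltEnd C)
    (h : ∀ X, TD.single P x p (A X + KM.tau (C X)) ∈ gD P) :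
    ∃ J : ContHom P, ∀ X, phi P (J.1 X) = TD.single P x p (A X) ∧
      phi P (conjW P (J.1 X)) = TD.single P x p (KM.tau (C X)) := by
  have key : ∀ X, ∃ v : WC P, phi P v = TD.single P x p (A X) ∧
      phi P (conjW P v) = TD.single P x p (KM.tau (C X)) := fun X => by
    -- Polarisation: `A X + τ (C X)` is an element of the real algebra with a complex linear and an
    -- antilinear part in `X`. Half its value at `X` and -i/2 times its value at iX isolate the
    -- linear part under φ, and the antilinear part once the scalars are conjugated.
    refine ⟨(1 / 2 : ℂ) ⊗ₜ (⟨_, h X⟩ : gD P)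
      + (-(Complex.I / 2)) ⊗ₜ (⟨_, h (Complex.I • X)⟩ : gD P), ?_, ?_⟩
    · simp only [map_add, phi_tmul, ← TD.single_smul, ← TD.single_add]
      congr 1
      simp only [map_smul, map_smulₛₗ, Complex.conj_I, smul_add, smul_smul]
      have e1 : -(Complex.I / 2) * Complex.I = 1 / 2 := by
        rw [neg_mul, div_mul_eq_mul_div, Complex.I_mul_I]; ring
      have e2 : -(Complex.I / 2) * -Complex.I = -(1 / 2) := by
        rw [mul_neg, e1]
      rw [e1, e2]
      module
    · simp only [map_add, conjW_tmul, phi_tmul, ← TD.single_smul, ← TD.single_add]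
      congr 1
      simp only [map_smul, map_smulₛₗ, Complex.conj_I, smul_add, smul_smul, map_neg, map_div₀,
        map_one, map_ofNat]
      have e1 : -(-Complex.I / 2) * Complex.I = -(1 / 2) := by
        rw [neg_div, neg_neg, div_mul_eq_mul_div, Complex.I_mul_I]; ring
      have e2 : -(-Complex.I / 2) * -Complex.I = 1 / 2 := by
        rw [mul_neg, e1, neg_neg]
      rw [e1, e2]
      module
  choose f hf hf' using key
  refine ⟨⟨{ toFun := f, map_add' := fun X Y => ?_, map_smul' := fun c X => ?_ },
    fun n => ⟨fun X hX => ?_, fun X hX => ?_⟩⟩, fun X => ⟨hf X, hf' X⟩⟩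
  · exact phi_conjW_ext (by simp only [map_add, hf, TD.single_add])
      (by simp only [map_add, hf', TD.single_add])
  · exact phi_conjW_ext (by simp only [RingHom.id_apply, map_smul, hf, TD.single_smul])
      (by simp only [RingHom.id_apply, map_smulₛₗ, hf', TD.single_smul])
  · refine ⟨?_, ?_⟩
    · change phi P (f X) ∈ coeffIn P _
      rw [hf]; exact TD.single_mem_coeffIn x p ((hA n).1 hX)
    · change phi P (conjW P (f X)) ∈ coeffIn P _
      -- τ exchanges the two filtrations of 𝔤̃, which matches the opposite conditions that `filtW`
      -- puts on the two embeddings.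
      rw [hf']; exact TD.single_mem_coeffIn x p (KM.tau_filt n ((hC n).1 hX))
  · refine ⟨?_, ?_⟩
    · change phi P (conjW P (f X)) ∈ coeffIn P _
      rw [hf']; exact TD.single_mem_coeffIn x p (KM.tau_filtBar n ((hC n).2 hX))
    · change phi P (conjW P (conjW P (f X))) ∈ coeffIn P _
      rw [conjW_conjW, hf]; exact TD.single_mem_coeffIn x p ((hA n).2 hX)

end Single

end DihedralGaudin
end

noncomputable section
namespace DihedralGaudin

variable {𝔤 : Type*} [LieRing 𝔤] [LieAlgebra ℂ 𝔤] {D : Datum 𝔤}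

/-! ## The contributions of the marked points -/

section Parts

variable {P : Points D}

theorem psum_sum {d : ℕ} {A κ : Type*} [AddCommMonoid A] (N : ℕ) (s : Finset κ)
    (f : κ → Idx d → A) : (psum N fun i => ∑ k ∈ s, f k i) = ∑ k ∈ s, psum N (f k) := by
  classical
  induction s using Finset.induction_on with
  | empty => simp [psum]
  | insert a s ha ih => simp only [Finset.sum_insert ha, psum_add, ih]

theorem actOmega_false_tmul (k : ℕ) (a : KM D) (f : Rat1) :
    actOmega D k false (a ⊗ₜ f) = KM.sig D k a ⊗ₜ (formS D)^[k] f := by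
  rw [KM.sig_natCast]
  induction k with
  | zero => rfl
  | succ k ih =>
    have h : actOmega D (k + 1) false (a ⊗ₜ f) = TensorProduct.map (KM.sigma : KM D →ₗ[ℂ] KM D)
        (formS D) (actOmega D k false (a ⊗ₜ f)) := Function.iterate_succ_apply' _ _ _
    rw [h, ih, TensorProduct.map_tmul, Function.iterate_succ_apply', pow_succ',
      Module.End.mul_apply]

theorem actOmega_true_tmul (k : ℕ) (a : KM D) (f : Rat1) :
    actOmega D k true (a ⊗ₜ f) = KM.sig D k (KM.tau a) ⊗ₜ (formS D)^[k] (formT f) :=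
  actOmega_false_tmul k (KM.tau a) (formT f)

/-- The image of `ζ` contracted with `⟨X, ·⟩`. -/
def contrZeta (P : Points D) (X : KM D) : Omega D ⊗[ℝ] gD P →ₗ[ℝ] WC P ⊗[ℂ] Rat1 :=
  (TensorProduct.map (contract (KM.form D X)) LinearMap.id).restrictScalars ℝ ∘ₗ zeta P

theorem contrZeta_apply (X : KM D) (v : Omega D ⊗[ℝ] gD P) : contrZeta P X v =
    TensorProduct.map (contract (KM.form D X)) LinearMap.id (zeta P v) := rfl

theorem contrZeta_tmul (X a : KM D) (f : Rat1) (Y : gD P) :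
    contrZeta P X ((a ⊗ₜ[ℂ] f) ⊗ₜ[ℝ] Y) = (KM.form D X a • ((1 : ℂ) ⊗ₜ[ℝ] Y)) ⊗ₜ f := by
  have : contrZeta P X ((a ⊗ₜ[ℂ] f) ⊗ₜ[ℝ] Y)
      = contract (KM.form D X) (a ⊗ₜ[ℂ] ((1 : ℂ) ⊗ₜ[ℝ] Y)) ⊗ₜ f := rfl
  rw [this, contract_tmul]

theorem contrZeta_sum_tmul {κ : Type*} (X : KM D) (r : ℝ) (s : Finset κ) (v : κ → Omega D)
    (Y : gD P) : contrZeta P X ((r • ∑ k ∈ s, v k) ⊗ₜ[ℝ] Y)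
      = (r : ℂ) • ∑ k ∈ s, contrZeta P X (v k ⊗ₜ Y) := by
  have h : (r • ∑ k ∈ s, v k) ⊗ₜ[ℝ] Y = r • ((∑ k ∈ s, v k) ⊗ₜ[ℝ] Y) := rfl
  rw [h, map_smul, TensorProduct.sum_tmul, map_sum]
  exact (Complex.coe_smul (E := WC P ⊗[ℂ] Rat1) r _).symm

/-- `ψ` is the part, with values in the coefficients of `ε_y^p`, of the Lax matrix which corresponds
to the part `Φ` of the canonical element. -/
structure IsLaxPart (y : Option P.Z) (p : Fin (P.ord y)) (Φ : ℕ → Omega D ⊗[ℝ] gD P)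
    (ψ : ContHom P ⊗[ℂ] regAlg P) : Prop where
  contr : ∀ N X, TensorProduct.map (evalHom P (KM.trunc D N X)) (regAlg P).val.toLinearMap ψ
    = contrZeta P X (Φ N)
  comp_self : ∀ b X, TensorProduct.map (comp P b y p ∘ₗ evalHom P X) (regAlg P).val.toLinearMap ψ
    = cyclo D (poleFun (polePoint b y) p) RatFunc.X X
  comp_ne : ∀ b y' (q : Fin (P.ord y')) X, ¬ (y' = y ∧ (q : ℕ) = p) →
    TensorProduct.map (comp P b y' q ∘ₗ evalHom P X) (regAlg P).val.toLinearMap ψ = 0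

/-- The composition of a continuous map with an endomorphism. -/
def ContHom.precomp (J : ContHom P) (B : KM D →ₗ[ℂ] KM D) (hB : FiltEnd B) : ContHom P :=
  ⟨J.1 ∘ₗ B, fun n => ⟨fun _ hX => (J.2 n).1 _ ((hB n).1 hX), fun _ hX => (J.2 n).2 _ ((hB n).2 hX)⟩⟩

/-- `J` has `φ(J X) = A X ε_y^p` and `φ(c J X) = τ(C X) ε_y^p`. -/
def HasComp (y : Option P.Z) (p : Fin (P.ord y)) (A C : KM D →ₗ[ℂ] KM D) (J : ContHom P) : Prop :=
  ∀ X, phi P (J.1 X) = TD.single P y p (A X) ∧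
    phi P (conjW P (J.1 X)) = TD.single P y p (KM.tau (C X))

section HasComp

variable {y : Option P.Z} {p : Fin (P.ord y)} {A C : KM D →ₗ[ℂ] KM D} {J : ContHom P}

theorem TD.single_self (y : Option P.Z) (p : Fin (P.ord y)) (X : KM D) :
    TD.single P y p X y p = X := if_pos ⟨rfl, rfl⟩

theorem HasComp.comp_false (h : HasComp y p A C J) (X : KM D) :
    comp P false y p (J.1 X) = A X := by
  rw [DihedralGaudin.comp_false, (h X).1, TD.single_self]

theorem HasComp.comp_true (h : HasComp y p A C J) (X : KM D) :
    comp P true y p (J.1 X) = C X := by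
  rw [DihedralGaudin.comp_true, (h X).2, TD.single_self, KM.tau_tau]

theorem HasComp.comp_ne (h : HasComp y p A C J) (b : Bool) {y' : Option P.Z} {q : Fin (P.ord y')}
    (hq : ¬ (y' = y ∧ (q : ℕ) = p)) (X : KM D) : comp P b y' q (J.1 X) = 0 := by
  cases b
  · rw [DihedralGaudin.comp_false, (h X).1]
    exact if_neg hq
  · rw [DihedralGaudin.comp_true, (h X).2]
    have : TD.single P y p (KM.tau (C X)) y' q = 0 := if_neg hq
    rw [this, map_zero]

/-- Recognition of the complexification of an element of `𝔤̃^𝒟` as a value of `J`. -/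
theorem HasComp.apply_eq (h : HasComp y p A C J) {X : KM D} {u : gD P} {V : KM D}
    (hu : (u : TD P) = TD.single P y p V) (hA : A X = V) (hC : KM.tau (C X) = V) :
    (1 : ℂ) ⊗ₜ[ℝ] u = J.1 X := by
  refine phi_conjW_ext ?_ ?_
  · rw [(h X).1, phi_tmul, one_smul, hu, hA]
  · rw [(h X).2, conjW_tmul, phi_tmul, map_one, one_smul, hu, hC]

end HasComp

variable (E : Bases D)

/-- The summand of `phiO` of degree `p`. -/
def phiOPart (N : ℕ) (x : P.Z) (p : Fin (P.ord (some x))) : Omega D ⊗[ℝ] gD P :=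
  psum N fun i => (E.affEigDual (p : ℕ) i ⊗ₜ[ℂ] pole 0 p) ⊗ₜ[ℝ]
      genO x p (E.affEig (p : ℕ) i) (E.sigma_affEig _ i) (E.tau_affEig _ i)

theorem KM.sigma_tau_of_eigen {j : ℤ} {X : KM D} (h : KM.sigma X = D.ω ^ j • X) :
    KM.sigma (KM.tau X) = D.ω ^ j • KM.tau X := by
  have h1 := KM.sigma_tau_sigma X
  rw [h, map_smulₛₗ, map_smul, D.conj_ω_zpow] at h1
  conv_rhs => rw [← h1, smul_smul, ← zpow_add₀ D.ω_ne_zero, add_neg_cancel, zpow_zero, one_smul]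

theorem KM.sigma_eigProj_add_tau (j : ℤ) (X : KM D) :
    KM.sigma (KM.eigProj D j X + KM.tau (KM.eigProj D j X))
      = D.ω ^ j • (KM.eigProj D j X + KM.tau (KM.eigProj D j X)) := by
  have h := KM.sigma_eigProj (D := D) j X
  rw [map_add, h, KM.sigma_tau_of_eigen h, smul_add]

theorem KM.tau_eigProj_add_tau (j : ℤ) (X : KM D) :
    KM.tau (KM.eigProj D j X + KM.tau (KM.eigProj D j X))
      = KM.eigProj D j X + KM.tau (KM.eigProj D j X) := by
  rw [map_add, KM.tau_tau, add_comm]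

theorem HasComp.apply_eigProj {y : Option P.Z} {p : Fin (P.ord y)} {j : ℤ} {J : ContHom P}
    (h : HasComp y p (KM.eigProj D j) (KM.eigProj D j) J) (X : KM D) :
    J.1 (KM.eigProj D j X) = J.1 X := by
  have e := KM.eigProj_of_eigen (KM.sigma_eigProj (D := D) j X)
  exact phi_conjW_ext (by rw [(h _).1, (h _).1, e]) (by rw [(h _).2, (h _).2, e])

/-- The stabiliser is all of Π, so both copies carry the projection to the ω^p-eigenspace. The
function z^(-p-1) is homogeneous, which makes a single tensor enough. -/
theorem exists_isLaxPart_origin (x : P.Z) (hx : (x : ℂ) = 0) (p : Fin (P.ord (some x))) :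
    ∃ ψ, IsLaxPart (some x) p (fun N => phiOPart E N x p) ψ := by
  obtain ⟨J, hJ⟩ := exists_contHom (some x) p (filtEnd_eigProj (D := D) (p : ℕ))
    (filtEnd_eigProj (p : ℕ)) fun X => (genO x p _ (KM.sigma_eigProj_add_tau (p : ℕ) X)
      (KM.tau_eigProj_add_tau _ X)).2
  change HasComp _ _ _ _ J at hJ
  have hmem : pole 0 p ∈ regAlg P := by
    have := formS_iterate_pole_mem P x false 0 p
    rwa [hx] at this
  have hcyc : ∀ X : KM D, cyclo D (poleFun (some 0) p) (RatFunc.X : Rat1) X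
      = KM.eigProj D (p : ℕ) X ⊗ₜ pole 0 p := fun X => by
    refine cyclo_of_homogeneous _ _ _ (fun k => ?_) X
    simp only [poleFun, map_zero, sub_zero, Algebra.smul_def, mul_pow, mul_inv, ← map_pow,
      ← map_inv₀]
    rw [← mul_assoc, ← map_mul]
    congr 2
    rw [← pow_mul, ← zpow_natCast, ← zpow_natCast, ← zpow_neg, ← zpow_add₀ D.ω_ne_zero]
    congr 1
    push_cast
    ring
  refine ⟨J ⊗ₜ ⟨pole 0 p, hmem⟩, fun N X => ?_, fun b X => ?_, fun b y q X hq => ?_⟩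
  · rw [phiOPart, psum_map]
    have e : ∀ i, contrZeta P X ((E.affEigDual (p : ℕ) i ⊗ₜ[ℂ] pole 0 p) ⊗ₜ[ℝ]
        genO x p (E.affEig (p : ℕ) i) (E.sigma_affEig _ i) (E.tau_affEig _ i))
        = ((TensorProduct.mk ℂ (WC P) Rat1).flip (pole 0 p) ∘ₗ J.1)
          (KM.form D X (E.affEigDual (p : ℕ) i) • E.affEig (p : ℕ) i) := fun i => by
      have e1 := KM.eigProj_of_eigen (E.sigma_affEig (p : ℕ) i)
      rw [contrZeta_tmul, hJ.apply_eq rfl e1 (by rw [e1, E.tau_affEig]), map_smul]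
      rfl
    simp only [e]
    rw [← psum_map, E.psum_affEig]
    change J.1 _ ⊗ₜ[ℂ] _ = J.1 _ ⊗ₜ[ℂ] _
    rw [hJ.apply_eigProj]
    rfl
  · change comp P b (some x) p (J.1 X) ⊗ₜ[ℂ] pole 0 p = _
    have e : polePoint b (some x) = some 0 := by
      cases b <;> simp [polePoint, hx]
    rw [e, hcyc]
    cases b
    · rw [hJ.comp_false]
    · rw [hJ.comp_true]
  · change comp P b y q (J.1 X) ⊗ₜ[ℂ] pole 0 p = _
    rw [hJ.comp_ne b hq, TensorProduct.zero_tmul]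

variable (P) in
/-- The summand of `phiInf` of degree `p`. -/
def phiInfPart (N : ℕ) (p : Fin (P.ord none)) : Omega D ⊗[ℝ] gD P :=
  if hp : (p : ℕ) = 0 then 0 else psum N fun i =>
    (-(E.affEigDual (-((p : ℕ) : ℤ)) i ⊗ₜ[ℂ] ((RatFunc.X : Rat1) ^ ((p : ℕ) - 1)))) ⊗ₜ[ℝ]
      genInf p hp (E.affEig (-((p : ℕ) : ℤ)) i) (E.sigma_affEig _ i) (E.tau_affEig _ i)

theorem exists_isLaxPart_infinity (p : Fin (P.ord none)) :
    ∃ ψ, IsLaxPart none p (fun N => phiInfPart P E N p) ψ := by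
  by_cases hp : (p : ℕ) = 0
  -- There is no ε^0 coefficient at infinity, in agreement with the value 0 of `poleFun` there.
  · refine ⟨0, fun N X => ?_, fun b X => ?_, fun b y q X hq => map_zero _⟩
    · rw [phiInfPart, dif_pos hp, map_zero, map_zero]
    · simp [cyclo, poleFun, polePoint, hp]
  obtain ⟨J, hJ⟩ := exists_contHom none p (filtEnd_eigProj (D := D) (-((p : ℕ) : ℤ)))
    (filtEnd_eigProj (-((p : ℕ) : ℤ))) fun X => (genInf p hp _ (KM.sigma_eigProj_add_tau _ X)
      (KM.tau_eigProj_add_tau _ X)).2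
  change HasComp _ _ _ _ J at hJ
  have hcyc : ∀ X : KM D, cyclo D (poleFun none p) (RatFunc.X : Rat1) X
      = KM.eigProj D (-((p : ℕ) : ℤ)) X ⊗ₜ (-RatFunc.X ^ ((p : ℕ) - 1)) := fun X => by
    have h0 : poleFun none p (RatFunc.X : Rat1) = -RatFunc.X ^ ((p : ℕ) - 1) := if_neg hp
    rw [← h0]
    refine cyclo_of_homogeneous _ _ _ (fun k => ?_) X
    simp only [poleFun, if_neg hp, smul_pow, smul_neg, smul_smul]
    congr 2
    rw [← pow_succ', Nat.sub_add_cancel (by omega), ← pow_mul, ← zpow_natCast]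
    congr 1
    push_cast
    ring
  -- The sign of -z^(p-1) is put on the map, so that the rational function is a plain power.
  refine ⟨(-J) ⊗ₜ ⟨_, X_pow_mem P ((p : ℕ) - 1)⟩, fun N X => ?_, fun b X => ?_,
    fun b y q X hq => ?_⟩
  · have e0 : phiInfPart P E N p = _ := dif_neg hp
    rw [e0, psum_map]
    have e : ∀ i, contrZeta P X ((-(E.affEigDual (-((p : ℕ) : ℤ)) i ⊗ₜ[ℂ]
        ((RatFunc.X : Rat1) ^ ((p : ℕ) - 1)))) ⊗ₜ[ℝ]
        genInf p hp (E.affEig (-((p : ℕ) : ℤ)) i) (E.sigma_affEig _ i) (E.tau_affEig _ i))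
        = (-(TensorProduct.mk ℂ (WC P) Rat1).flip (RatFunc.X ^ ((p : ℕ) - 1)) ∘ₗ J.1)
          (KM.form D X (E.affEigDual (-((p : ℕ) : ℤ)) i) • E.affEig (-((p : ℕ) : ℤ)) i) :=
        fun i => by
      have e1 := KM.eigProj_of_eigen (E.sigma_affEig (-((p : ℕ) : ℤ)) i)
      rw [TensorProduct.neg_tmul, map_neg, contrZeta_tmul,
        hJ.apply_eq rfl e1 (by rw [e1, E.tau_affEig]), map_smul]
      simp [TensorProduct.smul_tmul']
    simp only [e]
    rw [← psum_map, E.psum_affEig]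
    change (-(J.1 _)) ⊗ₜ[ℂ] _ = -(J.1 _ ⊗ₜ[ℂ] _)
    rw [hJ.apply_eigProj, TensorProduct.neg_tmul]
    rfl
  · change comp P b none p (-(J.1 X)) ⊗ₜ[ℂ] (RatFunc.X ^ ((p : ℕ) - 1)) =
      cyclo D (poleFun none p) (RatFunc.X : Rat1) X
    rw [hcyc, TensorProduct.tmul_neg, map_neg, TensorProduct.neg_tmul]
    cases b
    · rw [hJ.comp_false]
    · rw [hJ.comp_true]
  · change comp P b y q (-(J.1 X)) ⊗ₜ[ℂ] _ = _
    rw [map_neg, hJ.comp_ne b hq, neg_zero, TensorProduct.zero_tmul]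

end Parts

end DihedralGaudin
end

noncomputable section
namespace DihedralGaudin

variable {𝔤 : Type*} [LieRing 𝔤] [LieAlgebra ℂ 𝔤] {D : Datum 𝔤}

/-! ### Contributions of nonzero marked points -/

section NonzeroPoints

variable {P : Points D} (E : Bases D)

theorem form_sig_tau (k : ℤ) (X Y : KM D) : KM.form D X (KM.sig D k (KM.tau Y))
    = conj (KM.form D (KM.tau (KM.sig D (-k) X)) Y) := by
  rw [KM.form_sig_right, ← KM.form_tau, KM.tau_tau]

theorem formS_iterate_smul (k : ℕ) (c : ℂ) (f : Rat1) :
    (formS D)^[k] (c • f) = c • (formS D)^[k] f := by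
  induction k with
  | zero => rfl
  | succ k ih => rw [Function.iterate_succ_apply', Function.iterate_succ_apply', ih, map_smul]

variable (P) in
/-- The rational function `sᵏ tᵇ.(z - x)^{-p-1}`. -/
def regPole (x : P.Z) (b : Bool) (k p : ℕ) : regAlg P :=
  ⟨(formS D)^[k] (pole (if b then conj (x : ℂ) else x) p), formS_iterate_pole_mem P x b k p⟩

/-- The summand of `phiC` of degree `p`. -/
def phiCPart (N : ℕ) (x : P.Z) (hx : (x : ℂ) ≠ 0) (hx' : ∀ k, D.mu k true x ≠ x)
    (p : Fin (P.ord (some x))) : Omega D ⊗[ℝ] gD P :=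
  psum N fun i =>
    (((2 * D.T : ℝ)⁻¹ • ∑ k ∈ Finset.range D.T, ∑ b : Bool,
      actOmega D k b (E.affDual i ⊗ₜ pole x p)) ⊗ₜ[ℝ] genC x hx hx' p (E.aff i) +
    ((2 * D.T : ℝ)⁻¹ • ∑ k ∈ Finset.range D.T, ∑ b : Bool,
      actOmega D k b ((-Complex.I • E.affDual i) ⊗ₜ pole x p)) ⊗ₜ[ℝ]
        genC x hx hx' p (Complex.I • E.aff i))

/-- With trivial stabiliser the two copies are independent: `J` fills the first and `J'` the second.
Summing over the basis elements I^ã and iI^ã separates complex linear from antilinear dependence, so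
rotations feed `J` with poles on the orbit of x and reflections feed `J'` with poles on the orbit of
its conjugate. -/
theorem exists_isLaxPart_complex (x : P.Z) (hx : (x : ℂ) ≠ 0) (hx' : ∀ k, D.mu k true x ≠ x)
    (p : Fin (P.ord (some x))) :
    ∃ ψ, IsLaxPart (some x) p (fun N => phiCPart E N x hx hx' p) ψ := by
  obtain ⟨J, hJ⟩ := exists_contHom (some x) p (filtEnd_id (D := D)) filtEnd_zero
    fun X => (genC x hx hx' p _).2
  obtain ⟨J', hJ'⟩ := exists_contHom (some x) p (filtEnd_zero (D := D)) filtEnd_id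
    fun X => (genC x hx hx' p _).2
  change HasComp _ _ _ _ J at hJ
  change HasComp _ _ _ _ J' at hJ'
  set G : KM D → WC P := fun Y => (1 : ℂ) ⊗ₜ[ℝ] genC x hx hx' p Y with hG
  have hφ : ∀ Y, phi P (G Y) = TD.single P (some x) p Y := fun Y => by
    rw [hG]; dsimp only; rw [phi_tmul, one_smul]; rfl
  have hφ' : ∀ Y, phi P (conjW P (G Y)) = TD.single P (some x) p Y := fun Y => by
    rw [hG]; dsimp only; rw [conjW_tmul, map_one, phi_tmul, one_smul]; rfl
  -- The factor 2 here and in `h2` cancels the one in the normalisation 1/(2T).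
  have h1 : ∀ Y, G Y + (-Complex.I) • G (Complex.I • Y) = (2 : ℂ) • J.1 Y := fun Y => by
    refine phi_conjW_ext ?_ ?_
    · rw [map_add, map_smul, map_smul, hφ, hφ, (hJ Y).1, ← TD.single_smul, ← TD.single_add,
        ← TD.single_smul]
      congr 1
      rw [smul_smul, neg_mul, Complex.I_mul_I, neg_neg, one_smul, two_smul]; rfl
    · rw [map_add, map_smulₛₗ, map_smulₛₗ, map_add, map_smul, map_smul, hφ', hφ', (hJ Y).2,
        ← TD.single_smul, ← TD.single_add, ← TD.single_smul]
      congr 1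
      rw [smul_smul, map_neg, Complex.conj_I, neg_neg, Complex.I_mul_I, neg_one_smul,
        add_neg_cancel]
      simp
  have h2 : ∀ Y, G Y + Complex.I • G (Complex.I • Y) = (2 : ℂ) • J'.1 (KM.tau Y) := fun Y => by
    refine phi_conjW_ext ?_ ?_
    · rw [map_add, map_smul, map_smul, hφ, hφ, (hJ' _).1, ← TD.single_smul, ← TD.single_add,
        ← TD.single_smul]
      congr 1
      rw [smul_smul, Complex.I_mul_I, neg_one_smul, add_neg_cancel]
      simp
    · rw [map_add, map_smulₛₗ, map_smulₛₗ, map_add, map_smul, map_smul, hφ', hφ', (hJ' _).2,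
        ← TD.single_smul, ← TD.single_add, ← TD.single_smul]
      congr 1
      rw [smul_smul, Complex.conj_I, neg_mul, Complex.I_mul_I, neg_neg, one_smul,
        LinearMap.id_apply, KM.tau_tau, map_ofNat, two_smul]
  set ψ : ContHom P ⊗[ℂ] regAlg P := (D.T : ℂ)⁻¹ • ∑ k ∈ Finset.range D.T,
    (ContHom.precomp J (KM.sig D (-k)) (filtEnd_sig _) ⊗ₜ regPole P x false k p
      + ContHom.precomp J' (KM.sig D (-k)) (filtEnd_sig _) ⊗ₜ regPole P x true k p) with hψ
  have hmap : ∀ {V : Type _} [AddCommGroup V] [Module ℂ V] (f : WC P →ₗ[ℂ] V) (X : KM D),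
      TensorProduct.map (f ∘ₗ evalHom P X) (regAlg P).val.toLinearMap ψ
      = (D.T : ℂ)⁻¹ • ∑ k ∈ Finset.range D.T,
        (f (J.1 (KM.sig D (-k) X)) ⊗ₜ[ℂ] (formS D)^[k] (pole x p)
          + f (J'.1 (KM.sig D (-k) X)) ⊗ₜ[ℂ] (formS D)^[k] (pole (conj (x : ℂ)) p)) := by
    intro V _ _ f X
    rw [hψ, map_smul, map_sum]
    simp only [map_add]
    rfl
  have hcontr : ∀ X Y (c : KM D), contrZeta P X
      (((2 * D.T : ℝ)⁻¹ • ∑ k ∈ Finset.range D.T, ∑ b : Bool,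
        actOmega D k b (c ⊗ₜ pole x p)) ⊗ₜ[ℝ] genC x hx hx' p Y)
      = (2 * D.T : ℂ)⁻¹ • ∑ k ∈ Finset.range D.T,
        ((KM.form D (KM.sig D (-k) X) c • G Y) ⊗ₜ[ℂ] (formS D)^[k] (pole x p)
        + (conj (KM.form D (KM.tau (KM.sig D (-k) X)) c) • G Y) ⊗ₜ[ℂ]
          (formS D)^[k] (pole (conj (x : ℂ)) p)) := fun X Y c => by
    rw [contrZeta_sum_tmul]
    push_cast
    congr 1
    refine Finset.sum_congr rfl fun k _ => ?_
    rw [Fintype.sum_bool, TensorProduct.add_tmul, map_add, actOmega_true_tmul, actOmega_false_tmul,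
      contrZeta_tmul, contrZeta_tmul, formT_pole, form_sig_tau, KM.form_sig_right, add_comm]
  refine ⟨ψ, fun N X => ?_, fun b X => ?_, fun b y q X hq => ?_⟩
  · refine (hmap LinearMap.id _).trans ?_
    rw [phiCPart, psum_map]
    have e : ∀ i, contrZeta P X
        (((2 * D.T : ℝ)⁻¹ • ∑ k ∈ Finset.range D.T, ∑ b : Bool,
          actOmega D k b (E.affDual i ⊗ₜ pole x p)) ⊗ₜ[ℝ] genC x hx hx' p (E.aff i) +
        ((2 * D.T : ℝ)⁻¹ • ∑ k ∈ Finset.range D.T, ∑ b : Bool,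
          actOmega D k b ((-Complex.I • E.affDual i) ⊗ₜ pole x p)) ⊗ₜ[ℝ]
            genC x hx hx' p (Complex.I • E.aff i))
        = (D.T : ℂ)⁻¹ • ∑ k ∈ Finset.range D.T,
          (J.1 (KM.form D (KM.sig D (-k) X) (E.affDual i) • E.aff i) ⊗ₜ[ℂ]
            (formS D)^[k] (pole x p)
          + J'.1 (KM.tau (KM.form D (KM.tau (KM.sig D (-k) X)) (E.affDual i) • E.aff i)) ⊗ₜ[ℂ]
            (formS D)^[k] (pole (conj (x : ℂ)) p)) := fun i => by
      rw [map_add, hcontr, hcontr, ← smul_add, ← Finset.sum_add_distrib, mul_inv,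
        mul_comm, mul_smul, Finset.smul_sum]
      congr 1
      refine Finset.sum_congr rfl fun k _ => ?_
      rw [add_add_add_comm, ← TensorProduct.add_tmul, ← TensorProduct.add_tmul]
      have e1 : ∀ a : ℂ, a • G (E.aff i) + (-Complex.I * a) • G (Complex.I • E.aff i)
          = (2 : ℂ) • J.1 (a • E.aff i) := fun a => by
        rw [map_smul, smul_comm, ← h1, smul_add, smul_smul, mul_comm]
      have e2 : ∀ a : ℂ, conj a • G (E.aff i) + conj (-Complex.I * a) • G (Complex.I • E.aff i)
          = (2 : ℂ) • J'.1 (KM.tau (a • E.aff i)) := fun a => by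
        rw [map_smulₛₗ, map_smul, smul_comm, ← h2, smul_add, smul_smul, mul_comm, map_mul, map_neg,
          Complex.conj_I, neg_neg]
      rw [map_smul, map_smul, smul_eq_mul, smul_eq_mul, e1, e2, smul_add, TensorProduct.smul_tmul',
        TensorProduct.smul_tmul', smul_smul, smul_smul, inv_mul_cancel₀ two_ne_zero, one_smul,
        one_smul]
    simp only [e]
    rw [← psum_smul, psum_sum]
    congr 1
    refine Finset.sum_congr rfl fun k _ => ?_
    rw [psum_add]
    have e3 := psum_map ((TensorProduct.mk ℂ (WC P) Rat1).flip ((formS D)^[k] (pole x p)) ∘ₗ J.1) N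
      fun i => KM.form D (KM.sig D (-k) X) (E.affDual i) • E.aff i
    have e4 := psum_map (((TensorProduct.mk ℂ (WC P) Rat1).flip
      ((formS D)^[k] (pole (conj (x : ℂ)) p)) ∘ₗ J'.1) ∘ₛₗ KM.tau) N
      fun i => KM.form D (KM.tau (KM.sig D (-k) X)) (E.affDual i) • E.aff i
    rw [E.psum_aff] at e3 e4
    rw [← KM.trunc_sig]
    -- The reflection terms expand τσ^(-k)X in the basis and then apply τ once more; the two
    -- involutions cancel.
    have e5 : KM.trunc D N (KM.sig D (-k) X)
      = KM.tau (KM.trunc D N (KM.tau (KM.sig D (-k) X))) := by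
      rw [← KM.trunc_tau, KM.tau_tau]
    refine congrArg₂ (· + ·) e3 ?_
    rw [e5]
    exact e4
  · rw [hmap]
    cases b
    · simp only [hJ.comp_false, hJ'.comp_false, LinearMap.id_apply, LinearMap.zero_apply,
        TensorProduct.zero_tmul, add_zero]
      exact (cyclo_pole (x : ℂ) p X 0).symm
    · simp only [hJ.comp_true, hJ'.comp_true, LinearMap.id_apply, LinearMap.zero_apply,
        TensorProduct.zero_tmul, zero_add]
      exact (cyclo_pole (conj (x : ℂ)) p X 0).symm
  · rw [hmap]
    simp only [hJ.comp_ne b hq, hJ'.comp_ne b hq, TensorProduct.zero_tmul, add_zero,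
      Finset.sum_const_zero, smul_zero]

/-- The summand of `phiR` of degree `p`. -/
def phiRPart (N : ℕ) (x : P.Z) (hx : (x : ℂ) ≠ 0) (k : ℕ) (hk : D.mu k true x = x)
    (p : Fin (P.ord (some x))) : Omega D ⊗[ℝ] gD P :=
  psum N fun i =>
    ((D.T : ℝ)⁻¹ • ∑ l ∈ Finset.range D.T,
      actOmega D l false (E.affRealDual k (p : ℕ) i ⊗ₜ pole x p)) ⊗ₜ[ℝ]
        genR x hx hk p (E.affReal k (p : ℕ) i) (E.act_affReal k (p : ℕ) i)

theorem poleFun_mul_smul {A : Type*} [Field A] [Algebra ℂ A] (c x : ℂ) (p : ℕ) (u : A) :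
    poleFun (some (c * x)) p (c • u) = (c ^ (p + 1))⁻¹ • poleFun (some x) p u := by
  simp only [poleFun, Algebra.smul_def, map_mul, ← mul_sub, mul_pow, mul_inv, map_inv₀, map_pow]

/-- Invariance under s^κ t ties the two copies together: one map `J` serves both, with the identity
in the first copy and ω^(κp) σ^(-κ) in the second. The average over rotations then has poles on the
orbit of x in both copies, and this orbit contains the conjugate of x. -/
theorem exists_isLaxPart_real (x : P.Z) (hx : (x : ℂ) ≠ 0) (κ : ℕ) (hκ : D.mu κ true x = x)
    (p : Fin (P.ord (some x))) :
    ∃ ψ, IsLaxPart (some x) p (fun N => phiRPart E N x hx κ hκ p) ψ := by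
  set w : ℂ := D.ω ^ ((κ : ℤ) * (p : ℕ)) with hw
  have hwconj : conj w = w⁻¹ := by rw [hw, D.conj_ω_zpow, zpow_neg]
  have hw0 : w ≠ 0 := zpow_ne_zero _ D.ω_ne_zero
  -- This is the antilinear involution whose fixed space is the real form at the point, so adding it
  -- to the identity produces elements of that form.
  have hτC : ∀ X : KM D, KM.tau ((w • KM.sig D (-κ)) X) = w⁻¹ • KM.sig D κ (KM.tau X) := fun X => by
    rw [LinearMap.smul_apply, map_smulₛₗ, hwconj, KM.tau_sig, neg_neg]
  have hsig : ∀ X : KM D, KM.sig D κ (KM.tau (KM.sig D κ (KM.tau X))) = X := fun X => by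
    rw [KM.tau_sig, KM.tau_tau, KM.sig_sig_neg]
  have hreal : ∀ X : KM D, ((KM.sigma : Module.End ℂ (KM D)) ^ κ)
      (KM.tau (X + KM.tau ((w • KM.sig D (-κ)) X))) = D.ω ^ ((κ : ℤ) * (p : ℕ)) •
      (X + KM.tau ((w • KM.sig D (-κ)) X)) := fun X => by
    rw [← KM.sig_natCast, hτC, map_add, map_add, map_smulₛₗ, map_smul, hsig, map_inv₀, hwconj,
      inv_inv, ← hw, smul_add, smul_smul, mul_inv_cancel₀ hw0, one_smul, add_comm]
  obtain ⟨J, hJ⟩ := exists_contHom (some x) p (filtEnd_id (D := D)) ((filtEnd_sig (-κ)).smul w)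
    fun X => (genR x hx hκ p _ (hreal X)).2
  change HasComp _ _ _ _ J at hJ
  set ψ : ContHom P ⊗[ℂ] regAlg P := (D.T : ℂ)⁻¹ • ∑ k ∈ Finset.range D.T,
    (ContHom.precomp J (KM.sig D (-k)) (filtEnd_sig _) ⊗ₜ regPole P x false k p) with hψ
  have hmap : ∀ {V : Type _} [AddCommGroup V] [Module ℂ V] (f : WC P →ₗ[ℂ] V) (X : KM D),
      TensorProduct.map (f ∘ₗ evalHom P X) (regAlg P).val.toLinearMap ψ
      = (D.T : ℂ)⁻¹ • ∑ k ∈ Finset.range D.T,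
        f (J.1 (KM.sig D (-k) X)) ⊗ₜ[ℂ] (formS D)^[k] (pole x p) := by
    intro V _ _ f X
    rw [hψ, map_smul, map_sum]
    rfl
  refine ⟨ψ, fun N X => ?_, fun b X => ?_, fun b y q X hq => ?_⟩
  · refine (hmap LinearMap.id _).trans ?_
    rw [phiRPart, psum_map]
    have e : ∀ i, contrZeta P X (((D.T : ℝ)⁻¹ • ∑ l ∈ Finset.range D.T,
        actOmega D l false (E.affRealDual κ (p : ℕ) i ⊗ₜ pole x p)) ⊗ₜ[ℝ]
          genR x hx hκ p (E.affReal κ (p : ℕ) i) (E.act_affReal κ (p : ℕ) i))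
        = (D.T : ℂ)⁻¹ • ∑ k ∈ Finset.range D.T,
          J.1 (KM.form D (KM.sig D (-k) X) (E.affRealDual κ (p : ℕ) i) • E.affReal κ (p : ℕ) i)
            ⊗ₜ[ℂ] (formS D)^[k] (pole x p) := fun i => by
      rw [contrZeta_sum_tmul]
      push_cast
      congr 1
      refine Finset.sum_congr rfl fun k _ => ?_
      have e0 : KM.tau ((w • KM.sig D (-κ)) (E.affReal κ (p : ℕ) i)) = E.affReal κ (p : ℕ) i := by
        rw [hτC, KM.sig_natCast, E.act_affReal, ← hw, smul_smul, inv_mul_cancel₀ hw0, one_smul]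
      rw [actOmega_false_tmul, contrZeta_tmul, KM.form_sig_right, map_smul,
        hJ.apply_eq (X := E.affReal κ (p : ℕ) i) rfl rfl e0]
    simp only [e]
    rw [← psum_smul, psum_sum]
    congr 1
    refine Finset.sum_congr rfl fun k _ => ?_
    have e3 := psum_map ((TensorProduct.mk ℂ (WC P) Rat1).flip ((formS D)^[k] (pole x p)) ∘ₗ J.1) N
      fun i => KM.form D (KM.sig D (-k) X) (E.affRealDual κ (p : ℕ) i) • E.affReal κ (p : ℕ) i
    rw [E.psum_affReal] at e3
    rw [← KM.trunc_sig]
    exact e3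
  · rw [hmap]
    cases b
    · simp only [hJ.comp_false, LinearMap.id_apply]
      exact (cyclo_pole (x : ℂ) p X 0).symm
    · simp only [hJ.comp_true]
      -- Shifting the cyclic sum by κ accounts for the extra σ^(-κ) in the second copy.
      refine Eq.trans ?_ (cyclo_pole (conj (x : ℂ)) p X κ).symm
      congr 1
      refine Finset.sum_congr rfl fun k _ => ?_
      -- Rotating the pole at the conjugate point by s^κ gives the pole at x, up to ω^(-κ)
      -- ω^(κ(p+1)) = ω^(κp), which is the phase built into the second copy.
      have hpole : (formS D)^[κ] (pole (conj (x : ℂ)) p) = w • pole x p := by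
        have hx1 : conj (x : ℂ) = D.ω ^ (-(κ : ℤ)) * x := by
          conv_rhs => rw [← hκ]
          rw [Datum.mu, if_pos rfl, ← mul_assoc, ← zpow_natCast, ← zpow_add₀ D.ω_ne_zero,
            neg_add_cancel, zpow_zero, one_mul]
        rw [formS_iterate_pole, hx1, poleFun_mul_smul, smul_smul, pole_eq_poleFun, hw]
        congr 1
        rw [← zpow_natCast, ← zpow_mul, ← zpow_neg, ← zpow_add₀ D.ω_ne_zero]
        congr 1
        push_cast
        ring
      have hκk : (-(κ : ℤ) + -(k : ℤ)) = -((k + κ : ℕ) : ℤ) := by push_cast; ring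
      rw [Function.iterate_add_apply, hpole, formS_iterate_smul, LinearMap.smul_apply,
        ← KM.sig_add, hκk, TensorProduct.tmul_smul, TensorProduct.smul_tmul']
  · rw [hmap]
    simp only [hJ.comp_ne b hq, TensorProduct.zero_tmul, Finset.sum_const_zero, smul_zero]

end NonzeroPoints

/-! ## The Lax matrix -/

section Existence

variable (P : Points D) (E : Bases D)

open Classical in
/-- The summand of the canonical element attached to a marked point and a power of `ε`. -/
def phiPart (N : ℕ) : (s : (y : Option P.Z) × Fin (P.ord y)) → Omega D ⊗[ℝ] gD P
  | ⟨some x, p⟩ => if hx : (x : ℂ) = 0 then phiOPart E N x p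
    else if hk : ∃ k, D.mu k true x = x then phiRPart E N x hx hk.choose hk.choose_spec p
    else phiCPart E N x hx (not_exists.1 hk) p
  | ⟨none, p⟩ => phiInfPart P E N p

theorem exists_isLaxPart (s : (y : Option P.Z) × Fin (P.ord y)) :
    ∃ ψ, IsLaxPart s.1 s.2 (fun N => phiPart P E N s) ψ := by
  obtain ⟨_ | x, p⟩ := s
  · exact exists_isLaxPart_infinity E p
  · simp only [phiPart]
    split_ifs with hx hk
    · exact exists_isLaxPart_origin E x hx p
    · exact exists_isLaxPart_real E x hx _ hk.choose_spec p
    · exact exists_isLaxPart_complex E x hx _ p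

theorem Phi_eq_sum (N : ℕ) : Phi P E N = ∑ s, phiPart P E N s := by
  rw [Fintype.sum_sigma, Fintype.sum_option, add_comm]
  unfold Phi
  congr 1
  refine Finset.sum_congr rfl fun x _ => ?_
  simp only [phiPart]
  split_ifs <;> rfl

/-- The family is the sum of its parts over all marked points and powers of ε. Agreement with ζ(Φ)
may be tested after contraction with ⟨X, ·⟩, where it is additive over the parts, and only one part
contributes to any given component. -/
theorem exists_lax : ∃ 𝒥 : ContHom P ⊗[ℂ] regAlg P,
    (∀ N, TensorProduct.map (canonSeq E N ∘ₗ (ContHom P).subtype) (regAlg P).val.toLinearMap 𝒥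
      = zeta P (Phi P E N)) ∧
    ∀ b y q X, TensorProduct.map (comp P b y q ∘ₗ evalHom P X) (regAlg P).val.toLinearMap 𝒥
      = cyclo D (poleFun (polePoint b y) q) RatFunc.X X := by
  choose ψ hψ using exists_isLaxPart P E
  refine ⟨∑ s, ψ s, fun N => ?_, fun b y q X => ?_⟩
  · refine tensor_separating_eq (fun X => contract (KM.form D X)) contract_form_separating
      fun X => ?_
    rw [← LinearMap.comp_apply, ← TensorProduct.map_comp, ← contrZeta_apply, Phi_eq_sum, map_sum,
      map_sum]
    refine Finset.sum_congr rfl fun s _ => ?_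
    rw [← (hψ s).contr]
    congr 2
    ext1 J
    exact contract_canonSeq E N J.1 X
  · rw [map_sum, Finset.sum_eq_single_of_mem ⟨y, q⟩ (Finset.mem_univ _)]
    · exact (hψ ⟨y, q⟩).comp_self b X
    · rintro ⟨y', q'⟩ _ hne
      refine (hψ ⟨y', q'⟩).comp_ne b y q X ?_
      rintro ⟨rfl, h⟩
      exact hne (by rw [Fin.ext h])

end Existence

end DihedralGaudin
end

theorem mainTheorem1 {𝔤 : Type*} [LieRing 𝔤] [LieAlgebra ℂ 𝔤] [FiniteDimensional ℂ 𝔤]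
    (D : DihedralGaudin.Datum 𝔤) (P : DihedralGaudin.Points D) (E : DihedralGaudin.Bases D) :
    ∃ L : DihedralGaudin.FF P ⊗[ℂ] DihedralGaudin.regAlg P,
      DihedralGaudin.IsFormalLax P E L ∧
      (∀ L', DihedralGaudin.IsFormalLax P E L' → L' = L) ∧
      DihedralGaudin.poisson₁₂ P (DihedralGaudin.laxAt P 0 L) (DihedralGaudin.laxAt P 1 L) =
        DihedralGaudin.bracket₁₂₁ P
            (DihedralGaudin.rMat E (DihedralGaudin.coord 0) (DihedralGaudin.coord 1))
            (DihedralGaudin.laxAt P 0 L)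
          - DihedralGaudin.bracket₂₁₂ P
            (DihedralGaudin.rMat E (DihedralGaudin.coord 1) (DihedralGaudin.coord 0))
            (DihedralGaudin.laxAt P 1 L) :=
by
  obtain ⟨𝒥, h, h'⟩ := DihedralGaudin.exists_lax P E
  have hL := DihedralGaudin.isFormalLax_laxOf E h
  exact ⟨DihedralGaudin.laxOf E 𝒥, hL, fun _ hL' => DihedralGaudin.isFormalLax_unique E hL hL',
    DihedralGaudin.poisson_laxOf E h'⟩
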